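/- **Theorem 2.1.** Let $0<H<\tfrac12$ and, for $0<s<t$, put $$K_{H,1}(t,s)=c_H\,t^{H-\frac12}s^{\frac12-H}(t-s)^{H-\frac12},\qquad K_{H,2}(t,s)=c_H\left(\tfrac12-H\right)s^{\frac12-H}\int_s^t u^{H-\frac32}(u-s)^{H-\frac12}\,du,$$ where $c_H=\Big(\frac{2H}{(1-2H)\,\beta(1-2H,\,H+\frac12)}\Big)^{1/2}$ and $\beta$ is Euler's beta function. For $T>0$ and $\lambda>0$ let $\mathbf C^\lambda_0$ be the space of $\lambda$-Hölder continuous functions $f:[0,T]\to\mathbb R$ with $f(0)=0$, normed by $\|f\|_\lambda=\sup_{0<s<r\le T}|f(r)-f(s)|/|r-s|^\lambda$, and put $$(\Lambda_Hf)(t)=\int_0^t[f(t)-f(s)]\,\partial_sK_{H,1}(t,s)\,ds-\int_0^t\partial_sK_{H,2}(t,s)\,f(s)\,ds,\qquad 0\le t\le T .$$ (a) For every $\lambda\in(\tfrac12-H,\tfrac12)$ there is a constant $C$, depending only on $H$ and $\lambda$, such that for all $T>0$ and $f\in\mathbf C_0^\lambda$ both integrals converge absolutely for every $t\in[0,T]$,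 $\Lambda_Hf$ is continuous on $[0,T]$, and $\sup_{0\le t\le T}|(\Lambda_Hf)(t)|\le C\,T^{H-\frac12+\lambda}\|f\|_\lambda$; moreover $\Lambda_H$ is linear on $\mathbf C_0^\lambda$. (b) Let $T>0$ and let $B_H=(B_H(t))_{0\le t\le T}$ be a fractional Brownian motion with exponent $H$ on a probability space $(\Omega,\mathcal F,\mathbb P)$, that is, a centered Gaussian process with $\mathbb E[B_H(s)B_H(t)]=\frac12\left(s^{2H}+t^{2H}-|t-s|^{2H}\right)$. Then there is a real-valued standard Brownian motion $B=(B(t))_{0\le t\le T}$ on the same probability space such that almost surely the path of $B$ lies in $\mathbf C_0^\lambda$ for every $\lambda\in(\frac12-H,\frac12)$, and for every $t\in[0,T]$ $$B_H(t)=(\Lambda_HB)(t)\quad\text{almost surely.}$$ If $B_H$ has almost surely continuous paths, then almost surely this identity holds for all $t\in[0,T]$ simultaneously. -/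

import Mathlib

open MeasureTheory ProbabilityTheory Set

noncomputable section

/-- The positive normalizing constant `c_H = (2H / ((1 - 2H) β(1 - 2H, H + 1/2)))^{1/2}` of the
Volterra kernel of fractional Brownian motion with `0 < H < 1/2`; here `β` is Euler's beta
function. -/
def volterraConst (H : ℝ) : ℝ :=
  √(2 * H / ((1 - 2 * H) * ProbabilityTheory.beta (1 - 2 * H) (H + 1 / 2)))

/-- The first part `K_{H,1}(t,s)` of the Volterra kernel, meant for `0 < s < t`. -/
def kernelOne (H t s : ℝ) : ℝ :=
  volterraConst H * t ^ (H - 1 / 2) * s ^ (1 / 2 - H) * (t - s) ^ (H - 1 / 2)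

/-- The second part `K_{H,2}(t,s)` of the Volterra kernel, meant for `0 < s < t`. -/
def kernelTwo (H t s : ℝ) : ℝ :=
  volterraConst H * (1 / 2 - H) * s ^ (1 / 2 - H) *
    ∫ u in s..t, u ^ (H - 3 / 2) * (u - s) ^ (H - 1 / 2)

/-- `(Λ_H f)(t) = ∫₀ᵗ [f(t) - f(s)] ∂ₛK_{H,1}(t,s) ds - ∫₀ᵗ ∂ₛK_{H,2}(t,s) f(s) ds`. -/
def fracOp (H : ℝ) (f : ℝ → ℝ) (t : ℝ) : ℝ :=
  (∫ s in (0 : ℝ)..t, (f t - f s) * deriv (fun r => kernelOne H t r) s) -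
    ∫ s in (0 : ℝ)..t, deriv (fun r => kernelTwo H t r) s * f s

/-- Both integrals in the definition of `(Λ_H f)(t)` converge absolutely. -/
def FracOpConverges (H : ℝ) (f : ℝ → ℝ) (t : ℝ) : Prop :=
  IntervalIntegrable (fun s => (f t - f s) * deriv (fun r => kernelOne H t r) s) volume 0 t ∧
    IntervalIntegrable (fun s => deriv (fun r => kernelTwo H t r) s * f s) volume 0 t

/-- The space `C_0^lam` of `lam`-Hölder continuous functions on `[0,T]` vanishing at `0`
(the values of `f` outside `[0,T]` are irrelevant). -/
def MemHolderZero (lam T : ℝ) (f : ℝ → ℝ) : Prop :=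
  f 0 = 0 ∧ ∃ M : ℝ, ∀ s ∈ Icc 0 T, ∀ r ∈ Icc 0 T, |f r - f s| ≤ M * |r - s| ^ lam

/-- The norm `‖f‖_lam = sup_{0 < s < r ≤ T} |f(r) - f(s)| / |r - s|^lam`. -/
def holderNorm (lam T : ℝ) (f : ℝ → ℝ) : ℝ :=
  sSup {x : ℝ | ∃ s r : ℝ, 0 < s ∧ s < r ∧ r ≤ T ∧ x = |f r - f s| / |r - s| ^ lam}

/-- `B` is a standard Brownian motion on the time interval `[0,T]`
(the values of `B` at times outside `[0,T]` are irrelevant). -/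
structure IsBrownianOn {Ω : Type*} [MeasurableSpace Ω] (T : ℝ) (B : ℝ → Ω → ℝ)
    (P : Measure Ω) : Prop where
  zero : ∀ᵐ ω ∂P, B 0 ω = 0
  indep : HasIndepIncrements (fun t : Icc (0 : ℝ) T => B t) P
  law : ∀ s ∈ Icc 0 T, ∀ t ∈ Icc 0 T, s ≤ t →
    HasLaw (fun ω => B t ω - B s ω) (gaussianReal 0 (t - s).toNNReal) P
  cont : ∀ᵐ ω ∂P, ContinuousOn (fun t => B t ω) (Icc 0 T)

/-- `X` is a fractional Brownian motion with exponent `H` on the time interval `[0,T]`: a centered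
Gaussian process with covariance `(s^{2H} + t^{2H} - |t - s|^{2H}) / 2`. Continuity of paths is not
required (the values of `X` at times outside `[0,T]` are irrelevant). -/
structure IsFracBrownianOn {Ω : Type*} [MeasurableSpace Ω] (H T : ℝ) (X : ℝ → Ω → ℝ)
    (P : Measure Ω) : Prop where
  gaussian : IsGaussianProcess (fun t : Icc (0 : ℝ) T => X t) P
  centered : ∀ t ∈ Icc 0 T, ∫ ω, X t ω ∂P = 0
  covariance : ∀ s ∈ Icc 0 T, ∀ t ∈ Icc 0 T,
    cov[X s, X t; P] = (s ^ (2 * H) + t ^ (2 * H) - |t - s| ^ (2 * H)) / 2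

end

/-!
The kernel `K_H = K_{H,1} + K_{H,2}` is, up to a constant and the weights `s ^ (H - 1/2)` and
`r ^ (1/2 - H)`, a composition of fractional integrals. Beta integrals then give
`∫ K_H(s,u) K_H(t,u) du = (s^{2H} + t^{2H} - |t - s|^{2H}) / 2`, and Abel inversion shows that the
vectors `K_H(t, ·)` are total in `L²(0, T)`. Hence `K_H(t, ·) ↦ X_t` extends to an isometry `I` of
`L²(0, T)` into a Gaussian subspace of `L²(P)`, and `B` is a continuous modification of
`t ↦ I(1_{(0,t]})`. Since `K_{H,1}(t, ·)` vanishes at `0` and `K_{H,2}(t, ·)` at `t`, writing the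
two kernels as integrals of their derivatives and exchanging these with `I` turns
`X_t = I(K_H(t, ·))` into `(Λ_H B)(t)`.

The derivative of `K_{H,1}(t, ·)` has a nonintegrable singularity `(t - s) ^ (H - 3/2)` at `t`, and
that of `K_{H,2}(t, ·)` a nonintegrable singularity `s ^ (H - 3/2)` at `0`. The increments of `f` at
these points compensate them as soon as `lam > 1/2 - H`, and scaling produces the power of `T`.
-/

noncomputable section

open Filter
open scoped ENNReal NNReal Topology

/-! ### Truncated powers and beta integrals -/

/-- The truncated power `x₊ ^ a`, which vanishes for `x ≤ 0` whatever the exponent; it encodes the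
limits of integration of the fractional integrals below. -/
def posRpow (a x : ℝ) : ℝ := if 0 < x then x ^ a else 0

/-- The truncated power `x₊ ^ a` as an extended nonnegative real, for use in Lebesgue integrals. -/
def eposRpow (a x : ℝ) : ℝ≥0∞ := ENNReal.ofReal (posRpow a x)

lemma posRpow_of_pos {a x : ℝ} (hx : 0 < x) : posRpow a x = x ^ a := if_pos hx

lemma posRpow_of_nonpos {a x : ℝ} (hx : x ≤ 0) : posRpow a x = 0 := if_neg hx.not_gt

lemma posRpow_nonneg (a x : ℝ) : 0 ≤ posRpow a x := by
  unfold posRpow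
  split_ifs with hx
  exacts [Real.rpow_nonneg hx.le a, le_rfl]

@[fun_prop]
lemma measurable_posRpow (a : ℝ) : Measurable (posRpow a) :=
  Measurable.ite measurableSet_Ioi (by fun_prop) (by fun_prop)

lemma posRpow_mul_posRpow (a b x : ℝ) : posRpow a x * posRpow b x = posRpow (a + b) x := by
  rcases le_or_gt x 0 with hx | hx
  · simp only [posRpow_of_nonpos hx, mul_zero]
  · simp only [posRpow_of_pos hx, Real.rpow_add hx]

lemma posRpow_zero {x : ℝ} (hx : 0 < x) : posRpow 0 x = 1 := by
  rw [posRpow_of_pos hx, Real.rpow_zero]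

lemma posRpow_const_mul {c : ℝ} (hc : 0 < c) (a x : ℝ) :
    posRpow a (c * x) = c ^ a * posRpow a x := by
  rcases le_or_gt x 0 with hx | hx
  · rw [posRpow_of_nonpos hx, posRpow_of_nonpos (mul_nonpos_of_nonneg_of_nonpos hc.le hx), mul_zero]
  · rw [posRpow_of_pos hx, posRpow_of_pos (mul_pos hc hx), Real.mul_rpow hc.le hx.le]

lemma eposRpow_of_pos {a x : ℝ} (hx : 0 < x) : eposRpow a x = ENNReal.ofReal (x ^ a) := by
  rw [eposRpow, posRpow_of_pos hx]

lemma eposRpow_of_nonpos {a x : ℝ} (hx : x ≤ 0) : eposRpow a x = 0 := by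
  rw [eposRpow, posRpow_of_nonpos hx, ENNReal.ofReal_zero]

lemma eposRpow_ne_top (a x : ℝ) : eposRpow a x ≠ ⊤ := ENNReal.ofReal_ne_top

@[fun_prop]
lemma measurable_eposRpow (a : ℝ) : Measurable (eposRpow a) :=
  (measurable_posRpow a).ennreal_ofReal

lemma eposRpow_mul_eposRpow (a b x : ℝ) : eposRpow a x * eposRpow b x = eposRpow (a + b) x := by
  simp only [eposRpow, ← ENNReal.ofReal_mul (posRpow_nonneg _ _), posRpow_mul_posRpow]

lemma eposRpow_const_mul {c : ℝ} (hc : 0 < c) (a x : ℝ) :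
    eposRpow a (c * x) = eposRpow a c * eposRpow a x := by
  rw [eposRpow_of_pos hc, eposRpow, eposRpow, posRpow_const_mul hc,
    ENNReal.ofReal_mul (by positivity)]

lemma eposRpow_mul_eposRpow_sub_eq_zero {s t r : ℝ} (hr : r ∉ Ioo s t) (a b : ℝ) :
    eposRpow a (r - s) * eposRpow b (t - r) = 0 := by
  rcases le_or_gt r s with h | h
  · rw [eposRpow_of_nonpos (sub_nonpos.2 h), zero_mul]
  · rw [eposRpow_of_nonpos (x := t - r) (sub_nonpos.2 (not_lt.1 fun h' => hr ⟨h, h'⟩)), mul_zero]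

lemma beta_comm (a b : ℝ) : beta a b = beta b a := by
  simp only [beta, mul_comm, add_comm]

lemma lintegral_comp_const_add_mul (f : ℝ → ℝ≥0∞) (s : ℝ) {c : ℝ} (hc : c ≠ 0) :
    ENNReal.ofReal |c| * ∫⁻ v, f (s + c * v) = ∫⁻ r, f r := by
  have hmap := lintegral_map_equiv (μ := volume) (fun r => f (s + r))
    (Homeomorph.mulLeft₀ c hc).toMeasurableEquiv
  rw [← lintegral_add_left_eq_self f s]
  conv_rhs => rw [← Real.smul_map_volume_mul_left hc, lintegral_smul_measure]
  exact congrArg _ hmap.symm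

lemma lintegral_beta_unit {a b : ℝ} (ha : 0 < a) (hb : 0 < b) :
    ∫⁻ v, eposRpow (a - 1) v * eposRpow (b - 1) (1 - v) = ENNReal.ofReal (beta a b) := by
  have hpdf : ∀ v, eposRpow (a - 1) v * eposRpow (b - 1) (1 - v)
      = ENNReal.ofReal (beta a b) * betaPDF a b v := by
    intro v
    rw [betaPDF_eq]
    split_ifs with hv
    · rw [eposRpow_of_pos hv.1, eposRpow_of_pos (sub_pos.2 hv.2),
        ← ENNReal.ofReal_mul (Real.rpow_nonneg hv.1.le _), ← ENNReal.ofReal_mul (beta_pos ha hb).le]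
      congr 1
      field_simp [(beta_pos ha hb).ne']
    · simpa using eposRpow_mul_eposRpow_sub_eq_zero hv (a - 1) (b - 1)
  simp_rw [hpdf]
  rw [lintegral_const_mul' _ _ ENNReal.ofReal_ne_top, lintegral_betaPDF_eq_one ha hb, mul_one]

lemma lintegral_beta {a b : ℝ} (ha : 0 < a) (hb : 0 < b) (s t : ℝ) :
    ∫⁻ r, eposRpow (a - 1) (r - s) * eposRpow (b - 1) (t - r)
      = ENNReal.ofReal (beta a b) * eposRpow (a + b - 1) (t - s) := by
  rcases le_or_gt t s with hts | hst
  · rw [eposRpow_of_nonpos (x := t - s) (sub_nonpos.2 hts), mul_zero]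
    simp_rw [fun r => eposRpow_mul_eposRpow_sub_eq_zero (r := r)
      (fun h => (h.1.trans h.2).not_ge hts) (a - 1) (b - 1), lintegral_zero]
  set c := t - s with hc_def
  have hc : 0 < c := sub_pos.2 hst
  have hscale : ∀ v, eposRpow (a - 1) (s + c * v - s) * eposRpow (b - 1) (t - (s + c * v))
      = eposRpow (a + b - 2) c * (eposRpow (a - 1) v * eposRpow (b - 1) (1 - v)) := by
    intro v
    rw [show s + c * v - s = c * v by ring, show t - (s + c * v) = c * (1 - v) by rw [hc_def]; ring,
      eposRpow_const_mul hc, eposRpow_const_mul hc,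
      show a + b - 2 = (a - 1) + (b - 1) by ring, ← eposRpow_mul_eposRpow]
    ring
  rw [← lintegral_comp_const_add_mul _ s hc.ne']
  simp_rw [hscale]
  rw [lintegral_const_mul' _ _ (eposRpow_ne_top _ _), lintegral_beta_unit ha hb, abs_of_pos hc,
    ← mul_assoc, mul_comm _ (ENNReal.ofReal (beta a b)), ← Real.rpow_one c, ← eposRpow_of_pos hc,
    Real.rpow_one, eposRpow_mul_eposRpow]
  ring_nf

lemma bijOn_Ioo_mobius {z : ℝ} (hz : 0 < z) :
    BijOn (fun v => v * (1 + z) / (z + v)) (Ioo 0 1) (Ioo 0 1) := by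
  refine InvOn.bijOn (f' := fun w => w * z / (1 + z - w)) ⟨?_, ?_⟩ ?_ ?_
  · rintro v ⟨hv, -⟩
    have h : 1 + z - v * (1 + z) / (z + v) = z * (1 + z) / (z + v) := by field_simp; ring
    simp only [h]
    field_simp
  · rintro w ⟨hw0, hw1⟩
    have hw : 0 < 1 + z - w := by linarith
    have h : z + w * z / (1 + z - w) = z * (1 + z) / (1 + z - w) := by field_simp; ring
    simp only [h]
    field_simp
  · rintro v ⟨hv0, hv1⟩
    refine ⟨by positivity, ?_⟩
    rw [div_lt_one (by positivity)]
    nlinarith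
  · rintro w ⟨hw0, hw1⟩
    have hw : 0 < 1 + z - w := by linarith
    refine ⟨by positivity, ?_⟩
    rw [div_lt_one hw]
    nlinarith

lemma deriv_mobius_mul_beta_integrand {z v : ℝ} (hz : 0 < z) (hv : 0 < v) (a b : ℝ) :
    ENNReal.ofReal |z * (1 + z) / (z + v) ^ 2| *
      (eposRpow (a - 1) (v * (1 + z) / (z + v)) * eposRpow (b - 1) (1 - v * (1 + z) / (z + v)))
      = ENNReal.ofReal ((1 + z) ^ a * z ^ b) *
        (eposRpow (a - 1) v * eposRpow (b - 1) (1 - v) * eposRpow (-(a + b)) (z + v)) := by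
  have hconst : z * (1 + z) / (z + v) ^ 2 * ((1 + z) / (z + v)) ^ (a - 1) *
      (z / (z + v)) ^ (b - 1) = (1 + z) ^ a * z ^ b * (z + v) ^ (-(a + b)) := by
    rw [Real.div_rpow (by positivity) (by positivity), Real.div_rpow hz.le (by positivity),
      Real.rpow_neg (by positivity), Real.rpow_add (by positivity),
      Real.rpow_sub_one (by positivity), Real.rpow_sub_one (by positivity),
      Real.rpow_sub_one (by positivity), Real.rpow_sub_one (by positivity)]
    field_simp
  rw [show v * (1 + z) / (z + v) = (1 + z) / (z + v) * v by ring,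
    show 1 - (1 + z) / (z + v) * v = z / (z + v) * (1 - v) by field_simp; ring,
    eposRpow_const_mul (by positivity), eposRpow_const_mul (by positivity),
    eposRpow_of_pos (by positivity : 0 < (1 + z) / (z + v)),
    eposRpow_of_pos (by positivity : 0 < z / (z + v)),
    eposRpow_of_pos (by positivity : 0 < z + v), abs_of_nonneg (by positivity)]
  calc _ = ENNReal.ofReal (z * (1 + z) / (z + v) ^ 2 * ((1 + z) / (z + v)) ^ (a - 1) *
        (z / (z + v)) ^ (b - 1)) * (eposRpow (a - 1) v * eposRpow (b - 1) (1 - v)) := by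
        rw [ENNReal.ofReal_mul (by positivity), ENNReal.ofReal_mul (by positivity)]
        ring
    _ = _ := by
        rw [hconst, ENNReal.ofReal_mul (by positivity)]
        ring

/- The substitution `w = v (1 + z) / (z + v)` maps `(0, 1)` to itself and absorbs the factor
`(z + v) ^ (-(a + b))`. -/
lemma lintegral_beta_mul_add_rpow {a b z : ℝ} (ha : 0 < a) (hb : 0 < b) (hz : 0 < z) :
    ∫⁻ v, eposRpow (a - 1) v * eposRpow (b - 1) (1 - v) * eposRpow (-(a + b)) (z + v)
      = ENNReal.ofReal (beta a b) * ENNReal.ofReal ((1 + z) ^ (-a) * z ^ (-b)) := by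
  have hzero : ∀ v ∉ Ioo (0 : ℝ) 1, eposRpow (a - 1) v * eposRpow (b - 1) (1 - v) = 0 :=
    fun v hv => by simpa using eposRpow_mul_eposRpow_sub_eq_zero hv (a - 1) (b - 1)
  have hderiv : ∀ v ∈ Ioo (0 : ℝ) 1, HasDerivWithinAt (fun v => v * (1 + z) / (z + v))
      (z * (1 + z) / (z + v) ^ 2) (Ioo 0 1) v := by
    rintro v ⟨hv, -⟩
    have h := ((hasDerivAt_id v).mul_const (1 + z)).div ((hasDerivAt_id v).const_add z)
      (by simp only [id]; positivity)
    refine (h.congr_deriv ?_).hasDerivWithinAt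
    simp only [id]
    ring
  have hsubst := lintegral_image_eq_lintegral_abs_deriv_mul measurableSet_Ioo hderiv
    (bijOn_Ioo_mobius hz).injOn (fun w => eposRpow (a - 1) w * eposRpow (b - 1) (1 - w))
  rw [(bijOn_Ioo_mobius hz).image_eq,
    setLIntegral_eq_of_support_subset fun v hv => by_contra fun h => hv (hzero v h),
    lintegral_beta_unit ha hb] at hsubst
  rw [setLIntegral_congr_fun measurableSet_Ioo
      fun v hv => deriv_mobius_mul_beta_integrand hz hv.1 a b,
    lintegral_const_mul' _ _ ENNReal.ofReal_ne_top, setLIntegral_eq_of_support_subset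
      fun v hv => by_contra fun h => hv (by simp only [hzero v h, zero_mul])] at hsubst
  rw [hsubst, mul_comm, ← mul_assoc, ← ENNReal.ofReal_mul (by positivity),
    Real.rpow_neg (by positivity), Real.rpow_neg hz.le, ← mul_inv,
    inv_mul_cancel₀ (by positivity), ENNReal.ofReal_one, one_mul]

lemma lintegral_beta_three {a b r r' : ℝ} (ha : 0 < a) (hb : 0 < b) (hr : 0 < r) (hrr' : r < r') :
    ∫⁻ u, eposRpow (a - 1) u * eposRpow (b - 1) (r - u) * eposRpow (-(a + b)) (r' - u)
      = ENNReal.ofReal (beta a b) *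
        ENNReal.ofReal (r ^ (a + b - 1) * (r' - r) ^ (-a) * r' ^ (-b)) := by
  have hz : 0 < (r' - r) / r := div_pos (sub_pos.2 hrr') hr
  have hscale : ∀ v, eposRpow (a - 1) (r + -r * v) * eposRpow (b - 1) (r - (r + -r * v)) *
      eposRpow (-(a + b)) (r' - (r + -r * v)) = eposRpow (-2) r *
        (eposRpow (b - 1) v * eposRpow (a - 1) (1 - v) *
          eposRpow (-(b + a)) ((r' - r) / r + v)) := by
    intro v
    rw [show r + -r * v = r * (1 - v) by ring, show r - r * (1 - v) = r * v by ring,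
      show r' - r * (1 - v) = r * ((r' - r) / r + v) by field_simp; ring,
      eposRpow_const_mul hr, eposRpow_const_mul hr, eposRpow_const_mul hr,
      show (-2 : ℝ) = (a - 1) + (b - 1) + -(a + b) by ring, ← eposRpow_mul_eposRpow,
      ← eposRpow_mul_eposRpow, add_comm b a]
    ring
  rw [← lintegral_comp_const_add_mul _ r (neg_ne_zero.2 hr.ne')]
  simp_rw [hscale]
  rw [lintegral_const_mul' _ _ (eposRpow_ne_top _ _), lintegral_beta_mul_add_rpow hb ha hz,
    beta_comm, abs_neg, abs_of_pos hr, eposRpow_of_pos hr,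
    mul_left_comm _ (ENNReal.ofReal (beta _ _)), mul_left_comm,
    ← ENNReal.ofReal_mul (by positivity), ← ENNReal.ofReal_mul hr.le]
  congr 2
  have hr' : 0 < r' := hr.trans hrr'
  rw [show 1 + (r' - r) / r = r' / r by field_simp; ring, Real.div_rpow hr'.le hr.le,
    Real.div_rpow (sub_pos.2 hrr').le hr.le, Real.rpow_sub_one hr.ne', Real.rpow_add hr,
    Real.rpow_neg hr.le a, Real.rpow_neg hr.le b,
    show (-2 : ℝ) = ((-2 : ℤ) : ℝ) by norm_num, Real.rpow_intCast]
  field_simp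

/-! ### The Volterra kernel -/

/-- The density of the unnormalized beta distribution, `v ^ (a - 1) * (1 - v) ^ (b - 1)` on `(0, 1)`
and `0` elsewhere. -/
def betaWeight (a b v : ℝ) : ℝ := posRpow (a - 1) v * posRpow (b - 1) (1 - v)

lemma betaWeight_of_mem {a b v : ℝ} (hv : v ∈ Ioo (0 : ℝ) 1) :
    betaWeight a b v = v ^ (a - 1) * (1 - v) ^ (b - 1) := by
  rw [betaWeight, posRpow_of_pos hv.1, posRpow_of_pos (sub_pos.2 hv.2)]

lemma betaWeight_nonneg (a b v : ℝ) : 0 ≤ betaWeight a b v :=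
  mul_nonneg (posRpow_nonneg _ _) (posRpow_nonneg _ _)

@[fun_prop]
lemma measurable_betaWeight (a b : ℝ) : Measurable (betaWeight a b) := by
  unfold betaWeight
  fun_prop

lemma lintegral_betaWeight {a b : ℝ} (ha : 0 < a) (hb : 0 < b) :
    ∫⁻ v, ENNReal.ofReal (betaWeight a b v) = ENNReal.ofReal (beta a b) := by
  simp_rw [betaWeight, ENNReal.ofReal_mul (posRpow_nonneg _ _)]
  exact lintegral_beta_unit ha hb

lemma integrable_betaWeight {a b : ℝ} (ha : 0 < a) (hb : 0 < b) :
    Integrable (betaWeight a b) := by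
  refine ⟨(measurable_betaWeight a b).aestronglyMeasurable, ?_⟩
  rw [hasFiniteIntegral_iff_ofReal (.of_forall (betaWeight_nonneg a b)), lintegral_betaWeight ha hb]
  exact ENNReal.ofReal_lt_top

lemma integral_betaWeight {a b : ℝ} (ha : 0 < a) (hb : 0 < b) :
    ∫ v, betaWeight a b v = beta a b := by
  rw [integral_eq_lintegral_of_nonneg_ae (.of_forall (betaWeight_nonneg a b))
    (measurable_betaWeight a b).aestronglyMeasurable, lintegral_betaWeight ha hb,
    ENNReal.toReal_ofReal (beta_pos ha hb).le]

/-- The upper incomplete beta function `∫ w in y..1, w ^ (a - 1) * (1 - w) ^ (b - 1)`, through which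
the second Volterra kernel is expressed. -/
def incBeta (a b y : ℝ) : ℝ := ∫ w in y..1, betaWeight a b w

lemma incBeta_one (a b : ℝ) : incBeta a b 1 = 0 := intervalIntegral.integral_same

lemma incBeta_nonneg {a b y : ℝ} (hy : y ≤ 1) : 0 ≤ incBeta a b y :=
  intervalIntegral.integral_nonneg hy fun _ _ => betaWeight_nonneg _ _ _

section incBeta

variable {a b : ℝ} (ha : 0 < a) (hb : 0 < b)
include ha hb

lemma incBeta_le_beta {y : ℝ} (hy : y ≤ 1) : incBeta a b y ≤ beta a b := by
  rw [incBeta, intervalIntegral.integral_of_le hy, ← integral_betaWeight ha hb]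
  exact setIntegral_le_integral (integrable_betaWeight ha hb)
    (.of_forall fun _ => betaWeight_nonneg _ _ _)

lemma incBeta_zero : incBeta a b 0 = beta a b := by
  rw [incBeta, intervalIntegral.integral_of_le zero_le_one, integral_Ioc_eq_integral_Ioo,
    setIntegral_eq_integral_of_forall_compl_eq_zero, integral_betaWeight ha hb]
  intro v hv
  rcases le_or_gt v 0 with h | h
  · rw [betaWeight, posRpow_of_nonpos h, zero_mul]
  · rw [betaWeight, posRpow_of_nonpos (x := 1 - v), mul_zero]
    exact sub_nonpos.2 (not_lt.1 fun h' => hv ⟨h, h'⟩)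

lemma continuous_incBeta : Continuous (incBeta a b) := by
  have h := intervalIntegral.continuous_primitive
    (fun _ _ => (integrable_betaWeight ha hb).intervalIntegrable) 1
  exact h.neg.congr fun y => (intervalIntegral.integral_symm _ _).symm

lemma hasDerivAt_incBeta {y : ℝ} (hy : y ∈ Ioo (0 : ℝ) 1) :
    HasDerivAt (incBeta a b) (-(y ^ (a - 1) * (1 - y) ^ (b - 1))) y := by
  have heq : betaWeight a b =ᶠ[𝓝 y] fun w => w ^ (a - 1) * (1 - w) ^ (b - 1) := by
    filter_upwards [Ioo_mem_nhds hy.1 hy.2] with w hw using betaWeight_of_mem hw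
  have hcont : ContinuousAt (betaWeight a b) y := by
    refine ContinuousAt.congr ?_ heq.symm
    exact (Real.continuousAt_rpow_const y _ (.inl hy.1.ne')).mul
      (ContinuousAt.rpow_const (by fun_prop) (.inl (sub_pos.2 hy.2).ne'))
  rw [← betaWeight_of_mem hy]
  exact intervalIntegral.integral_hasDerivAt_left
    (integrable_betaWeight ha hb).intervalIntegrable
    (measurable_betaWeight a b).stronglyMeasurable.stronglyMeasurableAtFilter hcont

end incBeta

lemma ofReal_eq_add_lintegral_deriv {a b : ℝ} {f f' : ℝ → ℝ} (hab : a ≤ b)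
    (hf : ContinuousOn f (Icc a b)) (hf' : ∀ x ∈ Ioo a b, HasDerivAt f (f' x) x)
    (hnonneg : ∀ x ∈ Ioo a b, 0 ≤ f' x) (hfa : 0 ≤ f a) :
    ENNReal.ofReal (f b) = ENNReal.ofReal (f a) + ∫⁻ x in Ioo a b, ENNReal.ofReal (f' x) := by
  have hint := intervalIntegral.integrableOn_deriv_of_nonneg hf hf' hnonneg
  have hftc := intervalIntegral.integral_eq_sub_of_hasDerivAt_of_le hab hf hf'
    ((intervalIntegrable_iff_integrableOn_Ioc_of_le hab).2 hint)
  rw [intervalIntegral.integral_of_le hab, integral_Ioc_eq_integral_Ioo] at hftc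
  rw [← ofReal_integral_eq_lintegral_ofReal (hint.mono_set Ioo_subset_Ioc_self)
      ((ae_restrict_mem measurableSet_Ioo).mono hnonneg),
    ← ENNReal.ofReal_add hfa (setIntegral_nonneg measurableSet_Ioo hnonneg), hftc, add_sub_cancel]

lemma eposRpow_add_eq {p v z : ℝ} (hp : 0 < p) (hv : 0 < v) (hz : 0 < z) :
    eposRpow p (z + v)
      = eposRpow p v + ∫⁻ x in Ioo 0 z, ENNReal.ofReal p * eposRpow (p - 1) (x + v) := by
  have hderiv : ∀ x ∈ Ioo 0 z, HasDerivAt (fun x => (x + v) ^ p) (p * (x + v) ^ (p - 1)) x := by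
    intro x hx
    simpa using ((hasDerivAt_id x).add_const v).rpow_const (p := p)
      (.inl (by simp only [id]; linarith [hx.1]))
  have hpt : ∀ x ∈ Ioo 0 z, ENNReal.ofReal p * eposRpow (p - 1) (x + v)
      = ENNReal.ofReal (p * (x + v) ^ (p - 1)) := fun x hx => by
    rw [eposRpow_of_pos (by linarith [hx.1]), ENNReal.ofReal_mul hp.le]
  have hftc := ofReal_eq_add_lintegral_deriv hz.le
    (Continuous.continuousOn (by fun_prop (disch := exact hp.le))) hderiv
    (fun x hx => by have := hx.1; positivity) (by positivity)
  rw [setLIntegral_congr_fun measurableSet_Ioo hpt, eposRpow_of_pos (by positivity), hftc, zero_add,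
    eposRpow_of_pos hv]

/- The boundary value at `z = 0` is an ordinary beta integral, and the derivative in `z` of the
left-hand side is the integral of `lintegral_beta_mul_add_rpow`. -/
lemma lintegral_beta_mul_add_rpow_one_sub {a b z : ℝ} (ha : 0 < a) (hb : 0 < b) (hab : a + b < 1)
    (hz : 0 < z) :
    ∫⁻ v, eposRpow (a - 1) v * eposRpow (b - 1) (1 - v) * eposRpow (1 - (a + b)) (z + v)
      = ENNReal.ofReal (beta (1 - b) b) + ENNReal.ofReal (beta a b) *
        ∫⁻ x in Ioo 0 z, ENNReal.ofReal ((1 - (a + b)) * ((1 + x) ^ (-a) * x ^ (-b))) := by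
  have hp : 0 < 1 - (a + b) := sub_pos.2 hab
  let w (v : ℝ) : ℝ≥0∞ := eposRpow (a - 1) v * eposRpow (b - 1) (1 - v)
  have hw : Measurable w := by fun_prop
  have hsplit : ∀ v, w v * eposRpow (1 - (a + b)) (z + v)
      = eposRpow (1 - b - 1) v * eposRpow (b - 1) (1 - v) + ∫⁻ x in Ioo 0 z,
        ENNReal.ofReal (1 - (a + b)) * (w v * eposRpow (-(a + b)) (x + v)) := by
    intro v
    rcases le_or_gt v 0 with hv | hv
    · simp only [w, eposRpow_of_nonpos hv, zero_mul, mul_zero, lintegral_zero, add_zero]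
    rw [eposRpow_add_eq hp hv hz, mul_add, ← lintegral_const_mul _ (by fun_prop),
      show 1 - b - 1 = (a - 1) + (1 - (a + b)) by ring, ← eposRpow_mul_eposRpow,
      show 1 - (a + b) - 1 = -(a + b) by ring]
    simp only [w, mul_left_comm, mul_comm, mul_assoc]
  change ∫⁻ v, w v * _ = _
  simp_rw [hsplit]
  rw [lintegral_add_left (by fun_prop), lintegral_beta_unit (by linarith) hb,
    lintegral_lintegral_swap (by fun_prop), ← lintegral_const_mul _ (by fun_prop)]
  congr 1
  refine setLIntegral_congr_fun measurableSet_Ioo fun x hx => ?_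
  rw [lintegral_const_mul _ (by fun_prop), lintegral_beta_mul_add_rpow ha hb hx.1,
    ENNReal.ofReal_mul hp.le]
  ring

/-- The Volterra kernel is homogeneous of degree `H - 1/2`; up to the normalizing constant,
`volterraProfile H z` is the value of `s ^ (1/2 - H) * (K_{H,1}(t,s) + K_{H,2}(t,s))`, where
`z = s / (t - s)`. -/
def volterraProfile (H z : ℝ) : ℝ :=
  z ^ (1 - 2 * H) * (1 + z) ^ (H - 1 / 2) +
    (1 / 2 - H) * incBeta (1 - 2 * H) (H + 1 / 2) (z / (1 + z))

section Profile

variable {H : ℝ} (hH0 : 0 < H) (hH1 : H < 1 / 2)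
include hH0 hH1

lemma volterraProfile_zero :
    volterraProfile H 0 = (1 / 2 - H) * beta (1 - 2 * H) (H + 1 / 2) := by
  rw [volterraProfile, zero_div, incBeta_zero (by linarith) (by linarith),
    Real.zero_rpow (by linarith), zero_mul, zero_add]

lemma hasDerivAt_volterraProfile {z : ℝ} (hz : 0 < z) :
    HasDerivAt (volterraProfile H) ((1 / 2 - H) * ((1 + z) ^ (H - 1 / 2) * z ^ (-(2 * H)))) z := by
  have hz1 : 0 < 1 + z := by positivity
  have hquot : HasDerivAt (fun z => z / (1 + z)) (1 / (1 + z) ^ 2) z := by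
    refine ((hasDerivAt_id z).div ((hasDerivAt_id z).const_add 1) hz1.ne').congr_deriv ?_
    simp only [id]
    ring
  have hbeta := (hasDerivAt_incBeta (show 0 < 1 - 2 * H by linarith)
    (show 0 < H + 1 / 2 by linarith)
    (y := z / (1 + z)) ⟨by positivity, (div_lt_one hz1).2 (by linarith)⟩).comp z hquot
  have hpow := ((hasDerivAt_id z).rpow_const (p := 1 - 2 * H) (.inl hz.ne')).mul
    (((hasDerivAt_id z).const_add 1).rpow_const (p := H - 1 / 2) (.inl hz1.ne'))
  refine (hpow.add (hbeta.const_mul (1 / 2 - H))).congr_deriv ?_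
  rw [show 1 - z / (1 + z) = 1 / (1 + z) by field_simp; ring]
  simp only [id]
  have hfirst : (1 + z) ^ (H - 1 / 2) = (1 + z) ^ (H - 1 / 2 - 1) * (1 + z) := by
    rw [← Real.rpow_add_one hz1.ne', sub_add_cancel]
  have hsecond : z ^ (1 - 2 * H) = z ^ (-(2 * H)) * z := by
    rw [← Real.rpow_add_one hz.ne']
    ring_nf
  have hthird : (z / (1 + z)) ^ (1 - 2 * H - 1) * (1 / (1 + z)) ^ (H + 1 / 2 - 1)
      = z ^ (-(2 * H)) * (1 + z) ^ (H - 1 / 2 - 1) * (1 + z) ^ 2 := by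
    rw [Real.div_rpow hz.le hz1.le, one_div, Real.inv_rpow hz1.le, div_eq_mul_inv,
      ← Real.rpow_neg hz1.le, ← Real.rpow_neg hz1.le, mul_assoc, mul_assoc, ← Real.rpow_add hz1,
      ← Real.rpow_natCast (1 + z) 2, ← Real.rpow_add hz1]
    ring_nf
  rw [hthird, hfirst, hsecond, show 1 - 2 * H - 1 = -(2 * H) by ring]
  field_simp
  ring

lemma continuousOn_volterraProfile : ContinuousOn (volterraProfile H) (Ici 0) := by
  have hne : ∀ z ∈ Ici (0 : ℝ), 1 + z ≠ 0 := fun z hz => by have : 0 ≤ z := hz; positivity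
  refine ContinuousOn.add (ContinuousOn.mul ?_ ?_) (continuousOn_const.mul ?_)
  · exact continuousOn_id.rpow_const fun z _ => .inr (by linarith)
  · exact (continuousOn_const.add continuousOn_id).rpow_const fun z hz => .inl (hne z hz)
  · exact (continuous_incBeta (by linarith) (by linarith)).comp_continuousOn
      (continuousOn_id.div (continuousOn_const.add continuousOn_id) hne)

lemma ofReal_volterraProfile {z : ℝ} (hz : 0 < z) :
    ENNReal.ofReal (volterraProfile H z)
      = ENNReal.ofReal ((1 / 2 - H) * beta (1 - 2 * H) (H + 1 / 2)) +
        ∫⁻ x in Ioo 0 z,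
          ENNReal.ofReal ((1 / 2 - H) * ((1 + x) ^ (H - 1 / 2) * x ^ (-(2 * H)))) := by
  have := sub_pos.2 hH1
  have hB := beta_pos (show 0 < 1 - 2 * H by linarith) (show 0 < H + 1 / 2 by linarith)
  rw [← volterraProfile_zero hH0 hH1]
  refine ofReal_eq_add_lintegral_deriv hz.le
    ((continuousOn_volterraProfile hH0 hH1).mono Icc_subset_Ici_self)
    (fun x hx => hasDerivAt_volterraProfile hH0 hH1 hx.1)
    (fun x hx => by have := hx.1; positivity) ?_
  rw [volterraProfile_zero hH0 hH1]
  positivity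

lemma beta_one_sub_eq :
    beta (1 - 2 * H) (2 * H)
      = beta (1 / 2 - H) (2 * H) * ((1 / 2 - H) * beta (1 - 2 * H) (H + 1 / 2)) := by
  have hΓ : Real.Gamma (1 - 2 * H + (H + 1 / 2)) = (1 / 2 - H) * Real.Gamma (1 / 2 - H) := by
    rw [← Real.Gamma_add_one (by linarith)]
    ring_nf
  have := Real.Gamma_pos_of_pos (show 0 < H + 1 / 2 by linarith)
  have hG := Real.Gamma_pos_of_pos (show 0 < 1 / 2 - H by linarith)
  have : 1 - 2 * H ≠ 0 := by linarith
  simp only [beta]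
  rw [hΓ, sub_add_cancel, Real.Gamma_one, show 1 / 2 - H + 2 * H = H + 1 / 2 by ring]
  generalize Real.Gamma (1 / 2 - H) = G at *
  field_simp

end Profile

/-- The unnormalized Volterra kernel in its fractional-integral form: up to the factor
`s ^ (H - 1/2)`, a composition of the kernels of fractional integration of orders `1/2 - H` and
`2 * H`, weighted by `r ^ (1/2 - H)`. -/
def volterraE (H t s : ℝ) : ℝ≥0∞ :=
  eposRpow (H - 1 / 2) s * ∫⁻ r,
    eposRpow (1 / 2 - H - 1) (r - s) * eposRpow (2 * H - 1) (t - r) * eposRpow (1 / 2 - H) r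

/-- The Volterra kernel `K_H = K_{H,1} + K_{H,2}` of fractional Brownian motion, extended by zero
outside `0 < s < t`. -/
def volterraK (H t : ℝ) : ℝ → ℝ :=
  indicator (Ioo 0 t) fun s => kernelOne H t s + kernelTwo H t s

@[fun_prop]
lemma measurable_volterraE (H t : ℝ) : Measurable (volterraE H t) := by
  unfold volterraE
  fun_prop

lemma volterraConst_nonneg (H : ℝ) : 0 ≤ volterraConst H := Real.sqrt_nonneg _

lemma kernelOne_nonneg {H s t : ℝ} (hs : 0 ≤ s) (hst : s ≤ t) : 0 ≤ kernelOne H t s := by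
  have := volterraConst_nonneg H
  have := sub_nonneg.2 hst
  have := hs.trans hst
  unfold kernelOne
  positivity

lemma kernelTwo_nonneg {H s t : ℝ} (hH1 : H ≤ 1 / 2) (hs : 0 ≤ s) (hst : s ≤ t) :
    0 ≤ kernelTwo H t s := by
  have := volterraConst_nonneg H
  have := sub_nonneg.2 hH1
  refine mul_nonneg (by positivity) (intervalIntegral.integral_nonneg hst fun u hu => ?_)
  have := sub_nonneg.2 hu.1
  have := hs.trans hu.1
  positivity

lemma volterraK_nonneg {H : ℝ} (hH1 : H ≤ 1 / 2) (t s : ℝ) : 0 ≤ volterraK H t s :=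
  indicator_nonneg (fun _ hs => add_nonneg (kernelOne_nonneg hs.1.le hs.2.le)
    (kernelTwo_nonneg hH1 hs.1.le hs.2.le)) s

lemma kernelOne_eq {H s t : ℝ} (hs : 0 < s) (hst : s < t) :
    kernelOne H t s = volterraConst H *
      (s ^ (H - 1 / 2) * ((s / (t - s)) ^ (1 - 2 * H) * (1 + s / (t - s)) ^ (H - 1 / 2))) := by
  have hts : 0 < t - s := sub_pos.2 hst
  have hs' : s ^ (1 / 2 - H) = s ^ (H - 1 / 2) * s ^ (1 - 2 * H) := by
    rw [← Real.rpow_add hs]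
    ring_nf
  have hts' : (t - s) ^ (1 - 2 * H) = ((t - s) ^ (H - 1 / 2) * (t - s) ^ (H - 1 / 2))⁻¹ := by
    rw [← Real.rpow_add hts, ← Real.rpow_neg hts.le]
    ring_nf
  rw [kernelOne, hs', show 1 + s / (t - s) = t / (t - s) by field_simp; ring,
    Real.div_rpow hs.le hts.le, Real.div_rpow (hs.trans hst).le hts.le, hts']
  field_simp

lemma hasDerivAt_incBeta_const_div {H s u : ℝ} (hH0 : 0 < H) (hH1 : H < 1 / 2) (hs : 0 < s)
    (hsu : s < u) :
    HasDerivAt (fun u => s ^ (2 * H - 1) * incBeta (1 - 2 * H) (H + 1 / 2) (s / u))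
      (u ^ (H - 3 / 2) * (u - s) ^ (H - 1 / 2)) u := by
  have hu : 0 < u := hs.trans hsu
  have hus : 0 < u - s := sub_pos.2 hsu
  have hdiv : HasDerivAt (fun u => s / u) (-s / u ^ 2) u := by
    refine ((hasDerivAt_const u s).div (hasDerivAt_id u) hu.ne').congr_deriv ?_
    simp only [zero_mul, id, mul_one, zero_sub]
  have hbeta := (hasDerivAt_incBeta (show 0 < 1 - 2 * H by linarith)
    (show 0 < H + 1 / 2 by linarith) (y := s / u)
    ⟨by positivity, (div_lt_one hu).2 hsu⟩).comp u hdiv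
  refine (hbeta.const_mul (s ^ (2 * H - 1))).congr_deriv ?_
  rw [show 1 - s / u = (u - s) / u by field_simp, Real.div_rpow hs.le hu.le,
    Real.div_rpow hus.le hu.le]
  have hs' : s ^ (2 * H - 1) = (s ^ (1 - 2 * H - 1) * s)⁻¹ := by
    rw [← Real.rpow_add_one hs.ne', ← Real.rpow_neg hs.le]
    ring_nf
  have hu' : u ^ (H - 3 / 2) = (u ^ (1 - 2 * H - 1) * u ^ (H + 1 / 2 - 1) * u ^ (2 : ℕ))⁻¹ := by
    rw [← Real.rpow_natCast u 2, ← Real.rpow_add hu, ← Real.rpow_add hu, ← Real.rpow_neg hu.le]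
    push_cast
    ring_nf
  rw [hs', hu', show H - 1 / 2 = H + 1 / 2 - 1 by ring]
  field_simp

lemma kernelTwo_eq {H s t : ℝ} (hH0 : 0 < H) (hH1 : H < 1 / 2) (hs : 0 < s) (hst : s ≤ t) :
    kernelTwo H t s = volterraConst H *
      (s ^ (H - 1 / 2) * ((1 / 2 - H) * incBeta (1 - 2 * H) (H + 1 / 2) (s / t))) := by
  let F (u : ℝ) : ℝ := s ^ (2 * H - 1) * incBeta (1 - 2 * H) (H + 1 / 2) (s / u)
  have hcont : ContinuousOn F (Icc s t) := by
    exact continuousOn_const.mul <|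
      (continuous_incBeta (by linarith) (by linarith)).comp_continuousOn <|
        continuousOn_const.div continuousOn_id fun u hu => (hs.trans_le hu.1).ne'
  have hderiv : ∀ u ∈ Ioo s t, HasDerivAt F (u ^ (H - 3 / 2) * (u - s) ^ (H - 1 / 2)) u :=
    fun u hu => hasDerivAt_incBeta_const_div hH0 hH1 hs hu.1
  have hint := intervalIntegral.integrableOn_deriv_of_nonneg hcont hderiv fun u hu => by
    have := hs.trans hu.1
    have := sub_pos.2 hu.1
    positivity
  have hFs : F s = 0 := by simp only [F, div_self hs.ne', incBeta_one, mul_zero]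
  rw [kernelTwo, intervalIntegral.integral_eq_sub_of_hasDerivAt_of_le hst hcont hderiv
    ((intervalIntegrable_iff_integrableOn_Ioc_of_le hst).2 hint), hFs, sub_zero,
    show H - 1 / 2 = (1 / 2 - H) + (2 * H - 1) by ring, Real.rpow_add hs]
  ring

section Volterra

variable {H : ℝ} (hH0 : 0 < H) (hH1 : H < 1 / 2)
include hH0 hH1

lemma kernelOne_add_kernelTwo_eq {s t : ℝ} (hs : 0 < s) (hst : s < t) :
    kernelOne H t s + kernelTwo H t s
      = volterraConst H * (s ^ (H - 1 / 2) * volterraProfile H (s / (t - s))) := by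
  have hts : 0 < t - s := sub_pos.2 hst
  have ht : 0 < t := hs.trans hst
  rw [kernelOne_eq hs hst, kernelTwo_eq hH0 hH1 hs hst.le, volterraProfile,
    show s / (t - s) / (1 + s / (t - s)) = s / t by field_simp; ring]
  ring

lemma volterraE_of_mem {s t : ℝ} (hst : s ∈ Ioo 0 t) :
    volterraE H t s = ENNReal.ofReal
      (beta (1 / 2 - H) (2 * H) * (s ^ (H - 1 / 2) * volterraProfile H (s / (t - s)))) := by
  obtain ⟨hs, hst⟩ := hst
  have hc : 0 < t - s := sub_pos.2 hst
  have hB := beta_pos (show 0 < 1 / 2 - H by linarith) (show 0 < 2 * H by linarith)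
  have hscale : ∀ v, eposRpow (1 / 2 - H - 1) (s + (t - s) * v - s) *
      eposRpow (2 * H - 1) (t - (s + (t - s) * v)) * eposRpow (1 / 2 - H) (s + (t - s) * v)
      = eposRpow (-1) (t - s) * (eposRpow (1 / 2 - H - 1) v * eposRpow (2 * H - 1) (1 - v) *
        eposRpow (1 - (1 / 2 - H + 2 * H)) (s / (t - s) + v)) := by
    intro v
    rw [show s + (t - s) * v - s = (t - s) * v by ring,
      show t - (s + (t - s) * v) = (t - s) * (1 - v) by ring,
      show s + (t - s) * v = (t - s) * (s / (t - s) + v) by field_simp,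
      show 1 - (1 / 2 - H + 2 * H) = 1 / 2 - H by ring,
      eposRpow_const_mul hc, eposRpow_const_mul hc, eposRpow_const_mul hc,
      show (-1 : ℝ) = (1 / 2 - H - 1) + (2 * H - 1) + (1 / 2 - H) by ring,
      ← eposRpow_mul_eposRpow, ← eposRpow_mul_eposRpow]
    ring
  have hprofile := lintegral_beta_mul_add_rpow_one_sub (show 0 < 1 / 2 - H by linarith)
    (show 0 < 2 * H by linarith) (by linarith) (div_pos hs hc)
  rw [beta_one_sub_eq hH0 hH1, ENNReal.ofReal_mul hB.le, ← mul_add,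
    show 1 - (1 / 2 - H + 2 * H) = 1 / 2 - H by ring, show -(1 / 2 - H) = H - 1 / 2 by ring,
    ← ofReal_volterraProfile hH0 hH1 (div_pos hs hc)] at hprofile
  rw [volterraE, ← lintegral_comp_const_add_mul _ s hc.ne', abs_of_pos hc]
  simp_rw [hscale]
  rw [lintegral_const_mul' _ _ (eposRpow_ne_top _ _),
    show 1 - (1 / 2 - H + 2 * H) = 1 / 2 - H by ring, hprofile,
    ← mul_assoc (ENNReal.ofReal (t - s)), eposRpow_of_pos hc, ← ENNReal.ofReal_mul hc.le,
    Real.rpow_neg_one, mul_inv_cancel₀ hc.ne',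
    ENNReal.ofReal_one, one_mul, eposRpow_of_pos hs, mul_left_comm,
    ENNReal.ofReal_mul hB.le, ENNReal.ofReal_mul (by positivity)]

omit hH0 hH1 in
lemma volterraE_of_notMem {s t : ℝ} (hst : s ∉ Ioo 0 t) : volterraE H t s = 0 := by
  rcases le_or_gt s 0 with hs | hs
  · rw [volterraE, eposRpow_of_nonpos hs, zero_mul]
  · have hzero : ∀ r, eposRpow (1 / 2 - H - 1) (r - s) * eposRpow (2 * H - 1) (t - r) = 0 :=
      fun r => eposRpow_mul_eposRpow_sub_eq_zero (fun hr => hst ⟨hs, hr.1.trans hr.2⟩) _ _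
    simp only [volterraE, hzero, zero_mul, lintegral_zero, mul_zero]

lemma ofReal_volterraK (t s : ℝ) :
    ENNReal.ofReal (volterraK H t s)
      = ENNReal.ofReal (volterraConst H / beta (1 / 2 - H) (2 * H)) * volterraE H t s := by
  have hB := beta_pos (show 0 < 1 / 2 - H by linarith) (show 0 < 2 * H by linarith)
  by_cases hst : s ∈ Ioo 0 t
  · rw [volterraK, indicator_of_mem hst, kernelOne_add_kernelTwo_eq hH0 hH1 hst.1 hst.2,
      volterraE_of_mem hH0 hH1 hst,
      ← ENNReal.ofReal_mul (div_nonneg (volterraConst_nonneg H) hB.le),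
      ← mul_assoc (_ / _), div_mul_cancel₀ _ hB.ne']
  · rw [volterraK, indicator_of_notMem hst, volterraE_of_notMem hst, ENNReal.ofReal_zero, mul_zero]

lemma measurable_volterraK (t : ℝ) : Measurable (volterraK H t) := by
  have heq : volterraK H t = fun s =>
      (ENNReal.ofReal (volterraConst H / beta (1 / 2 - H) (2 * H)) * volterraE H t s).toReal := by
    funext s
    rw [← ofReal_volterraK hH0 hH1, ENNReal.toReal_ofReal (volterraK_nonneg hH1.le t s)]
  rw [heq]
  fun_prop

end Volterra

/-! ### Covariance of the Volterra kernel -/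

lemma lintegral_eposRpow_sub {a s t : ℝ} (ha : 0 < a) (hs : 0 ≤ s) (ht : 0 ≤ t) :
    ∫⁻ r, eposRpow (a - 1) (s - r) * eposRpow 0 r * eposRpow 0 (t - r)
      = ENNReal.ofReal ((s ^ a - posRpow a (s - t)) / a) := by
  let m := min s t
  have hm : 0 ≤ m := le_min hs ht
  have hend : (s - m) ^ a = posRpow a (s - t) := by
    rcases le_or_gt s t with h | h
    · rw [posRpow_of_nonpos (sub_nonpos.2 h), show m = s from min_eq_left h, sub_self,
        Real.zero_rpow ha.ne']
    · rw [posRpow_of_pos (sub_pos.2 h), show m = t from min_eq_right h.le]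
  have hsupp : (fun r => eposRpow (a - 1) (s - r) * eposRpow 0 r * eposRpow 0 (t - r)).support
      ⊆ Ioo 0 m := by
    refine Function.support_subset_iff'.2 fun r hr => ?_
    rcases le_or_gt r 0 with h0 | h0
    · rw [eposRpow_of_nonpos h0, mul_zero, zero_mul]
    rcases le_or_gt s r with hsr | hsr
    · rw [eposRpow_of_nonpos (sub_nonpos.2 hsr), zero_mul, zero_mul]
    · have htr : t ≤ r := not_lt.1 fun h => hr ⟨h0, lt_min hsr h⟩
      rw [eposRpow_of_nonpos (x := t - r) (sub_nonpos.2 htr), mul_zero]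
  have hint : ∀ r ∈ Ioo 0 m, eposRpow (a - 1) (s - r) * eposRpow 0 r * eposRpow 0 (t - r)
      = ENNReal.ofReal ((s - r) ^ (a - 1)) := fun r hr => by
    have hsr : 0 < s - r := sub_pos.2 (hr.2.trans_le (min_le_left _ _))
    have htr : 0 < t - r := sub_pos.2 (hr.2.trans_le (min_le_right _ _))
    rw [eposRpow_of_pos hsr, eposRpow_of_pos hr.1, eposRpow_of_pos htr, Real.rpow_zero,
      Real.rpow_zero, ENNReal.ofReal_one, mul_one, mul_one]
  have hderiv : ∀ r ∈ Ioo 0 m,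
      HasDerivAt (fun r => (s ^ a - (s - r) ^ a) / a) ((s - r) ^ (a - 1)) r := fun r hr => by
    have hsr : s - r ≠ 0 := (sub_pos.2 (hr.2.trans_le (min_le_left _ _))).ne'
    refine (((((hasDerivAt_id r).const_sub s).rpow_const (p := a) (.inl hsr)).const_sub
      (s ^ a)).div_const a).congr_deriv ?_
    simp only [id]
    field_simp
  have hftc := ofReal_eq_add_lintegral_deriv hm
    (Continuous.continuousOn (by fun_prop (disch := exact ha.le))) hderiv
    (fun r hr => Real.rpow_nonneg (sub_nonneg.2 (hr.2.le.trans (min_le_left _ _))) _)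
    (by simp only [sub_zero, sub_self, zero_div, le_refl])
  rw [← setLIntegral_eq_of_support_subset hsupp, setLIntegral_congr_fun measurableSet_Ioo hint,
    ← hend, hftc, sub_zero, sub_self, zero_div, ENNReal.ofReal_zero, zero_add]

/- The support of `eposRpow (-a) (r - r')` is `r' < r`, so that the inner integral over `r` is a
beta integral with exponents summing to `1`, hence constant on `r' < t`. -/
lemma lintegral_lintegral_riesz {a s t : ℝ} (ha0 : 0 < a) (ha1 : a < 1) (hs : 0 ≤ s) (ht : 0 ≤ t) :
    ∫⁻ r, ∫⁻ r', eposRpow (a - 1) (t - r) * eposRpow 0 r *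
        (eposRpow (a - 1) (s - r') * eposRpow 0 r') * eposRpow (-a) (r - r')
      = ENNReal.ofReal (beta (1 - a) a) * ENNReal.ofReal ((s ^ a - posRpow a (s - t)) / a) := by
  have hpt : ∀ r' r, eposRpow (a - 1) (t - r) * eposRpow 0 r *
        (eposRpow (a - 1) (s - r') * eposRpow 0 r') * eposRpow (-a) (r - r')
      = eposRpow (a - 1) (s - r') * eposRpow 0 r' *
        (eposRpow (1 - a - 1) (r - r') * eposRpow (a - 1) (t - r)) := by
    intro r' r
    rw [show 1 - a - 1 = -a by ring]
    rcases le_or_gt r' 0 with h0 | h0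
    · simp only [eposRpow_of_nonpos h0, mul_zero, zero_mul]
    rcases le_or_gt r r' with hr | hr
    · simp only [eposRpow_of_nonpos (sub_nonpos.2 hr), mul_zero, zero_mul]
    · rw [eposRpow_of_pos (h0.trans hr), Real.rpow_zero, ENNReal.ofReal_one]
      ring
  rw [lintegral_lintegral_swap (by fun_prop)]
  simp_rw [hpt]
  have hinner : ∀ r', ∫⁻ r, eposRpow (a - 1) (s - r') * eposRpow 0 r' *
      (eposRpow (1 - a - 1) (r - r') * eposRpow (a - 1) (t - r)) = ENNReal.ofReal (beta (1 - a) a) *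
        (eposRpow (a - 1) (s - r') * eposRpow 0 r' * eposRpow 0 (t - r')) := by
    intro r'
    rw [lintegral_const_mul _ (by fun_prop), lintegral_beta (sub_pos.2 ha1) ha0,
      show 1 - a + a - 1 = 0 by ring]
    ring
  simp_rw [hinner]
  rw [lintegral_const_mul _ (by fun_prop), lintegral_eposRpow_sub ha0 hs ht]

section Covariance

variable {H : ℝ} (hH0 : 0 < H) (hH1 : H < 1 / 2)
include hH0 hH1

lemma lintegral_eposRpow_three {r r' : ℝ} (hne : r ≠ r') :
    ∫⁻ u, eposRpow (2 * H - 1) u * eposRpow (1 / 2 - H - 1) (r - u) *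
        eposRpow (1 / 2 - H - 1) (r' - u)
      = ENNReal.ofReal (beta (2 * H) (1 / 2 - H)) *
        (eposRpow (H - 1 / 2) r * eposRpow (H - 1 / 2) r' *
          (eposRpow (-(2 * H)) (r - r') + eposRpow (-(2 * H)) (r' - r))) := by
  wlog hlt : r < r' generalizing r r'
  · rw [add_comm (eposRpow _ (r - r')), mul_comm (eposRpow (H - 1 / 2) r),
      ← this hne.symm (lt_of_le_of_ne (not_lt.1 hlt) hne.symm)]
    simp only [mul_right_comm]
  rw [eposRpow_of_nonpos (x := r - r') (sub_nonpos.2 hlt.le), zero_add]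
  rcases le_or_gt r 0 with hr | hr
  · have hzero : ∀ u, eposRpow (2 * H - 1) u * eposRpow (1 / 2 - H - 1) (r - u) = 0 := fun u => by
      simpa only [sub_zero] using eposRpow_mul_eposRpow_sub_eq_zero
        (fun hu : u ∈ Ioo 0 r => (hu.1.trans hu.2).not_ge hr) (2 * H - 1) (1 / 2 - H - 1)
    simp only [hzero, eposRpow_of_nonpos hr, zero_mul, mul_zero, lintegral_zero]
  · have hthree := lintegral_beta_three (a := 2 * H) (b := 1 / 2 - H) (by linarith) (by linarith)
      hr hlt
    rw [show -(2 * H + (1 / 2 - H)) = 1 / 2 - H - 1 by ring,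
      show 2 * H + (1 / 2 - H) - 1 = H - 1 / 2 by ring,
      show -(1 / 2 - H) = H - 1 / 2 by ring] at hthree
    have := hr.trans hlt
    have := sub_pos.2 hlt
    rw [hthree, eposRpow_of_pos hr, eposRpow_of_pos (by positivity),
      eposRpow_of_pos (x := r' - r) (by positivity)]
    congr 1
    rw [← ENNReal.ofReal_mul (by positivity), ← ENNReal.ofReal_mul (by positivity),
      mul_right_comm]

lemma lintegral_volterraE_integrand_mul (s t : ℝ) {r r' : ℝ} (hne : r ≠ r') :
    ∫⁻ u, eposRpow (H - 1 / 2) u * (eposRpow (1 / 2 - H - 1) (r - u) *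
        eposRpow (2 * H - 1) (t - r) * eposRpow (1 / 2 - H) r) * (eposRpow (H - 1 / 2) u *
        (eposRpow (1 / 2 - H - 1) (r' - u) * eposRpow (2 * H - 1) (s - r') *
          eposRpow (1 / 2 - H) r'))
      = ENNReal.ofReal (beta (2 * H) (1 / 2 - H)) *
        (eposRpow (2 * H - 1) (t - r) * eposRpow 0 r * (eposRpow (2 * H - 1) (s - r') *
          eposRpow 0 r') * (eposRpow (-(2 * H)) (r - r') + eposRpow (-(2 * H)) (r' - r))) := by
  have hsq : ∀ u, eposRpow (2 * H - 1) u = eposRpow (H - 1 / 2) u * eposRpow (H - 1 / 2) u :=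
    fun u => by rw [eposRpow_mul_eposRpow]; ring_nf
  have hone : ∀ r, eposRpow 0 r = eposRpow (1 / 2 - H) r * eposRpow (H - 1 / 2) r :=
    fun r => by rw [eposRpow_mul_eposRpow]; ring_nf
  calc _ = ∫⁻ u, eposRpow (2 * H - 1) (t - r) * eposRpow (1 / 2 - H) r *
        (eposRpow (2 * H - 1) (s - r') * eposRpow (1 / 2 - H) r') * (eposRpow (2 * H - 1) u *
          eposRpow (1 / 2 - H - 1) (r - u) * eposRpow (1 / 2 - H - 1) (r' - u)) := by
        simp only [hsq]
        exact lintegral_congr fun u => by ring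
    _ = _ := by
        rw [lintegral_const_mul _ (by fun_prop), lintegral_eposRpow_three hH0 hH1 hne]
        simp only [hone]
        ring

lemma lintegral_lintegral_riesz_symm {s t : ℝ} (hs : 0 ≤ s) (ht : 0 ≤ t) :
    ∫⁻ r, ∫⁻ r', eposRpow (2 * H - 1) (t - r) * eposRpow 0 r *
        (eposRpow (2 * H - 1) (s - r') * eposRpow 0 r') *
        (eposRpow (-(2 * H)) (r - r') + eposRpow (-(2 * H)) (r' - r))
      = ENNReal.ofReal (beta (1 - 2 * H) (2 * H)) *
        ENNReal.ofReal ((s ^ (2 * H) + t ^ (2 * H) - |t - s| ^ (2 * H)) / (2 * H)) := by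
  wlog hst : s ≤ t generalizing s t
  · rw [abs_sub_comm, add_comm (s ^ _), ← this ht hs (le_of_not_ge hst),
      lintegral_lintegral_swap (by fun_prop)]
    exact lintegral_congr fun r => lintegral_congr fun r' => by ring
  have hnonneg : 0 ≤ t ^ (2 * H) - (t - s) ^ (2 * H) := sub_nonneg.2 <|
    Real.rpow_le_rpow (sub_nonneg.2 hst) (by linarith) (by linarith)
  simp_rw [mul_add]
  rw [lintegral_congr fun r => lintegral_add_left (by fun_prop) _,
    lintegral_add_left (by fun_prop), lintegral_lintegral_riesz (by linarith) (by linarith) hs ht]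
  have hswap : ∫⁻ r, ∫⁻ r', eposRpow (2 * H - 1) (t - r) * eposRpow 0 r *
        (eposRpow (2 * H - 1) (s - r') * eposRpow 0 r') * eposRpow (-(2 * H)) (r' - r)
      = ENNReal.ofReal (beta (1 - 2 * H) (2 * H)) *
        ENNReal.ofReal ((t ^ (2 * H) - posRpow (2 * H) (t - s)) / (2 * H)) := by
    rw [← lintegral_lintegral_riesz (by linarith) (by linarith) ht hs,
      lintegral_lintegral_swap (by fun_prop)]
    exact lintegral_congr fun r => lintegral_congr fun r' => by ring
  have hpos : posRpow (2 * H) (t - s) = (t - s) ^ (2 * H) := by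
    rcases hst.lt_or_eq with h | rfl
    · exact posRpow_of_pos (sub_pos.2 h)
    · rw [sub_self, posRpow_of_nonpos le_rfl, Real.zero_rpow (by linarith)]
  rw [hswap, hpos, posRpow_of_nonpos (sub_nonpos.2 hst), abs_of_nonneg (sub_nonneg.2 hst), sub_zero,
    ← mul_add, ← ENNReal.ofReal_add (by positivity) (div_nonneg hnonneg (by linarith))]
  ring_nf

lemma lintegral_volterraE_mul {s t : ℝ} (hs : 0 ≤ s) (ht : 0 ≤ t) :
    ∫⁻ u, volterraE H t u * volterraE H s u
      = ENNReal.ofReal (beta (2 * H) (1 / 2 - H)) * (ENNReal.ofReal (beta (1 - 2 * H) (2 * H)) *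
        ENNReal.ofReal ((s ^ (2 * H) + t ^ (2 * H) - |t - s| ^ (2 * H)) / (2 * H))) := by
  have hE : ∀ t u, volterraE H t u = ∫⁻ r, eposRpow (H - 1 / 2) u *
      (eposRpow (1 / 2 - H - 1) (r - u) * eposRpow (2 * H - 1) (t - r) * eposRpow (1 / 2 - H) r) :=
    fun t u => (lintegral_const_mul _ (by fun_prop)).symm
  simp_rw [hE]
  rw [← lintegral_lintegral_riesz_symm hH0 hH1 hs ht,
    lintegral_congr fun u => (lintegral_lintegral_mul (by fun_prop) (by fun_prop)).symm,
    lintegral_lintegral_swap (by fun_prop), ← lintegral_const_mul _ (by fun_prop)]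
  refine lintegral_congr fun r => ?_
  rw [lintegral_lintegral_swap (by fun_prop), ← lintegral_const_mul _ (by fun_prop)]
  refine lintegral_congr_ae ?_
  filter_upwards [compl_mem_ae_iff.2 (measure_singleton r)] with r' hr'
  exact lintegral_volterraE_integrand_mul hH0 hH1 s t (Ne.symm hr')

lemma volterraConst_sq :
    volterraConst H ^ 2 * beta (1 - 2 * H) (2 * H) = H * beta (1 / 2 - H) (2 * H) := by
  have hB := beta_pos (show 0 < 1 - 2 * H by linarith) (show 0 < H + 1 / 2 by linarith)
  have : 1 - 2 * H ≠ 0 := by linarith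
  rw [beta_one_sub_eq hH0 hH1, volterraConst,
    Real.sq_sqrt (div_nonneg (by linarith) (mul_nonneg (by linarith) hB.le))]
  generalize beta (1 - 2 * H) (H + 1 / 2) = β at *
  field_simp

lemma lintegral_volterraK_mul {s t : ℝ} (hs : 0 ≤ s) (ht : 0 ≤ t) :
    ∫⁻ u, ENNReal.ofReal (volterraK H t u * volterraK H s u)
      = ENNReal.ofReal ((s ^ (2 * H) + t ^ (2 * H) - |t - s| ^ (2 * H)) / 2) := by
  have hB := beta_pos (show 0 < 1 / 2 - H by linarith) (show 0 < 2 * H by linarith)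
  have hB' := beta_pos (show 0 < 1 - 2 * H by linarith) (show 0 < 2 * H by linarith)
  have hc := div_nonneg (volterraConst_nonneg H) hB.le
  have hK : ∀ u, ENNReal.ofReal (volterraK H t u * volterraK H s u)
      = ENNReal.ofReal ((volterraConst H / beta (1 / 2 - H) (2 * H)) ^ 2) *
        (volterraE H t u * volterraE H s u) := fun u => by
    rw [ENNReal.ofReal_mul (volterraK_nonneg hH1.le t u), ofReal_volterraK hH0 hH1,
      ofReal_volterraK hH0 hH1, sq, ENNReal.ofReal_mul hc]
    ring
  simp_rw [hK]
  rw [lintegral_const_mul _ (by fun_prop), lintegral_volterraE_mul hH0 hH1 hs ht, beta_comm (2 * H),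
    ← ENNReal.ofReal_mul hB'.le, ← ENNReal.ofReal_mul hB.le, ← ENNReal.ofReal_mul (by positivity)]
  have hsq := volterraConst_sq hH0 hH1
  generalize beta (1 / 2 - H) (2 * H) = β at *
  congr 1
  field_simp
  linear_combination (s ^ (2 * H) + t ^ (2 * H) - |t - s| ^ (2 * H)) * hsq

lemma memLp_volterraK {t : ℝ} (ht : 0 ≤ t) : MemLp (volterraK H t) 2 := by
  have hmeas := measurable_volterraK hH0 hH1 t
  rw [memLp_two_iff_integrable_sq hmeas.aestronglyMeasurable]
  refine ⟨(hmeas.pow_const 2).aestronglyMeasurable, ?_⟩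
  rw [hasFiniteIntegral_iff_ofReal (.of_forall fun u => sq_nonneg _)]
  simp_rw [sq]
  rw [lintegral_volterraK_mul hH0 hH1 ht ht]
  exact ENNReal.ofReal_lt_top

lemma integral_volterraK_mul {s t : ℝ} (hs : 0 ≤ s) (ht : 0 ≤ t) :
    ∫ u, volterraK H t u * volterraK H s u
      = (s ^ (2 * H) + t ^ (2 * H) - |t - s| ^ (2 * H)) / 2 := by
  rw [integral_eq_lintegral_of_nonneg_ae
    (.of_forall fun u => mul_nonneg (volterraK_nonneg hH1.le t u) (volterraK_nonneg hH1.le s u))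
    ((measurable_volterraK hH0 hH1 t).mul (measurable_volterraK hH0 hH1 s)).aestronglyMeasurable,
    lintegral_volterraK_mul hH0 hH1 hs ht, ENNReal.toReal_ofReal]
  wlog hst : s ≤ t generalizing s t
  · rw [abs_sub_comm, add_comm (s ^ _)]
    exact this ht hs (le_of_not_ge hst)
  have := Real.rpow_nonneg hs (2 * H)
  have : (t - s) ^ (2 * H) ≤ t ^ (2 * H) :=
    Real.rpow_le_rpow (sub_nonneg.2 hst) (by linarith) (by linarith)
  rw [abs_of_nonneg (sub_nonneg.2 hst)]
  linarith

end Covariance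

/-! ### Totality of the Volterra kernels -/

/-- The Riemann–Liouville fractional integral of order `α`, up to the factor `Γ(α)`. -/
def abelTransform (α : ℝ) (φ : ℝ → ℝ) (t : ℝ) : ℝ := ∫ r, posRpow (α - 1) (t - r) * φ r

lemma abelTransform_congr {α t : ℝ} {φ ψ : ℝ → ℝ} (h : ∀ r < t, φ r = ψ r) :
    abelTransform α φ t = abelTransform α ψ t := by
  refine integral_congr_ae (.of_forall fun r => ?_)
  rcases lt_or_ge r t with hr | hr
  · simp only [h r hr]
  · simp only [posRpow_of_nonpos (sub_nonpos.2 hr), zero_mul]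

lemma lintegral_enorm_prod_mul {X Y : Type*} [MeasurableSpace X] [MeasurableSpace Y]
    {μ : Measure X} {ν : Measure Y} [SFinite μ] [SFinite ν] {k : X × Y → ℝ} {φ : Y → ℝ}
    (hk : AEStronglyMeasurable k (μ.prod ν)) (hφ : AEStronglyMeasurable φ ν) :
    ∫⁻ p, ‖k p * φ p.2‖ₑ ∂(μ.prod ν) = ∫⁻ y, (∫⁻ x, ‖k (x, y)‖ₑ ∂μ) * ‖φ y‖ₑ ∂ν := by
  refine (lintegral_prod_symm _ (hk.mul hφ.comp_snd).enorm).trans ?_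
  simp only [Pi.mul_apply, enorm_mul]
  exact lintegral_congr fun y => lintegral_mul_const' _ _ enorm_ne_top

lemma integrable_prod_mul_of_lintegral_enorm_le {X Y : Type*} [MeasurableSpace X]
    [MeasurableSpace Y] {μ : Measure X} {ν : Measure Y} [SFinite μ] [SFinite ν] {k : X × Y → ℝ}
    {φ : Y → ℝ} {C : ℝ≥0∞} (hk : AEStronglyMeasurable k (μ.prod ν))
    (hC : C ≠ ⊤) (hkC : ∀ y, ∫⁻ x, ‖k (x, y)‖ₑ ∂μ ≤ C) (hφ : Integrable φ ν) :
    Integrable (fun p => k p * φ p.2) (μ.prod ν) := by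
  refine ⟨hk.mul hφ.1.comp_snd, ?_⟩
  rw [hasFiniteIntegral_iff_enorm, lintegral_enorm_prod_mul hk hφ.1]
  calc _ ≤ ∫⁻ y, C * ‖φ y‖ₑ ∂ν := lintegral_mono fun y => by gcongr; exact hkC y
    _ = C * ∫⁻ y, ‖φ y‖ₑ ∂ν := lintegral_const_mul' _ _ hC
    _ < ⊤ := ENNReal.mul_lt_top hC.lt_top hφ.2

lemma enorm_posRpow (a x : ℝ) : ‖posRpow a x‖ₑ = eposRpow a x :=
  Real.enorm_of_nonneg (posRpow_nonneg a x)

lemma eposRpow_le_eposRpow {a x y : ℝ} (ha : 0 ≤ a) (hxy : x ≤ y) :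
    eposRpow a x ≤ eposRpow a y := by
  rcases le_or_gt x 0 with hx | hx
  · rw [eposRpow_of_nonpos hx]
    exact zero_le
  · rw [eposRpow_of_pos hx, eposRpow_of_pos (hx.trans_le hxy)]
    exact ENNReal.ofReal_le_ofReal (Real.rpow_le_rpow hx.le hxy ha)

lemma setLIntegral_Ioo_eposRpow_sub_le {α : ℝ} (hα0 : 0 < α) (hα1 : α ≤ 1) (a b s : ℝ) :
    ∫⁻ r in Ioo a b, eposRpow (α - 1) (r - s) ≤ ENNReal.ofReal (beta α 1) * eposRpow α (b - a) := by
  have hpt : ∀ r ∈ Ioo a b,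
      eposRpow (α - 1) (r - s) ≤ eposRpow (α - 1) (r - max s a) * eposRpow (1 - 1) (b - r) := by
    intro r hr
    rw [sub_self, eposRpow_of_pos (sub_pos.2 hr.2), Real.rpow_zero, ENNReal.ofReal_one, mul_one]
    rcases le_or_gt r s with hrs | hrs
    · rw [eposRpow_of_nonpos (sub_nonpos.2 hrs)]
      exact zero_le
    · have hmax : 0 < r - max s a := sub_pos.2 (max_lt hrs hr.1)
      rw [eposRpow_of_pos (sub_pos.2 hrs), eposRpow_of_pos hmax]
      exact ENNReal.ofReal_le_ofReal (Real.rpow_le_rpow_of_nonpos hmax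
        (sub_le_sub_left (le_max_left _ _) _) (sub_nonpos.2 hα1))
  calc _ ≤ ∫⁻ r in Ioo a b, eposRpow (α - 1) (r - max s a) * eposRpow (1 - 1) (b - r) :=
        setLIntegral_mono' measurableSet_Ioo hpt
    _ ≤ ∫⁻ r, eposRpow (α - 1) (r - max s a) * eposRpow (1 - 1) (b - r) :=
        setLIntegral_le_lintegral _ _
    _ = ENNReal.ofReal (beta α 1) * eposRpow α (b - max s a) := by
        rw [lintegral_beta hα0 one_pos, add_sub_cancel_right]
    _ ≤ _ := by
        gcongr
        exact eposRpow_le_eposRpow hα0.le (sub_le_sub_left (le_max_right _ _) _)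

lemma integral_beta {a b : ℝ} (ha : 0 < a) (hb : 0 < b) (s t : ℝ) :
    ∫ r, posRpow (a - 1) (r - s) * posRpow (b - 1) (t - r)
      = beta a b * posRpow (a + b - 1) (t - s) := by
  rw [integral_eq_lintegral_of_nonneg_ae
    (.of_forall fun r => mul_nonneg (posRpow_nonneg _ _) (posRpow_nonneg _ _))
    (Measurable.aestronglyMeasurable (by fun_prop))]
  have hbeta := lintegral_beta ha hb s t
  simp only [eposRpow, ← ENNReal.ofReal_mul (posRpow_nonneg _ _)] at hbeta
  rw [hbeta, ← ENNReal.ofReal_mul (beta_pos ha hb).le,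
    ENNReal.toReal_ofReal (mul_nonneg (beta_pos ha hb).le (posRpow_nonneg _ _))]

section Abel

variable {α : ℝ} (hα0 : 0 < α) (hα1 : α < 1) {φ : ℝ → ℝ} (hφ : Integrable φ)
include hα0 hα1 hφ

lemma integrableOn_abelTransform (a b : ℝ) : IntegrableOn (abelTransform α φ) (Ioo a b) := by
  have hle (s : ℝ) := setLIntegral_Ioo_eposRpow_sub_le hα0 hα1.le a b s
  simp only [← enorm_posRpow (α - 1)] at hle
  exact (integrable_prod_mul_of_lintegral_enorm_le (μ := volume.restrict (Ioo a b)) (ν := volume)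
    (k := fun p : ℝ × ℝ => posRpow (α - 1) (p.1 - p.2))
    (Measurable.aestronglyMeasurable (by fun_prop))
    (ENNReal.mul_ne_top ENNReal.ofReal_ne_top (eposRpow_ne_top α (b - a))) hle
    hφ).integral_prod_left

lemma abelTransform_abelTransform (x : ℝ) :
    abelTransform (1 - α) (abelTransform α φ) x = beta (1 - α) α * ∫ r in Iio x, φ r := by
  have hk : ∀ r, ∫⁻ t, ‖posRpow (1 - α - 1) (x - t) * posRpow (α - 1) (t - r)‖ₑ
      = ENNReal.ofReal (beta (1 - α) α) * eposRpow 0 (x - r) := fun r => by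
    simp_rw [enorm_mul, enorm_posRpow, mul_comm (eposRpow (1 - α - 1) _)]
    rw [lintegral_beta hα0 (sub_pos.2 hα1), beta_comm, show α + (1 - α) - 1 = 0 by ring]
  have hle : ∀ u, eposRpow 0 u ≤ 1 := fun u => by
    rcases le_or_gt u 0 with hu | hu
    · simp only [eposRpow_of_nonpos hu, zero_le]
    · rw [eposRpow_of_pos hu, Real.rpow_zero, ENNReal.ofReal_one]
  have hint := integrable_prod_mul_of_lintegral_enorm_le (C := ENNReal.ofReal (beta (1 - α) α))
    (μ := volume) (ν := volume)
    (k := fun p : ℝ × ℝ => posRpow (1 - α - 1) (x - p.1) * posRpow (α - 1) (p.1 - p.2))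
    (Measurable.aestronglyMeasurable (by fun_prop)) ENNReal.ofReal_ne_top
    (fun r => (hk r).trans_le (mul_le_of_le_one_right' (hle _))) hφ
  have hinner : ∀ r, ∫ t, posRpow (1 - α - 1) (x - t) * posRpow (α - 1) (t - r) * φ r
      = beta (1 - α) α * (Iio x).indicator φ r := fun r => by
    simp_rw [integral_mul_const, mul_comm (posRpow (1 - α - 1) _)]
    rw [integral_beta hα0 (sub_pos.2 hα1), beta_comm, show α + (1 - α) - 1 = 0 by ring, mul_assoc]
    rcases lt_or_ge r x with hr | hr
    · rw [indicator_of_mem (mem_Iio.2 hr), posRpow_zero (sub_pos.2 hr), one_mul]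
    · rw [indicator_of_notMem (notMem_Iio.2 hr), posRpow_of_nonpos (sub_nonpos.2 hr), zero_mul]
  calc _ = ∫ t, ∫ r, posRpow (1 - α - 1) (x - t) * posRpow (α - 1) (t - r) * φ r := by
        simp_rw [abelTransform, ← integral_const_mul, mul_assoc]
    _ = _ := by
        rw [integral_integral_swap hint]
        simp_rw [hinner]
        rw [integral_const_mul, integral_indicator measurableSet_Iio]

end Abel

lemma ae_eq_zero_of_forall_setIntegral_Iio_eq_zero {φ : ℝ → ℝ} {T : ℝ} (hφ : Integrable φ)
    (h : ∀ x < T, ∫ r in Iio x, φ r = 0) : ∀ᵐ r, r < T → φ r = 0 := by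
  filter_upwards [LocallyIntegrable.ae_hasDerivAt_integral hφ.locallyIntegrable] with x hx hxT
  refine (hx (x - 1)).unique ((hasDerivAt_const x (0 : ℝ)).congr_of_eventuallyEq ?_)
  filter_upwards [Iio_mem_nhds hxT] with y hy
  rw [← intervalIntegral.integral_Iic_sub_Iic hφ.integrableOn hφ.integrableOn,
    integral_Iic_eq_integral_Iio, integral_Iic_eq_integral_Iio, h y hy, h _ (by linarith), sub_zero]

lemma ae_eq_zero_of_abelTransform {α T : ℝ} (hα0 : 0 < α) (hα1 : α < 1) {φ : ℝ → ℝ}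
    (hφ : Integrable φ) (h : ∀ᵐ t, t < T → abelTransform α φ t = 0) :
    ∀ᵐ r, r < T → φ r = 0 := by
  refine ae_eq_zero_of_forall_setIntegral_Iio_eq_zero hφ fun x hx => ?_
  have habel := abelTransform_abelTransform hα0 hα1 hφ x
  have hzero : abelTransform (1 - α) (abelTransform α φ) x = 0 := by
    refine integral_eq_zero_of_ae ?_
    filter_upwards [h] with t ht
    rcases le_or_gt x t with hxt | hxt
    · rw [posRpow_of_nonpos (sub_nonpos.2 hxt), zero_mul, Pi.zero_apply]
    · rw [ht (hxt.trans hx), mul_zero, Pi.zero_apply]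
  rw [hzero] at habel
  exact (mul_eq_zero.1 habel.symm).resolve_left (beta_pos (sub_pos.2 hα1) hα0).ne'

/-- The integrand of `volterraE`, with the prefactor included, as a real function of `(r, s)`. -/
def volterraIntegrand (H t : ℝ) (p : ℝ × ℝ) : ℝ :=
  posRpow (2 * H - 1) (t - p.1) * (posRpow (1 / 2 - H) p.1 *
    (posRpow (1 / 2 - H - 1) (p.1 - p.2) * posRpow (H - 1 / 2) p.2))

@[fun_prop]
lemma measurable_volterraIntegrand (H t : ℝ) : Measurable (volterraIntegrand H t) := by
  unfold volterraIntegrand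
  fun_prop

lemma volterraIntegrand_nonneg (H t : ℝ) (p : ℝ × ℝ) : 0 ≤ volterraIntegrand H t p :=
  mul_nonneg (posRpow_nonneg _ _) (mul_nonneg (posRpow_nonneg _ _)
    (mul_nonneg (posRpow_nonneg _ _) (posRpow_nonneg _ _)))

lemma lintegral_enorm_volterraIntegrand (H t s : ℝ) :
    ∫⁻ r, ‖volterraIntegrand H t (r, s)‖ₑ = volterraE H t s := by
  simp only [volterraIntegrand, enorm_mul, enorm_posRpow]
  rw [volterraE, ← lintegral_const_mul _ (by fun_prop)]
  exact lintegral_congr fun r => by ring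

lemma integrable_posRpow_mul {H T : ℝ} (hH0 : 0 < H) {g : ℝ → ℝ}
    (hg : MemLp g 2) (hsupp : ∀ s ∉ Ioo 0 T, g s = 0) :
    Integrable fun s => posRpow (H - 1 / 2) s * g s := by
  have hpow : MemLp (fun s => (Ioo 0 T).indicator (posRpow (H - 1 / 2)) s) 2 := by
    have hmeas := (measurable_posRpow (H - 1 / 2)).indicator (measurableSet_Ioo (a := 0) (b := T))
    rw [memLp_two_iff_integrable_sq hmeas.aestronglyMeasurable]
    have hsq : ∀ s, (Ioo 0 T).indicator (posRpow (H - 1 / 2)) s ^ 2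
      = (Ioo 0 T).indicator (fun s => s ^ (2 * H - 1)) s := fun s => by
      by_cases hs : s ∈ Ioo 0 T
      · rw [indicator_of_mem hs, indicator_of_mem hs, posRpow_of_pos hs.1, sq, ← Real.rpow_add hs.1]
        ring_nf
      · rw [indicator_of_notMem hs, indicator_of_notMem hs, sq, zero_mul]
    simp_rw [hsq]
    rw [integrable_indicator_iff measurableSet_Ioo]
    exact (intervalIntegral.intervalIntegrable_rpow' (by linarith)).1.mono_set Ioo_subset_Ioc_self
  refine (hpow.integrable_mul hg).congr (.of_forall fun s => ?_)
  by_cases hs : s ∈ Ioo 0 T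
  · simp only [Pi.mul_apply, indicator_of_mem hs]
  · simp only [Pi.mul_apply, hsupp s hs, mul_zero]

section Totality

variable {H : ℝ} (hH0 : 0 < H) (hH1 : H < 1 / 2)
include hH0 hH1

lemma volterraConst_pos : 0 < volterraConst H := by
  have := beta_pos (show 0 < 1 - 2 * H by linarith) (show 0 < H + 1 / 2 by linarith)
  have : 0 < 1 - 2 * H := by linarith
  exact Real.sqrt_pos.2 (by positivity)

lemma volterraK_eq_integral (t s : ℝ) :
    volterraK H t s
      = volterraConst H / beta (1 / 2 - H) (2 * H) * ∫ r, volterraIntegrand H t (r, s) := by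
  have hB := beta_pos (show 0 < 1 / 2 - H by linarith) (show 0 < 2 * H by linarith)
  rw [integral_eq_lintegral_of_nonneg_ae (.of_forall fun r => volterraIntegrand_nonneg H t (r, s))
    (Measurable.aestronglyMeasurable (by fun_prop))]
  simp_rw [← Real.enorm_of_nonneg (volterraIntegrand_nonneg H t _)]
  rw [lintegral_enorm_volterraIntegrand, ← ENNReal.toReal_ofReal (volterraK_nonneg hH1.le t s),
    ofReal_volterraK hH0 hH1, ENNReal.toReal_mul,
    ENNReal.toReal_ofReal (div_nonneg (volterraConst_nonneg H) hB.le)]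

lemma integral_volterraK_mul_eq_abelTransform {t : ℝ} {g : ℝ → ℝ} (hg : AEStronglyMeasurable g)
    (hKg : Integrable fun s => volterraK H t s * g s) :
    ∫ s, volterraK H t s * g s
      = volterraConst H / beta (1 / 2 - H) (2 * H) * abelTransform (2 * H) (fun r =>
        posRpow (1 / 2 - H) r * abelTransform (1 / 2 - H) (fun s => posRpow (H - 1 / 2) s * g s) r)
          t := by
  have hB := beta_pos (show 0 < 1 / 2 - H by linarith) (show 0 < 2 * H by linarith)
  have hc := div_pos (volterraConst_pos hH0 hH1) hB
  have hint : Integrable (fun p : ℝ × ℝ => volterraIntegrand H t p * g p.2)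
      (volume.prod volume) := by
    have hmeas := (measurable_volterraIntegrand H t).aestronglyMeasurable (μ := volume.prod volume)
    refine ⟨hmeas.mul hg.comp_snd, ?_⟩
    rw [hasFiniteIntegral_iff_enorm, lintegral_enorm_prod_mul hmeas hg]
    simp_rw [lintegral_enorm_volterraIntegrand]
    have hfin := hKg.2
    simp_rw [hasFiniteIntegral_iff_enorm, enorm_mul,
      Real.enorm_of_nonneg (volterraK_nonneg hH1.le t _), ofReal_volterraK hH0 hH1,
      mul_assoc] at hfin
    rw [lintegral_const_mul' _ _ ENNReal.ofReal_ne_top] at hfin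
    exact ENNReal.lt_top_of_mul_ne_top_right hfin.ne (ENNReal.ofReal_pos.2 hc).ne'
  calc _ = volterraConst H / beta (1 / 2 - H) (2 * H) *
        ∫ s, ∫ r, volterraIntegrand H t (r, s) * g s := by
        simp_rw [volterraK_eq_integral hH0 hH1, mul_assoc, integral_const_mul, integral_mul_const]
    _ = _ := by
        rw [← integral_integral_swap hint]
        simp only [abelTransform, volterraIntegrand, ← integral_const_mul, mul_assoc]

lemma abelTransform_eq_zero_of_forall_integral_volterraK {T : ℝ} {g : ℝ → ℝ} (hg : MemLp g 2)
    (h : ∀ t ∈ Ioo 0 T, ∫ s, volterraK H t s * g s = 0) {t : ℝ} (ht : t < T) :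
    abelTransform (2 * H) ((Ioo 0 T).indicator fun r => posRpow (1 / 2 - H) r *
      abelTransform (1 / 2 - H) (fun s => posRpow (H - 1 / 2) s * g s) r) t = 0 := by
  have hB := beta_pos (show 0 < 1 / 2 - H by linarith) (show 0 < 2 * H by linarith)
  rcases le_or_gt t 0 with ht0 | ht0
  · rw [abelTransform_congr (ψ := 0) fun r hr =>
      indicator_of_notMem (fun hr0 => (hr0.1.trans hr).not_ge ht0) _]
    simp only [abelTransform, Pi.zero_apply, mul_zero, integral_zero]
  · have hK := integral_volterraK_mul_eq_abelTransform hH0 hH1 hg.1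
      ((memLp_volterraK hH0 hH1 ht0.le).integrable_mul hg)
    rw [h t ⟨ht0, ht⟩] at hK
    refine (abelTransform_congr fun r hr => indicator_apply_eq_self.2 fun hr0 => ?_).trans
      ((mul_eq_zero.1 hK.symm).resolve_left (div_pos (volterraConst_pos hH0 hH1) hB).ne')
    rw [posRpow_of_nonpos (not_lt.1 fun h0 => hr0 ⟨h0, hr.trans ht⟩), zero_mul]

lemma ae_eq_zero_of_forall_integral_volterraK {T : ℝ} {g : ℝ → ℝ} (hg : MemLp g 2)
    (hsupp : ∀ s ∉ Ioo 0 T, g s = 0) (h : ∀ t ∈ Ioo 0 T, ∫ s, volterraK H t s * g s = 0) :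
    g =ᵐ[volume] 0 := by
  have hpos (a : ℝ) {r : ℝ} (hr : 0 < r) : posRpow a r ≠ 0 := by
    rw [posRpow_of_pos hr]
    exact (Real.rpow_pos_of_pos hr a).ne'
  have hg₀ := integrable_posRpow_mul hH0 hg hsupp
  let ψ := abelTransform (1 / 2 - H) fun s => posRpow (H - 1 / 2) s * g s
  have hφ : IntegrableOn (fun r => posRpow (1 / 2 - H) r * ψ r) (Ioo 0 T) := by
    refine (integrableOn_abelTransform (by linarith) (by linarith) hg₀ 0 T).bdd_mul
      (c := T ^ (1 / 2 - H)) (measurable_posRpow _).aestronglyMeasurable ?_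
    filter_upwards [ae_restrict_mem measurableSet_Ioo] with r hr
    rw [posRpow_of_pos hr.1, Real.norm_of_nonneg (Real.rpow_nonneg hr.1.le _)]
    exact Real.rpow_le_rpow hr.1.le hr.2.le (by linarith)
  have hψ : ∀ᵐ r, r < T → ψ r = 0 := by
    filter_upwards [ae_eq_zero_of_abelTransform (by linarith) (by linarith)
      (hφ.integrable_indicator measurableSet_Ioo) (.of_forall fun t ht =>
        abelTransform_eq_zero_of_forall_integral_volterraK hH0 hH1 hg h ht)] with r hr hrT
    rcases le_or_gt r 0 with hr0 | hr0
    · rw [show ψ r = _ from abelTransform_congr (ψ := 0) fun s hs => by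
        rw [posRpow_of_nonpos (hs.le.trans hr0), zero_mul, Pi.zero_apply]]
      simp only [abelTransform, Pi.zero_apply, mul_zero, integral_zero]
    · have hzero := hr hrT
      rw [indicator_of_mem (show r ∈ Ioo 0 T from ⟨hr0, hrT⟩)] at hzero
      exact (mul_eq_zero.1 hzero).resolve_left (hpos _ hr0)
  filter_upwards [ae_eq_zero_of_abelTransform (by linarith) (by linarith) hg₀ hψ] with s hs
  by_cases hsT : s ∈ Ioo 0 T
  · exact (mul_eq_zero.1 (hs hsT.2)).resolve_left (hpos _ hsT.1)
  · exact hsupp s hsT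

end Totality

/-! ### The operator `Λ_H` on Hölder functions -/

/-- The derivative of `K_{H,1}(t, ·)` on `(0, t)`. -/
def kernelOneDeriv (H t s : ℝ) : ℝ :=
  volterraConst H * (1 / 2 - H) * t ^ (H - 1 / 2) *
    (s ^ (-1 / 2 - H) * (t - s) ^ (H - 1 / 2) + s ^ (1 / 2 - H) * (t - s) ^ (H - 3 / 2))

/-- The derivative of `-K_{H,2}(t, ·)` on `(0, t)`; the sign makes it nonnegative. -/
def kernelTwoNegDeriv (H t s : ℝ) : ℝ :=
  volterraConst H * (1 / 2 - H) *
    ((1 / 2 - H) * s ^ (H - 3 / 2) * incBeta (1 - 2 * H) (H + 1 / 2) (s / t) +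
      t ^ (H - 1 / 2) * s ^ (-1 / 2 - H) * (t - s) ^ (H - 1 / 2))

lemma kernelOneDeriv_nonneg {H s t : ℝ} (hH1 : H ≤ 1 / 2) (hs : 0 < s) (hst : s < t) :
    0 ≤ kernelOneDeriv H t s := by
  have := volterraConst_nonneg H
  have := hs.trans hst
  have := sub_pos.2 hst
  have := sub_nonneg.2 hH1
  unfold kernelOneDeriv
  positivity

lemma kernelTwoNegDeriv_nonneg {H s t : ℝ} (hH1 : H ≤ 1 / 2) (hs : 0 < s) (hst : s < t) :
    0 ≤ kernelTwoNegDeriv H t s := by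
  have := volterraConst_nonneg H
  have := hs.trans hst
  have := sub_pos.2 hst
  have := sub_nonneg.2 hH1
  have := incBeta_nonneg (a := 1 - 2 * H) (b := H + 1 / 2)
    ((div_le_one (hs.trans hst)).2 hst.le)
  unfold kernelTwoNegDeriv
  positivity

@[fun_prop]
lemma measurable_kernelOneDeriv (H t : ℝ) : Measurable (kernelOneDeriv H t) := by
  unfold kernelOneDeriv
  fun_prop

lemma hasDerivAt_kernelOne {H s t : ℝ} (hs : 0 < s) (hst : s < t) :
    HasDerivAt (kernelOne H t) (kernelOneDeriv H t s) s := by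
  have hleft := (hasDerivAt_id s).rpow_const (p := 1 / 2 - H) (.inl hs.ne')
  have hright := ((hasDerivAt_id s).const_sub t).rpow_const (p := H - 1 / 2)
    (.inl (sub_pos.2 hst).ne')
  refine ((hleft.const_mul (volterraConst H * t ^ (H - 1 / 2))).mul hright).congr_deriv ?_
  simp only [id, kernelOneDeriv]
  rw [show 1 / 2 - H - 1 = -1 / 2 - H by ring, show H - 1 / 2 - 1 = H - 3 / 2 by ring]
  ring

lemma kernelOneDeriv_scale {H t u : ℝ} (ht : 0 < t) (hu : u ∈ Ioo (0 : ℝ) 1) :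
    kernelOneDeriv H t (t * u) = t ^ (H - 3 / 2) * kernelOneDeriv H 1 u := by
  have hu1 : 0 < 1 - u := sub_pos.2 hu.2
  have hleft : t ^ (H - 1 / 2) * t ^ (-1 / 2 - H) * t ^ (H - 1 / 2) = t ^ (H - 3 / 2) := by
    rw [← Real.rpow_add ht, ← Real.rpow_add ht]
    ring_nf
  have hright : t ^ (H - 1 / 2) * t ^ (1 / 2 - H) = 1 := by
    rw [← Real.rpow_add ht, sub_add_sub_cancel, sub_self, Real.rpow_zero]
  simp only [kernelOneDeriv, ← mul_one_sub t u, Real.mul_rpow ht.le hu.1.le,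
    Real.mul_rpow ht.le hu1.le, Real.one_rpow]
  linear_combination
    (volterraConst H * (1 / 2 - H) * u ^ (-1 / 2 - H) * (1 - u) ^ (H - 1 / 2)) * hleft +
    (volterraConst H * (1 / 2 - H) * t ^ (H - 3 / 2) * u ^ (1 / 2 - H) *
      (1 - u) ^ (H - 3 / 2)) * hright

lemma kernelTwoNegDeriv_scale {H t u : ℝ} (ht : 0 < t) (hu : u ∈ Ioo (0 : ℝ) 1) :
    kernelTwoNegDeriv H t (t * u) = t ^ (H - 3 / 2) * kernelTwoNegDeriv H 1 u := by
  have hu1 : 0 < 1 - u := sub_pos.2 hu.2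
  have hpow : t ^ (H - 1 / 2) * t ^ (-1 / 2 - H) * t ^ (H - 1 / 2) = t ^ (H - 3 / 2) := by
    rw [← Real.rpow_add ht, ← Real.rpow_add ht]
    ring_nf
  simp only [kernelTwoNegDeriv, ← mul_one_sub t u, Real.mul_rpow ht.le hu.1.le,
    Real.mul_rpow ht.le hu1.le, Real.one_rpow, mul_div_cancel_left₀ _ ht.ne', div_one]
  linear_combination
    (volterraConst H * (1 / 2 - H) * u ^ (-1 / 2 - H) * (1 - u) ^ (H - 1 / 2)) * hpow

lemma setIntegral_Ioo_scale {t : ℝ} (ht : 0 < t) (F : ℝ → ℝ) :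
    ∫ s in Ioo 0 t, F s = t * ∫ u in Ioo 0 1, F (t * u) := by
  have h := intervalIntegral.smul_integral_comp_mul_left (a := 0) (b := 1) F t
  rw [mul_zero, mul_one, intervalIntegral.integral_of_le ht.le,
    intervalIntegral.integral_of_le zero_le_one, integral_Ioc_eq_integral_Ioo,
    integral_Ioc_eq_integral_Ioo, smul_eq_mul] at h
  exact h.symm

lemma integrableOn_Ioo_scale_iff {t : ℝ} (ht : 0 < t) {F : ℝ → ℝ} :
    IntegrableOn (fun u => F (t * u)) (Ioo 0 1) ↔ IntegrableOn F (Ioo 0 t) := by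
  rw [← intervalIntegrable_iff_integrableOn_Ioo_of_le zero_le_one,
    ← intervalIntegrable_iff_integrableOn_Ioo_of_le ht.le,
    ← IntervalIntegrable.comp_mul_left_iff (f := F) ht.ne', zero_div, div_self ht.ne']

section Kernel

variable {H : ℝ} (hH0 : 0 < H) (hH1 : H < 1 / 2)
include hH0 hH1

lemma measurable_kernelTwoNegDeriv (t : ℝ) : Measurable (kernelTwoNegDeriv H t) := by
  have := (continuous_incBeta (show 0 < 1 - 2 * H by linarith)
    (show 0 < H + 1 / 2 by linarith)).measurable
  unfold kernelTwoNegDeriv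
  fun_prop

lemma hasDerivAt_incBeta_div_const {s t : ℝ} (hs : 0 < s) (hst : s < t) :
    HasDerivAt (fun s => incBeta (1 - 2 * H) (H + 1 / 2) (s / t))
      (-(t ^ (H - 1 / 2) * s ^ (-(2 * H)) * (t - s) ^ (H - 1 / 2))) s := by
  have ht : 0 < t := hs.trans hst
  have hbeta := (hasDerivAt_incBeta (show 0 < 1 - 2 * H by linarith)
    (show 0 < H + 1 / 2 by linarith) (y := s / t)
    ⟨by positivity, (div_lt_one ht).2 hst⟩).comp s ((hasDerivAt_id s).div_const t)
  refine hbeta.congr_deriv ?_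
  have hpow : t ^ (H - 1 / 2) = (t ^ (-(2 * H)) * t ^ (H - 1 / 2) * t)⁻¹ := by
    rw [← Real.rpow_add ht, ← Real.rpow_add_one ht.ne', ← Real.rpow_neg ht.le]
    ring_nf
  rw [show 1 - s / t = (t - s) / t by field_simp, Real.div_rpow hs.le ht.le,
    Real.div_rpow (sub_pos.2 hst).le ht.le, show 1 - 2 * H - 1 = -(2 * H) by ring,
    show H + 1 / 2 - 1 = H - 1 / 2 by ring]
  conv_rhs => rw [hpow]
  field_simp

lemma hasDerivAt_kernelTwo {s t : ℝ} (hs : 0 < s) (hst : s < t) :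
    HasDerivAt (kernelTwo H t) (-kernelTwoNegDeriv H t s) s := by
  have hpow := (hasDerivAt_id s).rpow_const (p := H - 1 / 2) (.inl hs.ne')
  have hprod := ((hpow.mul ((hasDerivAt_incBeta_div_const hH0 hH1 hs hst).const_mul
    (1 / 2 - H))).const_mul (volterraConst H)).congr_of_eventuallyEq (f₁ := kernelTwo H t) <| by
      filter_upwards [Ioo_mem_nhds hs hst] with r hr using kernelTwo_eq hH0 hH1 hr.1 hr.2.le
  refine hprod.congr_deriv ?_
  have hs' : s ^ (-1 / 2 - H) = s ^ (H - 1 / 2) * s ^ (-(2 * H)) := by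
    rw [← Real.rpow_add hs]
    ring_nf
  simp only [id, kernelTwoNegDeriv, hs', show H - 1 / 2 - 1 = H - 3 / 2 by ring]
  ring

variable {lam : ℝ} (hlam : 1 / 2 - H < lam)
include hlam

lemma integrableOn_kernelOneDeriv_unit :
    IntegrableOn (fun u => (1 - u) ^ lam * kernelOneDeriv H 1 u) (Ioo 0 1) := by
  have h := ((integrable_betaWeight (a := 1 / 2 - H) (b := H + 1 / 2 + lam) (by linarith)
    (by linarith)).add (integrable_betaWeight (a := 3 / 2 - H) (b := H - 1 / 2 + lam) (by linarith)
    (by linarith))).const_mul (volterraConst H * (1 / 2 - H))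
  refine (h.integrableOn (s := Ioo 0 1)).congr_fun (fun u hu => ?_) measurableSet_Ioo
  have hu1 : 0 < 1 - u := sub_pos.2 hu.2
  simp only [Pi.add_apply, betaWeight_of_mem hu, kernelOneDeriv, Real.one_rpow,
    show H + 1 / 2 + lam - 1 = lam + (H - 1 / 2) by ring,
    show H - 1 / 2 + lam - 1 = lam + (H - 3 / 2) by ring, Real.rpow_add hu1,
    show 1 / 2 - H - 1 = -1 / 2 - H by ring, show 3 / 2 - H - 1 = 1 / 2 - H by ring]
  ring

lemma integrableOn_kernelTwoNegDeriv_unit :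
    IntegrableOn (fun u => u ^ lam * kernelTwoNegDeriv H 1 u) (Ioo 0 1) := by
  let c := volterraConst H * (1 / 2 - H)
  have h := (((integrable_betaWeight (a := H - 1 / 2 + lam) (b := 1) (by linarith)
    one_pos).const_mul ((1 / 2 - H) * beta (1 - 2 * H) (H + 1 / 2))).add
    (integrable_betaWeight (a := 1 / 2 - H + lam) (b := H + 1 / 2) (by linarith)
    (by linarith))).const_mul c
  refine (h.integrableOn (s := Ioo 0 1)).mono' (((by fun_prop : Measurable fun u : ℝ =>
    u ^ lam).mul (measurable_kernelTwoNegDeriv hH0 hH1 1)).aestronglyMeasurable) ?_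
  filter_upwards [ae_restrict_mem measurableSet_Ioo] with u hu
  have hbeta := incBeta_le_beta (show 0 < 1 - 2 * H by linarith)
    (show 0 < H + 1 / 2 by linarith) hu.2.le
  have := hu.1
  have := volterraConst_nonneg H
  have : 0 ≤ 1 / 2 - H := by linarith
  rw [Real.norm_of_nonneg (mul_nonneg (by positivity)
    (kernelTwoNegDeriv_nonneg hH1.le hu.1 hu.2))]
  calc u ^ lam * kernelTwoNegDeriv H 1 u
      = c * ((1 / 2 - H) * (u ^ lam * u ^ (H - 3 / 2)) * incBeta (1 - 2 * H) (H + 1 / 2) u +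
          u ^ lam * u ^ (-1 / 2 - H) * (1 - u) ^ (H - 1 / 2)) := by
        rw [kernelTwoNegDeriv, Real.one_rpow, div_one]
        ring
    _ ≤ c * ((1 / 2 - H) * (u ^ lam * u ^ (H - 3 / 2)) * beta (1 - 2 * H) (H + 1 / 2) +
          u ^ lam * u ^ (-1 / 2 - H) * (1 - u) ^ (H - 1 / 2)) := by
        gcongr
    _ = _ := by
        simp only [Pi.add_apply, betaWeight_of_mem hu, ← Real.rpow_add hu.1, sub_self,
          Real.rpow_zero]
        ring_nf

variable {t : ℝ} (ht : 0 < t)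
include ht

lemma integrableOn_kernelOneDeriv :
    IntegrableOn (fun s => (t - s) ^ lam * kernelOneDeriv H t s) (Ioo 0 t) := by
  refine (integrableOn_Ioo_scale_iff ht).1 <| IntegrableOn.congr_fun
    ((integrableOn_kernelOneDeriv_unit hH0 hH1 hlam).const_mul (t ^ lam * t ^ (H - 3 / 2)))
    (fun u hu => ?_) measurableSet_Ioo
  rw [kernelOneDeriv_scale ht hu, ← mul_one_sub, Real.mul_rpow ht.le (sub_pos.2 hu.2).le]
  ring

lemma integrableOn_kernelTwoNegDeriv :
    IntegrableOn (fun s => s ^ lam * kernelTwoNegDeriv H t s) (Ioo 0 t) := by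
  refine (integrableOn_Ioo_scale_iff ht).1 <| IntegrableOn.congr_fun
    ((integrableOn_kernelTwoNegDeriv_unit hH0 hH1 hlam).const_mul (t ^ lam * t ^ (H - 3 / 2)))
    (fun u hu => ?_) measurableSet_Ioo
  rw [kernelTwoNegDeriv_scale ht hu, Real.mul_rpow ht.le hu.1.le]
  ring

end Kernel

lemma fracOp_zero (H : ℝ) (f : ℝ → ℝ) : fracOp H f 0 = 0 := by
  simp only [fracOp, intervalIntegral.integral_same, sub_zero]

lemma fracOp_add_smul {H t : ℝ} {f g : ℝ → ℝ} (hf : FracOpConverges H f t)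
    (hg : FracOpConverges H g t) (a b : ℝ) :
    fracOp H (fun s => a * f s + b * g s) t = a * fracOp H f t + b * fracOp H g t := by
  have hone (s : ℝ) : (a * f t + b * g t - (a * f s + b * g s)) *
        deriv (fun r => kernelOne H t r) s =
      a * ((f t - f s) * deriv (fun r => kernelOne H t r) s) +
        b * ((g t - g s) * deriv (fun r => kernelOne H t r) s) := by ring
  have htwo (s : ℝ) : deriv (fun r => kernelTwo H t r) s * (a * f s + b * g s) =
      a * (deriv (fun r => kernelTwo H t r) s * f s) +
        b * (deriv (fun r => kernelTwo H t r) s * g s) := by ring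
  simp_rw [fracOp, hone, htwo]
  rw [intervalIntegral.integral_add (hf.1.const_mul a) (hg.1.const_mul b),
    intervalIntegral.integral_add (hf.2.const_mul a) (hg.2.const_mul b)]
  simp_rw [intervalIntegral.integral_const_mul]
  ring

section FracOp

variable {H t : ℝ} (hH0 : 0 < H) (hH1 : H < 1 / 2) (ht : 0 < t) (f : ℝ → ℝ)
include hH0 hH1 ht

lemma fracOp_eq :
    fracOp H f t = (∫ s in Ioo 0 t, (f t - f s) * kernelOneDeriv H t s) +
      ∫ s in Ioo 0 t, f s * kernelTwoNegDeriv H t s := by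
  rw [fracOp, intervalIntegral.integral_of_le ht.le, intervalIntegral.integral_of_le ht.le,
    integral_Ioc_eq_integral_Ioo, integral_Ioc_eq_integral_Ioo, sub_eq_add_neg, ← integral_neg]
  congr 1 <;> refine setIntegral_congr_fun measurableSet_Ioo fun s hs => ?_
  · simp only [(hasDerivAt_kernelOne hs.1 hs.2).deriv]
  · simp only [(hasDerivAt_kernelTwo hH0 hH1 hs.1 hs.2).deriv]
    ring

lemma fracOpConverges_iff :
    FracOpConverges H f t ↔
      IntegrableOn (fun u => (f t - f (t * u)) * kernelOneDeriv H 1 u) (Ioo 0 1) ∧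
      IntegrableOn (fun u => f (t * u) * kernelTwoNegDeriv H 1 u) (Ioo 0 1) := by
  have hpow {F : ℝ → ℝ} : IntegrableOn (fun u => t ^ (H - 3 / 2) * F u) (Ioo 0 1) ↔
      IntegrableOn F (Ioo 0 1) :=
    integrable_const_mul_iff (Real.rpow_pos_of_pos ht _).ne'.isUnit F
  rw [FracOpConverges, intervalIntegrable_iff_integrableOn_Ioo_of_le ht.le,
    intervalIntegrable_iff_integrableOn_Ioo_of_le ht.le, ← integrableOn_Ioo_scale_iff ht,
    ← integrableOn_Ioo_scale_iff ht]
  refine and_congr (Iff.trans ?_ hpow) (Iff.trans ?_ hpow)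
  · refine integrableOn_congr_fun (fun u hu => ?_) measurableSet_Ioo
    simp only [(hasDerivAt_kernelOne (mul_pos ht hu.1) (mul_lt_of_lt_one_right ht hu.2)).deriv,
      kernelOneDeriv_scale ht hu]
    ring
  · rw [IntegrableOn, ← integrable_neg_iff]
    refine integrableOn_congr_fun (fun u hu => ?_) measurableSet_Ioo
    simp only [Pi.neg_apply, kernelTwoNegDeriv_scale ht hu, (hasDerivAt_kernelTwo hH0 hH1
      (mul_pos ht hu.1) (mul_lt_of_lt_one_right ht hu.2)).deriv]
    ring

lemma fracOp_eq_scaled :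
    fracOp H f t = t ^ (H - 1 / 2) *
      ((∫ u in Ioo 0 1, (f t - f (t * u)) * kernelOneDeriv H 1 u) +
        ∫ u in Ioo 0 1, f (t * u) * kernelTwoNegDeriv H 1 u) := by
  rw [fracOp_eq hH0 hH1 ht, setIntegral_Ioo_scale ht, setIntegral_Ioo_scale ht, ← mul_add,
    show H - 1 / 2 = 1 + (H - 3 / 2) by ring, Real.rpow_add ht, Real.rpow_one, mul_assoc]
  congr 1
  rw [mul_add, ← integral_const_mul, ← integral_const_mul]
  congr 1
  · refine setIntegral_congr_fun measurableSet_Ioo fun u hu => ?_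
    simp only [kernelOneDeriv_scale ht hu]
    ring
  · refine setIntegral_congr_fun measurableSet_Ioo fun u hu => ?_
    simp only [kernelTwoNegDeriv_scale ht hu]
    ring

end FracOp

/-- `f` is Hölder continuous on `[0, T]` with constant `M` and exponent `lam`. -/
def HolderBoundOn (M lam T : ℝ) (f : ℝ → ℝ) : Prop :=
  ∀ s ∈ Icc 0 T, ∀ r ∈ Icc 0 T, |f r - f s| ≤ M * |r - s| ^ lam

section Holder

variable {H lam T M : ℝ} {f : ℝ → ℝ}

lemma HolderBoundOn.of_lt (hlam : lam ≠ 0)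
    (hf : ∀ s r, 0 ≤ s → s < r → r ≤ T → |f r - f s| ≤ M * (r - s) ^ lam) :
    HolderBoundOn M lam T f := by
  intro s hs r hr
  rcases lt_trichotomy s r with hsr | rfl | hrs
  · rw [abs_of_pos (sub_pos.2 hsr)]
    exact hf s r hs.1 hsr hr.2
  · rw [sub_self, sub_self, abs_zero, Real.zero_rpow hlam, mul_zero]
  · rw [abs_sub_comm, abs_sub_comm r, abs_of_pos (sub_pos.2 hrs)]
    exact hf r s hr.1 hrs hs.2

lemma HolderBoundOn.continuousOn (hlam : 0 < lam) (hf : HolderBoundOn M lam T f) :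
    ContinuousOn f (Icc 0 T) := by
  intro s hs
  rw [ContinuousWithinAt, tendsto_iff_dist_tendsto_zero]
  refine squeeze_zero' (g := fun r => M * |r - s| ^ lam) (.of_forall fun r => dist_nonneg) ?_ ?_
  · filter_upwards [self_mem_nhdsWithin] with r hr using hf s hs r hr
  · have hbound : ContinuousAt (fun r => M * |r - s| ^ lam) s :=
      continuousAt_const.mul (ContinuousAt.rpow_const (by fun_prop) (.inr hlam.le))
    have hlim := hbound.tendsto
    rw [sub_self, abs_zero, Real.zero_rpow hlam.ne', mul_zero] at hlim
    exact hlim.mono_left nhdsWithin_le_nhds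

lemma HolderBoundOn.nonneg (hT : 0 < T) (hf : HolderBoundOn M lam T f) : 0 ≤ M := by
  have h := (abs_nonneg _).trans (hf 0 (left_mem_Icc.2 hT.le) T (right_mem_Icc.2 hT.le))
  rw [sub_zero, abs_of_pos hT] at h
  exact nonneg_of_mul_nonneg_left h (Real.rpow_pos_of_pos hT _)

lemma abs_sub_le_holderNorm_of_pos (hf : HolderBoundOn M lam T f) {s r : ℝ} (hs : 0 < s)
    (hsr : s < r) (hr : r ≤ T) : |f r - f s| ≤ holderNorm lam T f * (r - s) ^ lam := by
  have hbdd : BddAbove {x : ℝ | ∃ s r : ℝ, 0 < s ∧ s < r ∧ r ≤ T ∧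
      x = |f r - f s| / |r - s| ^ lam} := by
    refine ⟨M, ?_⟩
    rintro x ⟨s, r, hs, hsr, hr, rfl⟩
    have := abs_pos.2 (sub_pos.2 hsr).ne'
    rw [div_le_iff₀ (by positivity)]
    exact hf s ⟨hs.le, hsr.le.trans hr⟩ r ⟨(hs.trans hsr).le, hr⟩
  rw [← abs_of_pos (sub_pos.2 hsr), ← div_le_iff₀ (by have := sub_pos.2 hsr; positivity)]
  exact le_csSup hbdd ⟨s, r, hs, hsr, hr, rfl⟩

lemma MemHolderZero.holderBoundOn (hlam : 0 < lam) (hf : MemHolderZero lam T f) :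
    HolderBoundOn (holderNorm lam T f) lam T f := by
  obtain ⟨-, M, hM⟩ := hf
  replace hM : HolderBoundOn M lam T f := hM
  refine .of_lt hlam.ne' fun s r hs hsr hr => ?_
  -- The norm only sees positive times; increments from time zero are recovered as limits.
  refine ContinuousWithinAt.closure_le (s := Ioo s r) (f := fun x => |f r - f x|)
    (g := fun x => holderNorm lam T f * (r - x) ^ lam) ?_ ?_ ?_ fun x hx =>
      abs_sub_le_holderNorm_of_pos hM (hs.trans_lt hx.1) hx.2 hr
  · rw [closure_Ioo hsr.ne]
    exact left_mem_Icc.2 hsr.le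
  · have hcont := (hM.continuousOn hlam) s ⟨hs, hsr.le.trans hr⟩
    exact (continuousWithinAt_const.sub (hcont.mono fun x hx =>
      ⟨hs.trans hx.1.le, hx.2.le.trans hr⟩)).abs
  · exact (continuousAt_const.mul
      (ContinuousAt.rpow_const (by fun_prop) (.inr hlam.le))).continuousWithinAt

lemma norm_fracOp_integrand_one_le (hH1 : H ≤ 1 / 2) (hf : HolderBoundOn M lam T f)
    {t u : ℝ} (ht : t ∈ Ioc 0 T) (hu : u ∈ Ioo (0 : ℝ) 1) :
    ‖(f t - f (t * u)) * kernelOneDeriv H 1 u‖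
      ≤ M * t ^ lam * ((1 - u) ^ lam * kernelOneDeriv H 1 u) := by
  have htu : t * u ≤ t := (mul_lt_of_lt_one_right ht.1 hu.2).le
  have hu1 : 0 < 1 - u := sub_pos.2 hu.2
  have hinc := hf (t * u) ⟨(mul_pos ht.1 hu.1).le, htu.trans ht.2⟩ t ⟨ht.1.le, ht.2⟩
  rw [← mul_one_sub, abs_of_pos (mul_pos ht.1 hu1), Real.mul_rpow ht.1.le hu1.le,
    ← mul_assoc] at hinc
  have hk := kernelOneDeriv_nonneg hH1 hu.1 hu.2
  rw [norm_mul, Real.norm_of_nonneg hk, ← mul_assoc]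
  exact mul_le_mul_of_nonneg_right hinc hk

lemma norm_fracOp_integrand_two_le (hH1 : H ≤ 1 / 2) (hf0 : f 0 = 0)
    (hf : HolderBoundOn M lam T f) {t u : ℝ} (ht : t ∈ Ioc 0 T) (hu : u ∈ Ioo (0 : ℝ) 1) :
    ‖f (t * u) * kernelTwoNegDeriv H 1 u‖
      ≤ M * t ^ lam * (u ^ lam * kernelTwoNegDeriv H 1 u) := by
  have htu : t * u ≤ t := (mul_lt_of_lt_one_right ht.1 hu.2).le
  have hinc := hf 0 ⟨le_rfl, ht.1.le.trans ht.2⟩ (t * u)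
    ⟨(mul_pos ht.1 hu.1).le, htu.trans ht.2⟩
  rw [hf0, sub_zero, sub_zero, abs_of_pos (mul_pos ht.1 hu.1),
    Real.mul_rpow ht.1.le hu.1.le, ← mul_assoc] at hinc
  have hk := kernelTwoNegDeriv_nonneg hH1 hu.1 hu.2
  rw [norm_mul, Real.norm_of_nonneg hk, ← mul_assoc]
  exact mul_le_mul_of_nonneg_right hinc hk

/-- A bound for the norm of `Λ_H` from `lam`-Hölder functions on `[0, 1]` to bounded functions. -/
def fracOpBound (H lam : ℝ) : ℝ :=
  (∫ u in Ioo 0 1, (1 - u) ^ lam * kernelOneDeriv H 1 u) +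
    ∫ u in Ioo 0 1, u ^ lam * kernelTwoNegDeriv H 1 u

lemma fracOpBound_nonneg (hH1 : H ≤ 1 / 2) (lam : ℝ) : 0 ≤ fracOpBound H lam := by
  refine add_nonneg (setIntegral_nonneg measurableSet_Ioo fun u hu => ?_)
    (setIntegral_nonneg measurableSet_Ioo fun u hu => ?_)
  · exact mul_nonneg (Real.rpow_nonneg (sub_pos.2 hu.2).le _)
      (kernelOneDeriv_nonneg hH1 hu.1 hu.2)
  · exact mul_nonneg (Real.rpow_nonneg hu.1.le _) (kernelTwoNegDeriv_nonneg hH1 hu.1 hu.2)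

variable (hH0 : 0 < H) (hH1 : H < 1 / 2) (hlam : 1 / 2 - H < lam) (hf : HolderBoundOn M lam T f)
include hH1 hlam hf

lemma aestronglyMeasurable_comp_mul {t : ℝ} (ht : t ∈ Icc 0 T) :
    AEStronglyMeasurable (fun u => f (t * u)) (volume.restrict (Ioo 0 1)) := by
  refine ContinuousOn.aestronglyMeasurable ((hf.continuousOn (by linarith)).comp (by fun_prop)
    fun u hu => ⟨mul_nonneg ht.1 hu.1.le, ?_⟩) measurableSet_Ioo
  exact (mul_le_of_le_one_right ht.1 hu.2.le).trans ht.2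

include hH0

lemma continuousOn_integral_kernelOneDeriv :
    ContinuousOn (fun t => ∫ u in Ioo 0 1, (f t - f (t * u)) * kernelOneDeriv H 1 u)
      (Ioc 0 T) := by
  have hcont := hf.continuousOn (by linarith)
  intro t₀ ht₀
  refine continuousWithinAt_of_dominated
    (bound := fun u => M * T ^ lam * ((1 - u) ^ lam * kernelOneDeriv H 1 u)) ?_ ?_
    ((integrableOn_kernelOneDeriv_unit hH0 hH1 hlam).const_mul _) ?_
  · filter_upwards [self_mem_nhdsWithin] with t ht
    exact (aestronglyMeasurable_const.sub (aestronglyMeasurable_comp_mul hH1 hlam hf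
      (Ioc_subset_Icc_self ht))).mul (measurable_kernelOneDeriv H 1).aestronglyMeasurable
  · filter_upwards [self_mem_nhdsWithin] with t ht
    filter_upwards [ae_restrict_mem measurableSet_Ioo] with u hu
    refine (norm_fracOp_integrand_one_le hH1.le hf ht hu).trans ?_
    have hM := hf.nonneg (ht₀.1.trans_le ht₀.2)
    have hlam' : 0 ≤ lam := by linarith
    have hk := kernelOneDeriv_nonneg hH1.le hu.1 hu.2
    have := sub_pos.2 hu.2
    have := ht.1.le
    gcongr
    exact ht.2
  · filter_upwards [ae_restrict_mem measurableSet_Ioo] with u hu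
    have hmaps : MapsTo (· * u) (Ioc 0 T) (Icc 0 T) := fun t ht =>
      ⟨mul_nonneg ht.1.le hu.1.le, (mul_le_of_le_one_right ht.1.le hu.2.le).trans ht.2⟩
    exact (((hcont.mono Ioc_subset_Icc_self).sub (hcont.comp (by fun_prop) hmaps)).mul
      continuousOn_const) t₀ ht₀

variable (hf0 : f 0 = 0)
include hf0

lemma fracOpConverges_of_holderBoundOn {t : ℝ} (ht : t ∈ Icc 0 T) : FracOpConverges H f t := by
  rcases ht.1.eq_or_lt with rfl | ht0
  · exact ⟨.refl, .refl⟩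
  have hmeas := aestronglyMeasurable_comp_mul hH1 hlam hf ht
  rw [fracOpConverges_iff hH0 hH1 ht0]
  constructor
  · refine ((integrableOn_kernelOneDeriv_unit hH0 hH1 hlam).const_mul (M * t ^ lam)).mono'
      ((aestronglyMeasurable_const.sub hmeas).mul
        (measurable_kernelOneDeriv H 1).aestronglyMeasurable) ?_
    filter_upwards [ae_restrict_mem measurableSet_Ioo] with u hu
    exact norm_fracOp_integrand_one_le hH1.le hf ⟨ht0, ht.2⟩ hu
  · refine ((integrableOn_kernelTwoNegDeriv_unit hH0 hH1 hlam).const_mul (M * t ^ lam)).mono'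
      (hmeas.mul (measurable_kernelTwoNegDeriv hH0 hH1 1).aestronglyMeasurable) ?_
    filter_upwards [ae_restrict_mem measurableSet_Ioo] with u hu
    exact norm_fracOp_integrand_two_le hH1.le hf0 hf ⟨ht0, ht.2⟩ hu

lemma abs_fracOp_le {t : ℝ} (ht : t ∈ Icc 0 T) :
    |fracOp H f t| ≤ fracOpBound H lam * t ^ (H - 1 / 2 + lam) * M := by
  rcases ht.1.eq_or_lt with rfl | ht0
  · rw [fracOp_zero, Real.zero_rpow (by linarith), mul_zero, zero_mul, abs_zero]
  have hone : ‖∫ u in Ioo 0 1, (f t - f (t * u)) * kernelOneDeriv H 1 u‖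
      ≤ M * t ^ lam * ∫ u in Ioo 0 1, (1 - u) ^ lam * kernelOneDeriv H 1 u := by
    rw [← integral_const_mul]
    refine norm_integral_le_of_norm_le
      ((integrableOn_kernelOneDeriv_unit hH0 hH1 hlam).const_mul _) ?_
    filter_upwards [ae_restrict_mem measurableSet_Ioo] with u hu
    exact norm_fracOp_integrand_one_le hH1.le hf ⟨ht0, ht.2⟩ hu
  have htwo : ‖∫ u in Ioo 0 1, f (t * u) * kernelTwoNegDeriv H 1 u‖
      ≤ M * t ^ lam * ∫ u in Ioo 0 1, u ^ lam * kernelTwoNegDeriv H 1 u := by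
    rw [← integral_const_mul]
    refine norm_integral_le_of_norm_le
      ((integrableOn_kernelTwoNegDeriv_unit hH0 hH1 hlam).const_mul _) ?_
    filter_upwards [ae_restrict_mem measurableSet_Ioo] with u hu
    exact norm_fracOp_integrand_two_le hH1.le hf0 hf ⟨ht0, ht.2⟩ hu
  rw [fracOp_eq_scaled hH0 hH1 ht0, abs_mul, abs_of_nonneg (Real.rpow_nonneg ht0.le _)]
  calc _ ≤ t ^ (H - 1 / 2) * (_ + _) := by
        gcongr
        exact (norm_add_le _ _).trans (add_le_add hone htwo)
    _ = _ := by
        rw [Real.rpow_add ht0, fracOpBound]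
        ring

lemma continuousOn_integral_kernelTwoNegDeriv :
    ContinuousOn (fun t => ∫ u in Ioo 0 1, f (t * u) * kernelTwoNegDeriv H 1 u) (Ioc 0 T) := by
  intro t₀ ht₀
  refine continuousWithinAt_of_dominated
    (bound := fun u => M * T ^ lam * (u ^ lam * kernelTwoNegDeriv H 1 u)) ?_ ?_
    ((integrableOn_kernelTwoNegDeriv_unit hH0 hH1 hlam).const_mul _) ?_
  · filter_upwards [self_mem_nhdsWithin] with t ht
    exact (aestronglyMeasurable_comp_mul hH1 hlam hf (Ioc_subset_Icc_self ht)).mul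
      (measurable_kernelTwoNegDeriv hH0 hH1 1).aestronglyMeasurable
  · filter_upwards [self_mem_nhdsWithin] with t ht
    filter_upwards [ae_restrict_mem measurableSet_Ioo] with u hu
    refine (norm_fracOp_integrand_two_le hH1.le hf0 hf ht hu).trans ?_
    have hM := hf.nonneg (ht₀.1.trans_le ht₀.2)
    have hlam' : 0 ≤ lam := by linarith
    have hk := kernelTwoNegDeriv_nonneg hH1.le hu.1 hu.2
    have := hu.1
    have := ht.1.le
    gcongr
    exact ht.2
  · filter_upwards [ae_restrict_mem measurableSet_Ioo] with u hu
    have hmaps : MapsTo (· * u) (Ioc 0 T) (Icc 0 T) := fun t ht =>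
      ⟨mul_nonneg ht.1.le hu.1.le, (mul_le_of_le_one_right ht.1.le hu.2.le).trans ht.2⟩
    exact (((hf.continuousOn (by linarith)).comp (by fun_prop) hmaps).mul
      continuousOn_const) t₀ ht₀

lemma continuousOn_fracOp : ContinuousOn (fracOp H f) (Icc 0 T) := by
  have hpos : ContinuousOn (fracOp H f) (Ioc 0 T) := by
    refine ContinuousOn.congr ?_ fun t ht => fracOp_eq_scaled hH0 hH1 ht.1 f
    exact (continuousOn_id.rpow_const fun t ht => .inl ht.1.ne').mul
      ((continuousOn_integral_kernelOneDeriv hH0 hH1 hlam hf).add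
        (continuousOn_integral_kernelTwoNegDeriv hH0 hH1 hlam hf hf0))
  intro t ht
  rcases ht.1.eq_or_lt with rfl | ht0
  · rw [ContinuousWithinAt, fracOp_zero]
    refine squeeze_zero_norm' (a := fun t => fracOpBound H lam * t ^ (H - 1 / 2 + lam) * M) ?_ ?_
    · filter_upwards [self_mem_nhdsWithin] with t ht
      exact abs_fracOp_le hH0 hH1 hlam hf hf0 ht
    · have hbound : ContinuousAt (fun t : ℝ => fracOpBound H lam * t ^ (H - 1 / 2 + lam) * M) 0 :=
        (continuousAt_const.mul (Real.continuousAt_rpow_const _ _ (.inr (by linarith)))).mul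
          continuousAt_const
      have hlim := hbound.tendsto
      rw [Real.zero_rpow (by linarith), mul_zero, zero_mul] at hlim
      exact hlim.mono_left nhdsWithin_le_nhds
  · refine (hpos t ⟨ht0, ht.2⟩).mono_of_mem_nhdsWithin ?_
    filter_upwards [self_mem_nhdsWithin, mem_nhdsWithin_of_mem_nhds (Ioi_mem_nhds ht0)]
      with r hr hr0 using ⟨hr0, hr.2⟩

end Holder

theorem fracOp_bounded_linear {H lam : ℝ} (hH0 : 0 < H) (hH1 : H < 1 / 2)
    (hlam : 1 / 2 - H < lam) :
    ∃ C : ℝ, ∀ T : ℝ, 0 < T → ∀ f : ℝ → ℝ, MemHolderZero lam T f →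
      (∀ t ∈ Icc 0 T, FracOpConverges H f t) ∧
      ContinuousOn (fracOp H f) (Icc 0 T) ∧
      (∀ t ∈ Icc 0 T, |fracOp H f t| ≤ C * T ^ (H - 1 / 2 + lam) * holderNorm lam T f) ∧
      (∀ g : ℝ → ℝ, MemHolderZero lam T g → ∀ a b : ℝ, ∀ t ∈ Icc 0 T,
        fracOp H (fun s => a * f s + b * g s) t = a * fracOp H f t + b * fracOp H g t) := by
  have hlam0 : 0 < lam := by linarith
  refine ⟨fracOpBound H lam, fun T hT f hf => ?_⟩
  have hholder := hf.holderBoundOn hlam0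
  have hconv {g : ℝ → ℝ} (hg : MemHolderZero lam T g) {t : ℝ} (ht : t ∈ Icc 0 T) :
      FracOpConverges H g t :=
    fracOpConverges_of_holderBoundOn hH0 hH1 hlam (hg.holderBoundOn hlam0) hg.1 ht
  refine ⟨fun t ht => hconv hf ht, continuousOn_fracOp hH0 hH1 hlam hholder hf.1,
    fun t ht => (abs_fracOp_le hH0 hH1 hlam hholder hf.1 ht).trans ?_,
    fun g hg a b t ht => fracOp_add_smul (hconv hf ht) (hconv hg ht) a b⟩
  have := hholder.nonneg hT
  have := fracOpBound_nonneg hH1.le lam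
  have := ht.1
  have : 0 ≤ H - 1 / 2 + lam := by linarith
  gcongr
  exact ht.2

/-! ### Hölder modifications of processes -/

lemma HolderBoundOn.continuous_comp_projIcc {M lam T : ℝ} {f : ℝ → ℝ} (hlam : 0 < lam)
    (hT : 0 ≤ T) (hf : HolderBoundOn M lam T f) :
    Continuous fun t => f (projIcc 0 T hT t) :=
  (continuousOn_iff_continuous_domRestrict.1 (hf.continuousOn hlam)).Icc_extend'

lemma HolderBoundOn.mono_exponent {M γ γ' T : ℝ} {f : ℝ → ℝ} (hT : 0 < T) (hγ' : 0 < γ')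
    (hγ : γ' ≤ γ) (hf : HolderBoundOn M γ T f) : HolderBoundOn (M * T ^ (γ - γ')) γ' T f := by
  intro s hs r hr
  have hle : |r - s| ≤ T := abs_sub_le_of_nonneg_of_le hr.1 hr.2 hs.1 hs.2
  have hpow : |r - s| ^ γ ≤ T ^ (γ - γ') * |r - s| ^ γ' := by
    rw [show γ = γ - γ' + γ' by ring,
      Real.rpow_add_of_nonneg (abs_nonneg _) (sub_nonneg.2 hγ) hγ'.le, add_sub_cancel_right]
    exact mul_le_mul_of_nonneg_right (Real.rpow_le_rpow (abs_nonneg _) hle (sub_nonneg.2 hγ))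
      (by positivity)
  rw [mul_assoc]
  exact (hf s hs r hr).trans (mul_le_mul_of_nonneg_left hpow (hf.nonneg hT))

lemma HolderBoundOn.comp_div {M lam T : ℝ} {f : ℝ → ℝ} (hT : 0 < T)
    (hf : HolderBoundOn M lam 1 f) :
    HolderBoundOn (M * (T ^ lam)⁻¹) lam T (fun t => f (t / T)) := by
  have hmem {t : ℝ} (ht : t ∈ Icc 0 T) : t / T ∈ Icc (0 : ℝ) 1 :=
    ⟨div_nonneg ht.1 hT.le, (div_le_one hT).2 ht.2⟩
  intro s hs r hr
  refine (hf _ (hmem hs) _ (hmem hr)).trans_eq ?_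
  rw [← sub_div, abs_div, abs_of_pos hT, Real.div_rpow (abs_nonneg _) hT.le]
  ring

/-- The largest multiple of `2⁻ⁿ` below `t`, for `t ≥ 0`. -/
def dyadicFloor (n : ℕ) (t : ℝ) : ℝ := (⌊2 ^ n * t⌋₊ : ℝ) / 2 ^ n

lemma dyadicFloor_le {t : ℝ} (ht : 0 ≤ t) (n : ℕ) : dyadicFloor n t ≤ t := by
  rw [dyadicFloor, div_le_iff₀ (by positivity), mul_comm]
  exact Nat.floor_le (by positivity)

lemma lt_dyadicFloor_add (t : ℝ) (n : ℕ) : t < dyadicFloor n t + 1 / 2 ^ n := by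
  rw [dyadicFloor, ← add_div, lt_div_iff₀ (by positivity), mul_comm]
  exact Nat.lt_floor_add_one _

lemma floor_two_pow_mul_le {t : ℝ} (ht : t ≤ 1) (n : ℕ) : ⌊2 ^ n * t⌋₊ ≤ 2 ^ n := by
  refine Nat.floor_le_of_le ?_
  push_cast
  exact mul_le_of_le_one_right (by positivity) ht

section DyadicIncrements

variable {y : ℝ → ℝ} {C ρ : ℝ}

lemma abs_sub_le_of_le_succ {n : ℕ} (hC0 : 0 ≤ C)
    (hC : ∀ k : ℕ, k < 2 ^ n → |y ((k + 1) / 2 ^ n) - y (k / 2 ^ n)| ≤ C)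
    {j k : ℕ} (hjk : j ≤ k) (hkj : k ≤ j + 1) (hk : k ≤ 2 ^ n) :
    |y (k / 2 ^ n) - y (j / 2 ^ n)| ≤ C := by
  rcases hjk.eq_or_lt with rfl | hlt
  · simpa using hC0
  · obtain rfl : k = j + 1 := by omega
    exact_mod_cast hC j hk

lemma abs_dyadicFloor_succ_sub_le (hC0 : 0 ≤ C) (hρ0 : 0 ≤ ρ)
    (hC : ∀ n k : ℕ, k < 2 ^ n → |y ((k + 1) / 2 ^ n) - y (k / 2 ^ n)| ≤ C * ρ ^ n)
    {t : ℝ} (ht : t ∈ Icc (0 : ℝ) 1) (n : ℕ) :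
    |y (dyadicFloor (n + 1) t) - y (dyadicFloor n t)| ≤ C * ρ ^ (n + 1) := by
  have hrefine : dyadicFloor n t = ((2 * ⌊2 ^ n * t⌋₊ : ℕ) : ℝ) / 2 ^ (n + 1) := by
    rw [dyadicFloor, pow_succ]
    push_cast
    field_simp
  have hpos : (0 : ℝ) ≤ 2 ^ n * t := mul_nonneg (by positivity) ht.1
  have hlower : 2 * ⌊2 ^ n * t⌋₊ ≤ ⌊2 ^ (n + 1) * t⌋₊ := by
    refine Nat.le_floor ?_
    rw [pow_succ', mul_assoc]
    push_cast
    linarith [Nat.floor_le hpos]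
  have hupper : ⌊2 ^ (n + 1) * t⌋₊ ≤ 2 * ⌊2 ^ n * t⌋₊ + 1 := by
    rw [← Nat.lt_add_one_iff, pow_succ', mul_assoc, Nat.floor_lt (by positivity)]
    push_cast
    linarith [Nat.lt_floor_add_one (2 ^ n * t)]
  rw [hrefine, dyadicFloor]
  exact abs_sub_le_of_le_succ (by positivity) (hC (n + 1)) hlower hupper
    (floor_two_pow_mul_le ht.2 _)

lemma abs_dyadicFloor_sub_le {n : ℕ} (hC0 : 0 ≤ C)
    (hC : ∀ k : ℕ, k < 2 ^ n → |y ((k + 1) / 2 ^ n) - y (k / 2 ^ n)| ≤ C)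
    {s r : ℝ} (hs : 0 ≤ s) (hr : r ≤ 1) (hsr : s ≤ r) (h : r - s ≤ 1 / 2 ^ n) :
    |y (dyadicFloor n r) - y (dyadicFloor n s)| ≤ C := by
  refine abs_sub_le_of_le_succ hC0 hC (Nat.floor_le_floor (by gcongr)) ?_
    (floor_two_pow_mul_le hr _)
  rw [← Nat.floor_add_one (by positivity)]
  refine Nat.floor_le_floor ?_
  rw [le_div_iff₀ (by positivity)] at h
  linarith

lemma two_rpow_neg_pow_le {γ d : ℝ} (hγ : 0 ≤ γ) {n : ℕ} (h : 1 / 2 ^ (n + 1) ≤ d) :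
    ((2 : ℝ) ^ (-γ)) ^ n ≤ 2 ^ γ * d ^ γ := by
  have hd : 1 / 2 ^ n ≤ 2 * d := by
    rw [pow_succ, ← div_div] at h
    linarith
  calc ((2 : ℝ) ^ (-γ)) ^ n = (1 / 2 ^ n) ^ γ := by
        rw [Real.rpow_neg two_pos.le, inv_pow, one_div, Real.inv_rpow (by positivity),
          ← Real.rpow_natCast, ← Real.rpow_natCast, ← Real.rpow_mul two_pos.le,
          ← Real.rpow_mul two_pos.le, mul_comm]
    _ ≤ (2 * d) ^ γ := Real.rpow_le_rpow (by positivity) hd hγ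
    _ = 2 ^ γ * d ^ γ := Real.mul_rpow two_pos.le (le_trans (by positivity) h)

lemma holderBoundOn_of_abs_dyadicFloor_sub_le {b : ℝ → ℝ} {γ D : ℝ} (hγ : 0 < γ) (hC0 : 0 ≤ C)
    (hC : ∀ n k : ℕ, k < 2 ^ n →
      |y ((k + 1) / 2 ^ n) - y (k / 2 ^ n)| ≤ C * ((2 : ℝ) ^ (-γ)) ^ n)
    (hD0 : 0 ≤ D)
    (hD : ∀ t ∈ Icc (0 : ℝ) 1, ∀ n, |y (dyadicFloor n t) - b t| ≤ D * ((2 : ℝ) ^ (-γ)) ^ n) :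
    HolderBoundOn ((2 * D + C) * 2 ^ γ) γ 1 b := by
  refine HolderBoundOn.of_lt hγ.ne' fun s r hs hsr hr => ?_
  obtain ⟨n, hn, hn'⟩ := exists_nat_pow_near_of_lt_one (sub_pos.2 hsr) (by linarith)
    (show (0 : ℝ) < 1 / 2 by norm_num) (by norm_num)
  rw [one_div_pow] at hn hn'
  calc |b r - b s| = |(y (dyadicFloor n s) - b s) - (y (dyadicFloor n r) - b r) +
          (y (dyadicFloor n r) - y (dyadicFloor n s))| := by
        congr 1
        ring
    _ ≤ |y (dyadicFloor n s) - b s| + |y (dyadicFloor n r) - b r| +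
          |y (dyadicFloor n r) - y (dyadicFloor n s)| :=
        (abs_add_le _ _).trans (by gcongr; exact abs_sub _ _)
    _ ≤ D * ((2 : ℝ) ^ (-γ)) ^ n + D * ((2 : ℝ) ^ (-γ)) ^ n + C * ((2 : ℝ) ^ (-γ)) ^ n := by
        gcongr
        · exact hD s ⟨hs, hsr.le.trans hr⟩ n
        · exact hD r ⟨hs.trans hsr.le, hr⟩ n
        · exact abs_dyadicFloor_sub_le (by positivity) (hC n) hs hr hsr.le hn'
    _ = (2 * D + C) * ((2 : ℝ) ^ (-γ)) ^ n := by ring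
    _ ≤ (2 * D + C) * (2 ^ γ * (r - s) ^ γ) := by
        gcongr
        exact two_rpow_neg_pow_le hγ.le hn.le
    _ = (2 * D + C) * 2 ^ γ * (r - s) ^ γ := by ring

lemma exists_holder_limit_of_dyadic {γ : ℝ} (hγ : 0 < γ) (hC0 : 0 ≤ C)
    (hC : ∀ n k : ℕ, k < 2 ^ n →
      |y ((k + 1) / 2 ^ n) - y (k / 2 ^ n)| ≤ C * ((2 : ℝ) ^ (-γ)) ^ n) :
    ∃ b : ℝ → ℝ, (∀ t ∈ Icc (0 : ℝ) 1,
      Tendsto (fun n => y (dyadicFloor n t)) atTop (𝓝 (b t))) ∧ ∃ M, HolderBoundOn M γ 1 b := by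
  set ρ : ℝ := (2 : ℝ) ^ (-γ)
  have hρ0 : 0 < ρ := by positivity
  have hρ1 : ρ < 1 := Real.rpow_lt_one_of_one_lt_of_neg (by norm_num) (by linarith)
  have hdist : ∀ t ∈ Icc (0 : ℝ) 1, ∀ n,
      dist (y (dyadicFloor n t)) (y (dyadicFloor (n + 1) t)) ≤ C * ρ * ρ ^ n := by
    intro t ht n
    rw [dist_comm, Real.dist_eq, mul_assoc, ← pow_succ']
    exact abs_dyadicFloor_succ_sub_le hC0 hρ0.le hC ht n
  have hlim : ∀ t ∈ Icc (0 : ℝ) 1, ∃ l, Tendsto (fun n => y (dyadicFloor n t)) atTop (𝓝 l) :=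
    fun t ht => cauchySeq_tendsto_of_complete (cauchySeq_of_le_geometric ρ (C * ρ) hρ1 (hdist t ht))
  choose! b hb using hlim
  refine ⟨b, hb, _, holderBoundOn_of_abs_dyadicFloor_sub_le (D := C * ρ / (1 - ρ)) hγ hC0 hC
    (div_nonneg (by positivity) (by linarith)) fun t ht n => ?_⟩
  rw [← Real.dist_eq, div_mul_eq_mul_div]
  exact dist_le_of_le_geometric_of_tendsto ρ (C * ρ) hρ1 (hdist t ht) (hb t ht) n

end DyadicIncrements

/-- The sum over all dyadic increments of level `n` in `[0, 1]` of their `2(m + 2)`-th powers,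
weighted by `2 ^ (n * m)`. If it is finite, the increments of level `n` are `O(2 ^ (-nγ))` with
`γ = m / (2(m + 2))`, and these exponents increase to `1 / 2`. -/
def dyadicSum {Ω : Type*} (Y : ℝ → Ω → ℝ) (m : ℕ) (ω : Ω) : ℝ≥0∞ :=
  ∑' n : ℕ, ∑ k ∈ Finset.range (2 ^ n),
    (2 ^ n : ℝ≥0∞) ^ m * ‖Y ((k + 1) / 2 ^ n) ω - Y (k / 2 ^ n) ω‖ₑ ^ (2 * (m + 2))

section Modification

variable {Ω : Type*} {Y : ℝ → Ω → ℝ} {m : ℕ}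

lemma exists_dyadic_bound_of_dyadicSum_ne_top {ω : Ω} (h : dyadicSum Y m ω ≠ ∞) :
    ∃ C, 0 ≤ C ∧ ∀ n k : ℕ, k < 2 ^ n → |Y ((k + 1) / 2 ^ n) ω - Y (k / 2 ^ n) ω|
      ≤ C * ((2 : ℝ) ^ (-((m : ℝ) / (2 * (m + 2))))) ^ n := by
  set S := (dyadicSum Y m ω).toReal
  have hS0 : 0 ≤ S := ENNReal.toReal_nonneg
  set p : ℕ := 2 * (m + 2) with hp
  have hp0 : p ≠ 0 := by omega
  refine ⟨S ^ (1 / (p : ℝ)), by positivity, fun n k hk => ?_⟩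
  set x := |Y ((k + 1) / 2 ^ n) ω - Y (k / 2 ^ n) ω|
  have hterm : (2 ^ n : ℝ≥0∞) ^ m * ‖Y ((k + 1) / 2 ^ n) ω - Y (k / 2 ^ n) ω‖ₑ ^ p
      ≤ dyadicSum Y m ω :=
    (Finset.single_le_sum (f := fun k : ℕ => (2 ^ n : ℝ≥0∞) ^ m *
      ‖Y ((k + 1) / 2 ^ n) ω - Y (k / 2 ^ n) ω‖ₑ ^ p) (fun _ _ => by positivity)
      (Finset.mem_range.2 hk)).trans (ENNReal.le_tsum n)
  have hxS : ((2 : ℝ) ^ n) ^ m * x ^ p ≤ S := by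
    simpa [ENNReal.toReal_mul, ENNReal.toReal_pow, x] using ENNReal.toReal_mono h hterm
  have hroot : (S ^ (1 / (p : ℝ))) ^ p = S := by
    rw [one_div, Real.rpow_inv_natCast_pow hS0 hp0]
  have hrate : (((2 : ℝ) ^ (-((m : ℝ) / (2 * (m + 2))))) ^ n) ^ p = (((2 : ℝ) ^ n) ^ m)⁻¹ := by
    rw [← pow_mul, ← pow_mul, ← Real.rpow_natCast, ← Real.rpow_mul two_pos.le,
      ← Real.rpow_natCast, ← Real.rpow_neg two_pos.le]
    congr 1
    rw [hp]
    push_cast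
    field_simp
  refine le_of_pow_le_pow_left₀ hp0 (by positivity) ?_
  rw [mul_pow, hroot, hrate, ← div_eq_mul_inv, le_div_iff₀ (by positivity), mul_comm]
  exact hxS

lemma exists_lt_half_of_lt_half {γ : ℝ} (hγ : γ < 1 / 2) :
    ∃ m : ℕ, 0 < m ∧ γ ≤ (m : ℝ) / (2 * (m + 2)) := by
  obtain ⟨m, hm⟩ := exists_nat_gt (4 * γ / (1 - 2 * γ))
  rw [div_lt_iff₀ (by linarith)] at hm
  refine ⟨m + 1, m.succ_pos, ?_⟩
  rw [le_div_iff₀ (by positivity)]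
  push_cast
  linarith

lemma exists_holder_limit_of_dyadicSum {ω : Ω} (hω : ∀ m, dyadicSum Y m ω ≠ ∞) :
    ∃ b : ℝ → ℝ, (∀ t ∈ Icc (0 : ℝ) 1,
      Tendsto (fun n => Y (dyadicFloor n t) ω) atTop (𝓝 (b t))) ∧
      ∀ γ, 0 < γ → γ < 1 / 2 → ∃ M, HolderBoundOn M γ 1 b := by
  have hlevel (m : ℕ) (hm : 0 < m) : ∃ b : ℝ → ℝ, (∀ t ∈ Icc (0 : ℝ) 1,
      Tendsto (fun n => Y (dyadicFloor n t) ω) atTop (𝓝 (b t))) ∧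
      ∃ M, HolderBoundOn M ((m : ℝ) / (2 * (m + 2))) 1 b := by
    obtain ⟨C, hC0, hC⟩ := exists_dyadic_bound_of_dyadicSum_ne_top (hω m)
    exact exists_holder_limit_of_dyadic (y := fun t => Y t ω) (by positivity) hC0 hC
  obtain ⟨b, hb, -⟩ := hlevel 1 one_pos
  refine ⟨b, hb, fun γ hγ0 hγ => ?_⟩
  obtain ⟨m, hm, hγm⟩ := exists_lt_half_of_lt_half hγ
  obtain ⟨b', hb', M, hM⟩ := hlevel m hm
  have heq : EqOn b b' (Icc 0 1) := fun t ht => tendsto_nhds_unique (hb t ht) (hb' t ht)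
  refine ⟨_, HolderBoundOn.mono_exponent one_pos hγ0 hγm (M := M) fun s hs r hr => ?_⟩
  rw [heq hs, heq hr]
  exact hM s hs r hr

variable [MeasurableSpace Ω] {P : Measure Ω}

lemma measurable_dyadicSum_term (hY : ∀ t, Measurable (Y t)) (m n k : ℕ) :
    Measurable fun ω => (2 ^ n : ℝ≥0∞) ^ m *
      ‖Y ((k + 1) / 2 ^ n) ω - Y (k / 2 ^ n) ω‖ₑ ^ (2 * (m + 2)) :=
  (((hY _).sub (hY _)).enorm.pow_const _).const_mul _

lemma measurable_dyadicSum (hY : ∀ t, Measurable (Y t)) (m : ℕ) : Measurable (dyadicSum Y m) :=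
  Measurable.tsum fun n => Finset.measurable_fun_sum _ fun k _ =>
    measurable_dyadicSum_term hY m n k

lemma ofReal_inv_two_pow (n : ℕ) : ENNReal.ofReal (1 / 2 ^ n) = 2⁻¹ ^ n := by
  rw [one_div, ENNReal.ofReal_inv_of_pos (by positivity), ENNReal.ofReal_pow two_pos.le,
    ENNReal.ofReal_ofNat, ENNReal.inv_pow]

lemma lintegral_sum_dyadic_le (hY : ∀ t, Measurable (Y t)) {c : ℝ≥0∞}
    (h : ∀ s t, ∫⁻ ω, ‖Y t ω - Y s ω‖ₑ ^ (2 * (m + 2)) ∂P ≤ c * ENNReal.ofReal |t - s| ^ (m + 2))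
    (n : ℕ) :
    ∫⁻ ω, ∑ k ∈ Finset.range (2 ^ n), (2 ^ n : ℝ≥0∞) ^ m *
      ‖Y ((k + 1) / 2 ^ n) ω - Y (k / 2 ^ n) ω‖ₑ ^ (2 * (m + 2)) ∂P ≤ c * 2⁻¹ ^ n := by
  have hgap (k : ℕ) : ENNReal.ofReal |((k : ℝ) + 1) / 2 ^ n - k / 2 ^ n| = 2⁻¹ ^ n := by
    rw [← sub_div, add_sub_cancel_left, abs_of_pos (by positivity), ofReal_inv_two_pow]
  have hcancel : (2 ^ n : ℝ≥0∞) * 2⁻¹ ^ n = 1 := by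
    rw [← mul_pow, ENNReal.mul_inv_cancel (by simp) (by simp), one_pow]
  rw [lintegral_finsetSum _ fun k _ => measurable_dyadicSum_term hY m n k]
  calc ∑ k ∈ Finset.range (2 ^ n), ∫⁻ ω, (2 ^ n : ℝ≥0∞) ^ m *
        ‖Y ((k + 1) / 2 ^ n) ω - Y (k / 2 ^ n) ω‖ₑ ^ (2 * (m + 2)) ∂P
      ≤ ∑ k ∈ Finset.range (2 ^ n), (2 ^ n : ℝ≥0∞) ^ m * (c * (2⁻¹ ^ n) ^ (m + 2)) := by
        refine Finset.sum_le_sum fun k _ => ?_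
        rw [lintegral_const_mul' _ _ (by finiteness), ← hgap k]
        gcongr
        exact h _ _
    _ = c * ((2 ^ n : ℝ≥0∞) * 2⁻¹ ^ n) ^ (m + 1) * 2⁻¹ ^ n := by
        rw [Finset.sum_const, Finset.card_range, nsmul_eq_mul]
        push_cast
        ring
    _ = c * 2⁻¹ ^ n := by rw [hcancel, one_pow, mul_one]

lemma lintegral_dyadicSum_ne_top (hY : ∀ t, Measurable (Y t)) {c : ℝ≥0∞} (hc : c ≠ ∞)
    (h : ∀ s t, ∫⁻ ω, ‖Y t ω - Y s ω‖ₑ ^ (2 * (m + 2)) ∂P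
      ≤ c * ENNReal.ofReal |t - s| ^ (m + 2)) :
    ∫⁻ ω, dyadicSum Y m ω ∂P ≠ ∞ := by
  simp only [dyadicSum]
  rw [lintegral_tsum fun n => (Finset.measurable_fun_sum _ fun k _ =>
    measurable_dyadicSum_term hY m n k).aemeasurable]
  refine ne_top_of_le_ne_top ?_ (ENNReal.tsum_le_tsum fun n => lintegral_sum_dyadic_le hY h n)
  rw [ENNReal.tsum_mul_left, ENNReal.tsum_geometric]
  exact ENNReal.mul_ne_top hc (by simp)

lemma ae_dyadicSum_ne_top (hY : ∀ t, Measurable (Y t))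
    (h : ∀ m : ℕ, ∃ c : ℝ≥0∞, c ≠ ∞ ∧ ∀ s t,
      ∫⁻ ω, ‖Y t ω - Y s ω‖ₑ ^ (2 * m) ∂P ≤ c * ENNReal.ofReal |t - s| ^ m) :
    ∀ᵐ ω ∂P, ∀ m, dyadicSum Y m ω ≠ ∞ := by
  refine ae_all_iff.2 fun m => ?_
  obtain ⟨c, hc, hm⟩ := h (m + 2)
  filter_upwards [ae_lt_top (measurable_dyadicSum hY m) (lintegral_dyadicSum_ne_top hY hc hm)]
    with ω hω using hω.ne

lemma ae_tendsto_dyadicFloor (hY : ∀ t, Measurable (Y t)) {c : ℝ≥0∞} (hc : c ≠ ∞)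
    (h : ∀ s t, ∫⁻ ω, ‖Y t ω - Y s ω‖ₑ ^ 2 ∂P ≤ c * ENNReal.ofReal |t - s|)
    {t : ℝ} (ht : 0 ≤ t) :
    ∀ᵐ ω ∂P, Tendsto (fun n => Y (dyadicFloor n t) ω) atTop (𝓝 (Y t ω)) := by
  have hmeas : ∀ n, Measurable fun ω => ‖Y (dyadicFloor n t) ω - Y t ω‖ₑ ^ 2 := fun n =>
    ((hY _).sub (hY _)).enorm.pow_const _
  have hgap (n : ℕ) : |dyadicFloor n t - t| ≤ 1 / 2 ^ n := by
    rw [abs_sub_comm, abs_of_nonneg (sub_nonneg.2 (dyadicFloor_le ht n))]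
    linarith [lt_dyadicFloor_add t n]
  have hfin : ∫⁻ ω, ∑' n, ‖Y (dyadicFloor n t) ω - Y t ω‖ₑ ^ 2 ∂P ≠ ∞ := by
    rw [lintegral_tsum fun n => (hmeas n).aemeasurable]
    refine ne_top_of_le_ne_top (b := ∑' n : ℕ, c * (2⁻¹ : ℝ≥0∞) ^ n) ?_
      (ENNReal.tsum_le_tsum fun n => (h _ _).trans ?_)
    · rw [ENNReal.tsum_mul_left, ENNReal.tsum_geometric]
      exact ENNReal.mul_ne_top hc (by simp)
    · rw [← ofReal_inv_two_pow]
      exact mul_le_mul_right (ENNReal.ofReal_le_ofReal (hgap n)) c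
  filter_upwards [ae_lt_top (Measurable.tsum hmeas) hfin] with ω hω
  have hsq := ENNReal.tendsto_atTop_zero_of_tsum_ne_top hω.ne
  rw [tendsto_iff_edist_tendsto_0]
  have hsqrt := hsq.ennrpow_const (1 / 2)
  rw [ENNReal.zero_rpow_of_pos one_half_pos] at hsqrt
  refine hsqrt.congr fun n => ?_
  rw [← ENNReal.rpow_natCast, ← ENNReal.rpow_mul, edist_eq_enorm_sub]
  norm_num

lemma exists_holder_modification_unitInterval (hY : ∀ t, Measurable (Y t))
    (h : ∀ m : ℕ, ∃ c : ℝ≥0∞, c ≠ ∞ ∧ ∀ s t,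
      ∫⁻ ω, ‖Y t ω - Y s ω‖ₑ ^ (2 * m) ∂P ≤ c * ENNReal.ofReal |t - s| ^ m) :
    ∃ B : ℝ → Ω → ℝ, (∀ t, Measurable (B t)) ∧ (∀ ω, Continuous fun t => B t ω) ∧
      (∀ t ∈ Icc (0 : ℝ) 1, B t =ᵐ[P] Y t) ∧
      ∀ ω γ, 0 < γ → γ < 1 / 2 → ∃ M, HolderBoundOn M γ 1 fun t => B t ω := by
  set G : Set Ω := {ω | ∀ m, dyadicSum Y m ω ≠ ∞} with hG
  have hGmeas : MeasurableSet G := by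
    rw [hG, Set.ofPred_forall]
    exact MeasurableSet.iInter fun m =>
      (measurable_dyadicSum hY m) (measurableSet_singleton _).compl
  have hpath (ω : Ω) : ∃ b : ℝ → ℝ, (∀ t ∈ Icc (0 : ℝ) 1,
      Tendsto (fun n => G.indicator (Y (dyadicFloor n t)) ω) atTop (𝓝 (b t))) ∧
      ∀ γ, 0 < γ → γ < 1 / 2 → ∃ M, HolderBoundOn M γ 1 b := by
    by_cases hω : ω ∈ G
    · simpa only [indicator_of_mem hω] using exists_holder_limit_of_dyadicSum hω
    · refine ⟨0, fun t _ => ?_, fun γ _ _ => ⟨0, fun s _ r _ => by simp⟩⟩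
      simp only [indicator_of_notMem hω]
      exact tendsto_const_nhds
  choose b hb hholder using hpath
  have hproj {t : ℝ} (ht : t ∈ Icc (0 : ℝ) 1) : (projIcc 0 1 zero_le_one t : ℝ) = t :=
    congr_arg Subtype.val (projIcc_of_mem _ ht)
  refine ⟨fun t ω => b ω (projIcc 0 1 zero_le_one t), fun t => ?_, fun ω => ?_, fun t ht => ?_,
    fun ω γ hγ0 hγ => ?_⟩
  · let u := projIcc 0 1 (zero_le_one' ℝ) t
    exact measurable_of_tendsto_metrizable (fun n => (hY (dyadicFloor n u)).indicator hGmeas)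
      (tendsto_pi_nhds.2 fun ω => hb ω u u.2)
  · obtain ⟨M, hM⟩ := hholder ω (1 / 4) (by norm_num) (by norm_num)
    exact hM.continuous_comp_projIcc (by norm_num) zero_le_one
  · obtain ⟨c, hc, hm⟩ := h 1
    filter_upwards [ae_dyadicSum_ne_top hY h,
      ae_tendsto_dyadicFloor hY hc (by simpa using hm) ht.1] with ω hω hlim
    have hlim' := hb ω t ht
    simp only [indicator_of_mem (show ω ∈ G from hω)] at hlim'
    rw [hproj ht]
    exact tendsto_nhds_unique hlim' hlim
  · obtain ⟨M, hM⟩ := hholder ω γ hγ0 hγ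
    refine ⟨M, fun s hs r hr => ?_⟩
    simp only [hproj hs, hproj hr]
    exact hM s hs r hr

theorem exists_holder_modification {T : ℝ} (hT : 0 < T) (hY : ∀ t, Measurable (Y t))
    (h : ∀ m : ℕ, ∃ c : ℝ≥0∞, c ≠ ∞ ∧ ∀ s t,
      ∫⁻ ω, ‖Y t ω - Y s ω‖ₑ ^ (2 * m) ∂P ≤ c * ENNReal.ofReal |t - s| ^ m) :
    ∃ B : ℝ → Ω → ℝ, (∀ t, Measurable (B t)) ∧ (∀ ω, Continuous fun t => B t ω) ∧
      (∀ t ∈ Icc 0 T, B t =ᵐ[P] Y t) ∧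
      ∀ ω γ, 0 < γ → γ < 1 / 2 → ∃ M, HolderBoundOn M γ T fun t => B t ω := by
  have hscale (m : ℕ) : ∃ c : ℝ≥0∞, c ≠ ∞ ∧ ∀ s t,
      ∫⁻ ω, ‖Y (T * t) ω - Y (T * s) ω‖ₑ ^ (2 * m) ∂P ≤ c * ENNReal.ofReal |t - s| ^ m := by
    obtain ⟨c, hc, hm⟩ := h m
    refine ⟨c * ENNReal.ofReal T ^ m, by finiteness, fun s t => (hm _ _).trans_eq ?_⟩
    rw [← mul_sub, abs_mul, abs_of_pos hT, ENNReal.ofReal_mul hT.le, mul_pow, mul_assoc]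
  obtain ⟨B, hBm, hBc, hBY, hB⟩ := exists_holder_modification_unitInterval
    (Y := fun x => Y (T * x)) (fun t => hY _) hscale
  refine ⟨fun t => B (t / T), fun t => hBm _, fun ω => (hBc ω).comp (continuous_id.div_const T),
    fun t ht => ?_, fun ω γ hγ0 hγ => ?_⟩
  · simpa [mul_div_cancel₀ _ hT.ne'] using
      hBY (t / T) ⟨div_nonneg ht.1 hT.le, (div_le_one hT).2 ht.2⟩
  · obtain ⟨M, hM⟩ := hB ω γ hγ0 hγ
    exact ⟨_, hM.comp_div hT⟩

end Modification

/-! ### Isonormal Gaussian processes -/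

lemma exists_linearIsometry_of_gram {ι W V : Type*}
    [NormedAddCommGroup W] [InnerProductSpace ℝ W]
    [NormedAddCommGroup V] [InnerProductSpace ℝ V] [CompleteSpace V] {k : ι → W} {x : ι → V}
    (hgram : ∀ i j, inner ℝ (k i) (k j) = inner ℝ (x i) (x j))
    (hdense : DenseRange (Finsupp.linearCombination ℝ k)) :
    ∃ I : W →ₗᵢ[ℝ] V, ∀ i, I (k i) = x i := by
  have hnorm (c) :
      ‖Finsupp.linearCombination ℝ x c‖ = ‖Finsupp.linearCombination ℝ k c‖ := by
    rw [← sq_eq_sq₀ (norm_nonneg _) (norm_nonneg _), ← real_inner_self_eq_norm_sq,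
      ← real_inner_self_eq_norm_sq]
    simp only [Finsupp.linearCombination_apply, Finsupp.sum, sum_inner, inner_sum,
      real_inner_smul_left, real_inner_smul_right, hgram]
  let J := (Finsupp.linearCombination ℝ x).extendOfNorm (Finsupp.linearCombination ℝ k)
  have hJ (c) : J (Finsupp.linearCombination ℝ k c) = Finsupp.linearCombination ℝ x c :=
    LinearMap.extendOfNorm_eq hdense ⟨1, fun c => by rw [hnorm, one_mul]⟩ c
  have hJ_norm (w) : ‖J w‖ = ‖w‖ :=
    hdense.induction_on w (isClosed_eq J.continuous.norm continuous_norm) fun c => by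
      rw [hJ, hnorm]
  refine ⟨⟨J.toLinearMap, hJ_norm⟩, fun i => ?_⟩
  simpa using hJ (Finsupp.single i 1)

section Gaussian

variable {Ω : Type*} [MeasurableSpace Ω] {P : Measure Ω}

lemma measurable_coeFn_Lp {p : ℝ≥0∞} (Z : Lp ℝ p P) : Measurable Z :=
  (Lp.stronglyMeasurable Z).measurable

lemma coeFn_sum_smul_Lp {p : ℝ≥0∞} {ι : Type*} (s : Finset ι) (c : ι → ℝ) (Z : ι → Lp ℝ p P) :
    (∑ i ∈ s, c i • Z i : Lp ℝ p P) =ᵐ[P] fun ω => ∑ i ∈ s, c i * Z i ω := by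
  have hsmul : ∀ᵐ ω ∂P, ∀ i ∈ s, (c i • Z i : Lp ℝ p P) ω = c i * Z i ω :=
    (eventually_all_finset s).2 fun i _ => Lp.coeFn_smul (c i) (Z i)
  filter_upwards [Lp.coeFn_finsetSum s fun i => c i • Z i, hsmul] with ω hsum hω
  rw [hsum, Finset.sum_apply]
  exact Finset.sum_congr rfl hω

lemma integral_coeFn_sq (Z : Lp ℝ 2 P) : ∫ ω, Z ω ^ 2 ∂P = ‖Z‖ ^ 2 := by
  rw [← real_inner_self_eq_norm_sq, L2.inner_def]
  simp only [sq, RCLike.inner_apply, conj_trivial]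

lemma hasLaw_gaussianReal_of_hasGaussianLaw {Z : Lp ℝ 2 P} (hZ : HasGaussianLaw Z P)
    (h0 : ∫ ω, Z ω ∂P = 0) : HasLaw Z (gaussianReal 0 (‖Z‖₊ ^ 2)) P := by
  refine ⟨hZ.aemeasurable, ?_⟩
  have hvar : Var[Z; P] = ‖Z‖ ^ 2 := by
    rw [variance_of_integral_eq_zero hZ.aemeasurable h0, integral_coeFn_sq]
  rw [hZ.map_eq_gaussianReal, hvar, h0, Real.toNNReal_pow (norm_nonneg _), norm_toNNReal]

variable [IsProbabilityMeasure P]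

lemma integral_abs_le_norm_Lp (Z : Lp ℝ 2 P) : ∫ ω, |Z ω| ∂P ≤ ‖Z‖ := by
  have hZ : MemLp Z 2 P := Lp.memLp Z
  have h : ∫ ω, |Z ω| ∂P = (eLpNorm Z 1 P).toReal := by
    rw [eLpNorm_one_eq_lintegral_enorm, ← integral_norm_eq_lintegral_enorm hZ.1]
    simp only [Real.norm_eq_abs]
  rw [h, Lp.norm_def]
  exact ENNReal.toReal_mono hZ.2.ne
    (eLpNorm_le_eLpNorm_of_exponent_le one_le_two hZ.1)

lemma norm_exp_mul_I_sub_exp_mul_I_le (x y : ℝ) :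
    ‖Complex.exp (x * Complex.I) - Complex.exp (y * Complex.I)‖ ≤ |x - y| := by
  have h : Complex.exp (x * Complex.I) - Complex.exp (y * Complex.I) =
      Complex.exp (y * Complex.I) * (Complex.exp (Complex.I * (x - y : ℝ)) - 1) := by
    rw [mul_sub, ← Complex.exp_add, mul_one]
    push_cast
    ring_nf
  rw [h, norm_mul, Complex.norm_exp_ofReal_mul_I, one_mul]
  exact Real.norm_exp_I_mul_ofReal_sub_one_le

lemma lipschitzWith_charFun_map_Lp (t : ℝ) :
    LipschitzWith (Real.nnabs t) fun Z : Lp ℝ 2 P => charFun (P.map Z) t := by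
  have hmeas (Z : Lp ℝ 2 P) :
      Measurable fun ω => Complex.exp ((t * Z ω : ℝ) * Complex.I) := by
    have := measurable_coeFn_Lp Z
    fun_prop
  have hint (Z : Lp ℝ 2 P) : Integrable (fun ω => Complex.exp ((t * Z ω : ℝ) * Complex.I)) P :=
    .of_bound (hmeas Z).aestronglyMeasurable 1
      (.of_forall fun ω => (Complex.norm_exp_ofReal_mul_I _).le)
  have hcf (Z : Lp ℝ 2 P) :
      charFun (P.map Z) t = ∫ ω, Complex.exp ((t * Z ω : ℝ) * Complex.I) ∂P := by
    rw [charFun_apply_real, integral_map (measurable_coeFn_Lp Z).aemeasurable (by fun_prop)]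
    simp only [Complex.ofReal_mul]
  refine .of_dist_le_mul fun Z Z' => ?_
  have hbound : ∀ᵐ ω ∂P, ‖Complex.exp ((t * Z ω : ℝ) * Complex.I) -
      Complex.exp ((t * Z' ω : ℝ) * Complex.I)‖ ≤ |t| * |(Z - Z' : Lp ℝ 2 P) ω| := by
    filter_upwards [Lp.coeFn_sub Z Z'] with ω hω
    rw [hω, Pi.sub_apply, ← abs_mul, mul_sub]
    exact norm_exp_mul_I_sub_exp_mul_I_le _ _
  rw [hcf, hcf, dist_eq_norm, ← integral_sub (hint Z) (hint Z'), dist_eq_norm]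
  calc _ ≤ ∫ ω, |t| * |(Z - Z' : Lp ℝ 2 P) ω| ∂P :=
        norm_integral_le_of_norm_le
          (((Lp.memLp (Z - Z')).integrable one_le_two).abs.const_mul _) hbound
    _ ≤ |t| * ‖Z - Z'‖ := by
        rw [integral_const_mul]
        exact mul_le_mul_of_nonneg_left (integral_abs_le_norm_Lp _) (abs_nonneg _)

lemma hasLaw_gaussianReal_iff_charFun {Z : Lp ℝ 2 P} {v : ℝ≥0} :
    HasLaw Z (gaussianReal 0 v) P ↔
      ∀ t : ℝ, charFun (P.map Z) t = Complex.exp (-(v * t ^ 2 / 2)) := by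
  have hZ := (measurable_coeFn_Lp Z).aemeasurable (μ := P)
  have hg (t : ℝ) : charFun (gaussianReal 0 v) t = Complex.exp (-(v * t ^ 2 / 2)) := by
    rw [charFun_gaussianReal]
    simp only [Complex.ofReal_zero, mul_zero, zero_mul, zero_sub]
  refine ⟨fun h t => by rw [h.map_eq, hg], fun h => ⟨hZ, ?_⟩⟩
  have := Measure.isProbabilityMeasure_map hZ
  exact Measure.ext_of_charFun (funext fun t => (h t).trans (hg t).symm)

lemma isClosed_setOf_hasLaw_gaussianReal :
    IsClosed {Z : Lp ℝ 2 P | HasLaw Z (gaussianReal 0 (‖Z‖₊ ^ 2)) P} := by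
  simp only [hasLaw_gaussianReal_iff_charFun, ofPred_forall]
  refine isClosed_iInter fun t =>
    isClosed_eq (lipschitzWith_charFun_map_Lp t).continuous ?_
  push_cast
  fun_prop

lemma hasLaw_gaussianReal_sum_smul {ι : Type*} {Z : ι → Lp ℝ 2 P}
    (hZ : IsGaussianProcess (fun i => (Z i : Ω → ℝ)) P) (h0 : ∀ i, ∫ ω, Z i ω ∂P = 0)
    (s : Finset ι) (c : ι → ℝ) :
    HasLaw (∑ i ∈ s, c i • Z i : Lp ℝ 2 P) (gaussianReal 0 (‖∑ i ∈ s, c i • Z i‖₊ ^ 2)) P := by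
  have hae := coeFn_sum_smul_Lp s c Z
  refine hasLaw_gaussianReal_of_hasGaussianLaw ?_ ?_
  · exact ((hZ.smul c).hasGaussianLaw_fun_sum (I := s)).congr hae.symm
  · rw [integral_congr_ae hae, integral_finsetSum]
    · exact Finset.sum_eq_zero fun i _ => by rw [integral_const_mul, h0, mul_zero]
    · exact fun i _ => ((Lp.memLp (Z i)).integrable one_le_two).const_mul _

end Gaussian

section Isonormal

variable {Ω : Type*} [MeasurableSpace Ω] {P : Measure Ω} {W : Type*} [NormedAddCommGroup W]
  [InnerProductSpace ℝ W] {I : W →ₗᵢ[ℝ] Lp ℝ 2 P}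

/-- An isonormal Gaussian process over `W` (an abstract Wiener integral): a linear isometry into
`L²(P)` all of whose values are centered Gaussian variables. -/
def IsIsonormal (I : W →ₗᵢ[ℝ] Lp ℝ 2 P) : Prop :=
  ∀ w, HasLaw (I w) (gaussianReal 0 (‖w‖₊ ^ 2)) P

lemma IsIsonormal.hasGaussianLaw_pi (hI : IsIsonormal I) {ι : Type*} [Finite ι] (w : ι → W) :
    HasGaussianLaw (fun ω i => I (w i) ω) P := by
  classical
  have := Fintype.ofFinite ι
  have hmeas : Measurable fun ω i => I (w i) ω :=
    measurable_pi_lambda _ fun i => measurable_coeFn_Lp _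
  refine ⟨isGaussian_of_isGaussian_map fun L => ?_⟩
  rw [Measure.map_map (by fun_prop) hmeas]
  have hL : (L ∘ fun ω i => I (w i) ω) =ᵐ[P] I (∑ i, L (Pi.single i 1) • w i) := by
    simp only [map_sum, map_smul]
    filter_upwards [coeFn_sum_smul_Lp Finset.univ (fun i => L (Pi.single i 1)) fun i => I (w i)]
      with ω hω
    rw [hω, Function.comp_apply]
    conv_lhs => rw [pi_eq_sum_univ' fun i => I (w i) ω]
    simp only [map_sum, map_smul, smul_eq_mul, mul_comm]
  rw [Measure.map_congr hL, (hI _).map_eq]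
  infer_instance

variable [IsProbabilityMeasure P]

lemma isIsonormal_of_dense {D : Set W} (hD : Dense D)
    (h : ∀ w ∈ D, HasLaw (I w) (gaussianReal 0 (‖w‖₊ ^ 2)) P) : IsIsonormal I := by
  have hclosed : IsClosed {w | HasLaw (I w) (gaussianReal 0 (‖w‖₊ ^ 2)) P} := by
    simpa only [preimage_ofPred_eq, I.nnnorm_map] using
      (isClosed_setOf_hasLaw_gaussianReal (P := P)).preimage I.continuous
  exact hD.induction h hclosed

lemma IsIsonormal.iIndepFun (hI : IsIsonormal I) {ι : Type*} [Finite ι] {w : ι → W}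
    (hw : Pairwise fun i j => inner ℝ (w i) (w j) = 0) :
    iIndepFun (fun i => (I (w i) : Ω → ℝ)) P := by
  have := Fintype.ofFinite ι
  refine (hI.hasGaussianLaw_pi w).iIndepFun_of_covariance_eq_zero fun i j hij => ?_
  have h0 (v : W) : ∫ ω, I v ω ∂P = 0 := by rw [(hI v).integral_eq, integral_id_gaussianReal]
  rw [covariance_eq_sub (Lp.memLp _) (Lp.memLp _), h0, zero_mul, sub_zero, ← hw hij,
    ← I.inner_map_map, L2.inner_def]
  exact integral_congr_ae (.of_forall fun ω => by simp [mul_comm])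

end Isonormal

lemma volterraK_eq_zero_of_notMem {H t T s : ℝ} (htT : t ≤ T) (hs : s ∉ Ioo 0 T) :
    volterraK H t s = 0 :=
  indicator_of_notMem (fun h => hs (Ioo_subset_Ioo_right htT h)) _

lemma setIntegral_volterraK_mul {H t T : ℝ} (htT : t ≤ T) (g : ℝ → ℝ) :
    ∫ u in Ioo 0 T, volterraK H t u * g u = ∫ u, volterraK H t u * g u :=
  setIntegral_eq_integral_of_forall_compl_eq_zero fun u hu => by
    rw [volterraK_eq_zero_of_notMem htT hu, zero_mul]

/-- The Volterra kernel `K_H(t, ·)` as a vector of `L²(0, T)`. -/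
def volterraLp {H : ℝ} (hH0 : 0 < H) (hH1 : H < 1 / 2) (T : ℝ) (t : Icc 0 T) :
    Lp ℝ 2 (volume.restrict (Ioo 0 T)) :=
  ((memLp_volterraK hH0 hH1 t.2.1).restrict (Ioo 0 T)).toLp

section VolterraLp

variable {H : ℝ} (hH0 : 0 < H) (hH1 : H < 1 / 2) {T : ℝ}

lemma coeFn_volterraLp (t : Icc 0 T) :
    volterraLp hH0 hH1 T t =ᵐ[volume.restrict (Ioo 0 T)] volterraK H t :=
  MemLp.coeFn_toLp _

lemma inner_volterraLp_left (t : Icc 0 T) (g : Lp ℝ 2 (volume.restrict (Ioo 0 T))) :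
    inner ℝ (volterraLp hH0 hH1 T t) g = ∫ u, volterraK H t u * g u := by
  rw [L2.inner_def, ← setIntegral_volterraK_mul t.2.2]
  refine integral_congr_ae ?_
  filter_upwards [coeFn_volterraLp hH0 hH1 t] with u hu
  simp only [hu, RCLike.inner_apply, conj_trivial, mul_comm]

lemma inner_volterraLp (s t : Icc 0 T) :
    inner ℝ (volterraLp hH0 hH1 T s) (volterraLp hH0 hH1 T t) =
      ((s : ℝ) ^ (2 * H) + (t : ℝ) ^ (2 * H) - |(t : ℝ) - s| ^ (2 * H)) / 2 := by
  rw [real_inner_comm, inner_volterraLp_left, ← integral_volterraK_mul hH0 hH1 s.2.1 t.2.1,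
    ← setIntegral_volterraK_mul t.2.2, ← setIntegral_volterraK_mul t.2.2]
  refine integral_congr_ae ?_
  filter_upwards [coeFn_volterraLp hH0 hH1 s] with u hu
  rw [hu]

lemma eq_zero_of_forall_inner_volterraLp {g : Lp ℝ 2 (volume.restrict (Ioo 0 T))}
    (hg : ∀ t, inner ℝ (volterraLp hH0 hH1 T t) g = 0) : g = 0 := by
  have hzero : (Ioo 0 T).indicator g =ᵐ[volume] 0 := by
    refine ae_eq_zero_of_forall_integral_volterraK hH0 hH1
      ((memLp_indicator_iff_restrict measurableSet_Ioo).2 (Lp.memLp g))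
      (fun s hs => indicator_of_notMem hs _) fun t ht => ?_
    have hgt := hg ⟨t, ht.1.le, ht.2.le⟩
    rw [inner_volterraLp_left] at hgt
    refine (integral_congr_ae (.of_forall fun s => ?_)).trans hgt
    by_cases hs : s ∈ Ioo 0 T
    · simp only [indicator_of_mem hs]
    · simp only [volterraK_eq_zero_of_notMem ht.2.le hs, zero_mul]
  rw [Lp.eq_zero_iff_ae_eq_zero]
  filter_upwards [ae_restrict_of_ae hzero, ae_restrict_mem measurableSet_Ioo] with s hs hmem
  rwa [indicator_of_mem hmem] at hs

lemma denseRange_linearCombination_volterraLp :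
    DenseRange (Finsupp.linearCombination ℝ (volterraLp hH0 hH1 T)) := by
  have hrange : range (Finsupp.linearCombination ℝ (volterraLp hH0 hH1 T)) =
      (Submodule.span ℝ (range (volterraLp hH0 hH1 T)) : Set _) := by
    rw [← Finsupp.range_linearCombination, LinearMap.coe_range]
  rw [DenseRange, hrange, Submodule.dense_iff_topologicalClosure_eq_top,
    Submodule.topologicalClosure_eq_top_iff, Submodule.eq_bot_iff]
  exact fun g hg => eq_zero_of_forall_inner_volterraLp hH0 hH1 fun t =>
    (Submodule.mem_orthogonal _ _).1 hg _ (Submodule.subset_span (mem_range_self t))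

lemma exists_isonormal_of_isFracBrownianOn {Ω : Type*} [MeasurableSpace Ω] {P : Measure Ω}
    [IsProbabilityMeasure P] {X : ℝ → Ω → ℝ} (hX : IsFracBrownianOn H T X P) :
    ∃ I : Lp ℝ 2 (volume.restrict (Ioo 0 T)) →ₗᵢ[ℝ] Lp ℝ 2 P,
      IsIsonormal I ∧ ∀ t : Icc 0 T, I (volterraLp hH0 hH1 T t) =ᵐ[P] X t := by
  have hL2 (t : Icc 0 T) : MemLp (X t) 2 P := (hX.gaussian.hasGaussianLaw_eval t).memLp_two
  let Z (t : Icc 0 T) : Lp ℝ 2 P := (hL2 t).toLp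
  have hZ (t : Icc 0 T) : Z t =ᵐ[P] X t := MemLp.coeFn_toLp _
  have hgram (s t : Icc 0 T) :
      inner ℝ (volterraLp hH0 hH1 T s) (volterraLp hH0 hH1 T t) = inner ℝ (Z s) (Z t) := by
    rw [inner_volterraLp, ← hX.covariance s s.2 t t.2, covariance_eq_sub (hL2 s) (hL2 t),
      hX.centered s s.2, zero_mul, sub_zero, L2.inner_def]
    refine integral_congr_ae ?_
    filter_upwards [hZ s, hZ t] with ω hs ht
    simp only [hs, ht, RCLike.inner_apply, conj_trivial, Pi.mul_apply, mul_comm]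
  have hdense := denseRange_linearCombination_volterraLp hH0 hH1 (T := T)
  obtain ⟨I, hI⟩ := exists_linearIsometry_of_gram hgram hdense
  refine ⟨I, isIsonormal_of_dense hdense ?_, fun t => (hI t).symm ▸ hZ t⟩
  rintro _ ⟨c, rfl⟩
  have hsum : I (Finsupp.linearCombination ℝ (volterraLp hH0 hH1 T) c) =
      ∑ t ∈ c.support, c t • Z t := by
    simp only [Finsupp.linearCombination_apply, Finsupp.sum, map_sum, map_smul, hI]
  rw [← I.nnnorm_map, hsum]
  exact hasLaw_gaussianReal_sum_smul (hX.gaussian.congr fun t => (hZ t).symm)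
    (fun t => (integral_congr_ae (hZ t)).trans (hX.centered t t.2)) _ _

end VolterraLp

/-! ### Brownian motion from an isonormal process -/

/-- The indicator function of `(-∞, t]` as a vector of `L²(0, T)`. -/
def stepLp (T t : ℝ) : Lp ℝ 2 (volume.restrict (Ioo 0 T)) :=
  indicatorConstLp 2 (measurableSet_Iic (a := t)) (measure_ne_top _ _) 1

lemma restrict_Ioo_restrict_Iic {s t : ℝ} (hst : s ≤ t) :
    (volume.restrict (Ioo 0 t)).restrict (Iic s) = volume.restrict (Ioc 0 s) := by
  rw [restrict_Ioo_eq_restrict_Ioc, Measure.restrict_restrict measurableSet_Iic, inter_comm,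
    Ioc_inter_Iic, min_eq_right hst]

lemma inner_stepLp_left {s T : ℝ} (hsT : s ≤ T) (g : Lp ℝ 2 (volume.restrict (Ioo 0 T))) :
    inner ℝ (stepLp T s) g = ∫ u in Ioc 0 s, g u := by
  rw [stepLp, L2.inner_indicatorConstLp_one, restrict_Ioo_restrict_Iic hsT]

lemma inner_stepLp_sub_left {s t T : ℝ} (hs : 0 ≤ s) (hst : s ≤ t) (htT : t ≤ T)
    (g : Lp ℝ 2 (volume.restrict (Ioo 0 T))) :
    inner ℝ (stepLp T t - stepLp T s) g = ∫ u in Ioc s t, g u := by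
  have hg : IntegrableOn g (Ioc 0 t) :=
    ((integrableOn_Ioc_iff_integrableOn_Ioo (by finiteness)).2
      ((Lp.memLp g).integrable one_le_two)).mono_set (Ioc_subset_Ioc_right htT)
  rw [inner_sub_left, inner_stepLp_left htT, inner_stepLp_left (hst.trans htT), sub_eq_iff_eq_add',
    ← Ioc_union_Ioc_eq_Ioc hs hst, setIntegral_union (Ioc_disjoint_Ioc_of_le le_rfl)
      measurableSet_Ioc (hg.mono_set (Ioc_subset_Ioc_right hst))
      (hg.mono_set (Ioc_subset_Ioc_left hs))]

lemma inner_stepLp (T s t : ℝ) :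
    inner ℝ (stepLp T s) (stepLp T t) = (volume.restrict (Ioo 0 T)).real (Iic (min s t)) := by
  rw [stepLp, stepLp, L2.inner_indicatorConstLp_indicatorConstLp, Iic_inter_Iic]
  simp

lemma stepLp_zero (T : ℝ) : stepLp T 0 = 0 := by
  have h : (Iic 0 ∩ Ioo 0 T : Set ℝ) = ∅ :=
    (Iic_disjoint_Ioi le_rfl).mono_right Ioo_subset_Ioi_self |>.inter_eq
  rw [← inner_self_eq_zero (𝕜 := ℝ), inner_stepLp, min_self,
    measureReal_restrict_apply measurableSet_Iic, h, measureReal_empty]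

lemma norm_stepLp_sub_sq (T : ℝ) {s t : ℝ} (hst : s ≤ t) :
    ‖stepLp T t - stepLp T s‖ ^ 2 = (volume.restrict (Ioo 0 T)).real (Ioc s t) := by
  rw [norm_sub_sq_real, ← real_inner_self_eq_norm_sq, ← real_inner_self_eq_norm_sq, inner_stepLp,
    inner_stepLp, inner_stepLp, min_self, min_self, min_eq_right hst, ← Iic_sdiff_Iic,
    measureReal_sdiff (Iic_subset_Iic.2 hst) measurableSet_Iic]
  ring

lemma norm_stepLp_sub_sq_le (T s t : ℝ) : ‖stepLp T t - stepLp T s‖ ^ 2 ≤ |t - s| := by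
  wlog hst : s ≤ t generalizing s t
  · rw [norm_sub_rev, abs_sub_comm]
    exact this t s (le_of_not_ge hst)
  rw [norm_stepLp_sub_sq T hst, abs_of_nonneg (sub_nonneg.2 hst), ← Real.volume_real_Ioc_of_le hst]
  exact ENNReal.toReal_mono measure_Ioc_lt_top.ne (Measure.restrict_apply_le _ _)

lemma norm_stepLp_sub_sq_of_mem {T s t : ℝ} (hs : s ∈ Icc 0 T) (ht : t ∈ Icc 0 T)
    (hst : s ≤ t) : ‖stepLp T t - stepLp T s‖ ^ 2 = t - s := by
  rw [norm_stepLp_sub_sq T hst, restrict_Ioo_eq_restrict_Ioc,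
    measureReal_restrict_apply measurableSet_Ioc, inter_eq_left.2 (Ioc_subset_Ioc hs.1 ht.2),
    Real.volume_real_Ioc_of_le hst]

lemma inner_stepLp_sub_stepLp_sub (T : ℝ) {a b c d : ℝ} (hab : a ≤ b) (hbc : b ≤ c)
    (hcd : c ≤ d) : inner ℝ (stepLp T b - stepLp T a) (stepLp T d - stepLp T c) = 0 := by
  simp only [inner_sub_left, inner_sub_right, inner_stepLp, min_eq_left, hbc, hab.trans hbc,
    hbc.trans hcd, hab.trans (hbc.trans hcd), sub_self]

lemma inner_stepLp_increments (T : ℝ) {n : ℕ} {t : Fin (n + 1) → ℝ} (ht : Monotone t) :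
    Pairwise fun i j : Fin n => inner ℝ (stepLp T (t i.succ) - stepLp T (t i.castSucc))
      (stepLp T (t j.succ) - stepLp T (t j.castSucc)) = 0 := by
  intro i j hij
  wlog hlt : i < j generalizing i j
  · rw [real_inner_comm]
    exact this hij.symm (lt_of_le_of_ne (not_lt.1 hlt) hij.symm)
  exact inner_stepLp_sub_stepLp_sub T (ht (Fin.castSucc_le_succ i))
    (ht (Fin.succ_le_castSucc_iff.2 hlt)) (ht (Fin.castSucc_le_succ j))

lemma lintegral_gaussianReal_even_moment (m : ℕ) (σ : ℝ≥0) :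
    ∫⁻ x, ‖x‖ₑ ^ (2 * m) ∂(gaussianReal 0 (σ ^ 2)) =
      ((σ : ℝ≥0∞) ^ 2) ^ m * ∫⁻ x, ‖x‖ₑ ^ (2 * m) ∂(gaussianReal 0 1) := by
  have h : gaussianReal 0 (σ ^ 2) = (gaussianReal 0 1).map fun x => (σ : ℝ) * x := by
    rw [gaussianReal_map_const_mul, mul_zero, mul_one]
    rfl
  rw [h, lintegral_map (by fun_prop) (by fun_prop), ← lintegral_const_mul _ (by fun_prop)]
  refine lintegral_congr fun x => ?_
  rw [enorm_mul, mul_pow, pow_mul, NNReal.enorm_eq]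

lemma lintegral_gaussianReal_pow_ne_top (m : ℕ) :
    ∫⁻ x, ‖x‖ₑ ^ m ∂(gaussianReal 0 1) ≠ ∞ := by
  rcases Nat.eq_zero_or_pos m with rfl | hm
  · simp
  · have h := lintegral_rpow_enorm_lt_top_of_eLpNorm_lt_top (p := (m : ℝ≥0))
      (by simpa using hm.ne') (by simp) (memLp_id_gaussianReal (μ := 0) (v := 1) (m : ℝ≥0)).2
    simpa using h.ne

section Isonormal

variable {Ω : Type*} [MeasurableSpace Ω] {P : Measure Ω} {T : ℝ}
  {I : Lp ℝ 2 (volume.restrict (Ioo 0 T)) →ₗᵢ[ℝ] Lp ℝ 2 P}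

lemma coeFn_isometry_sub {W : Type*} [NormedAddCommGroup W] [NormedSpace ℝ W]
    (J : W →ₗᵢ[ℝ] Lp ℝ 2 P) (v w : W) : (fun ω => J v ω - J w ω) =ᵐ[P] J (v - w) := by
  rw [map_sub]
  exact (Lp.coeFn_sub _ _).symm

lemma IsIsonormal.lintegral_stepLp_sub_pow_le (hI : IsIsonormal I) (m : ℕ) (s t : ℝ) :
    ∫⁻ ω, ‖I (stepLp T t) ω - I (stepLp T s) ω‖ₑ ^ (2 * m) ∂P ≤
      (∫⁻ x, ‖x‖ₑ ^ (2 * m) ∂(gaussianReal 0 1)) * ENNReal.ofReal |t - s| ^ m := by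
  have hsub : ∫⁻ ω, ‖I (stepLp T t) ω - I (stepLp T s) ω‖ₑ ^ (2 * m) ∂P =
      ∫⁻ ω, ‖I (stepLp T t - stepLp T s) ω‖ₑ ^ (2 * m) ∂P :=
    lintegral_congr_ae ((coeFn_isometry_sub I _ _).fun_comp fun x => ‖x‖ₑ ^ (2 * m))
  rw [hsub, (hI _).lintegral_comp (f := fun x => ‖x‖ₑ ^ (2 * m)) (by fun_prop),
    lintegral_gaussianReal_even_moment, mul_comm]
  gcongr
  rw [← enorm_eq_nnnorm, ← ofReal_norm, ← ENNReal.ofReal_pow (norm_nonneg _)]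
  exact ENNReal.ofReal_le_ofReal (norm_stepLp_sub_sq_le T s t)

variable [IsProbabilityMeasure P]

lemma IsIsonormal.isBrownianOn (hI : IsIsonormal I) (hT : 0 ≤ T) {B : ℝ → Ω → ℝ}
    (hcont : ∀ ω, Continuous fun t => B t ω) (hB : ∀ t ∈ Icc 0 T, B t =ᵐ[P] I (stepLp T t)) :
    IsBrownianOn T B P := by
  have hincr {s t : ℝ} (hs : s ∈ Icc 0 T) (ht : t ∈ Icc 0 T) :
      (fun ω => B t ω - B s ω) =ᵐ[P] I (stepLp T t - stepLp T s) :=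
    ((hB t ht).sub (hB s hs)).trans (coeFn_isometry_sub I _ _)
  refine ⟨?_, fun n t ht => ?_, fun s hs t ht hst => ?_,
    .of_forall fun ω => (hcont ω).continuousOn⟩
  · filter_upwards [hB 0 ⟨le_rfl, hT⟩, Lp.coeFn_zero ℝ 2 P] with ω hω h0
    rw [hω, stepLp_zero, map_zero, h0, Pi.zero_apply]
  · exact (hI.iIndepFun (inner_stepLp_increments T fun i j hij => ht hij)).congr
      fun i => (hincr (t i.castSucc).2 (t i.succ).2).symm
  · rw [← norm_stepLp_sub_sq_of_mem hs ht hst, Real.toNNReal_pow (norm_nonneg _), norm_toNNReal]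
    exact (hI _).congr (hincr hs ht)

lemma IsIsonormal.exists_isBrownianOn (hI : IsIsonormal I) (hT : 0 < T) :
    ∃ B : ℝ → Ω → ℝ, (∀ t, Measurable (B t)) ∧ (∀ ω, Continuous fun t => B t ω) ∧
      IsBrownianOn T B P ∧
      (∀ᵐ ω ∂P, ∀ lam : ℝ, 0 < lam → lam < 1 / 2 → MemHolderZero lam T (fun t => B t ω)) ∧
      ∀ t ∈ Icc 0 T, B t =ᵐ[P] I (stepLp T t) := by
  obtain ⟨B, hmeas, hcont, hB, hholder⟩ := exists_holder_modification (P := P) hT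
    (Y := fun t => I (stepLp T t)) (fun t => measurable_coeFn_Lp _) fun m =>
      ⟨_, lintegral_gaussianReal_pow_ne_top (2 * m), hI.lintegral_stepLp_sub_pow_le m⟩
  have hBrown := hI.isBrownianOn hT.le hcont hB
  refine ⟨B, hmeas, hcont, hBrown, ?_, hB⟩
  filter_upwards [hBrown.zero] with ω hω lam hlam0 hlam1
  exact ⟨hω, hholder ω lam hlam0 hlam1⟩

end Isonormal

/-! ### Integration by parts against the kernels -/

section Fubini

variable {X Y : Type*} [MeasurableSpace X] [MeasurableSpace Y] {μ : Measure X} {ν : Measure Y}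
  [SFinite μ] [SFinite ν] {S : Set (X × Y)} (hS : MeasurableSet S) {D : X → ℝ} {K g : Y → ℝ}
  (hD : AEStronglyMeasurable D μ) (hD0 : 0 ≤ᵐ[μ] D) (hg : AEStronglyMeasurable g ν)
  (hK : ∀ᵐ y ∂ν, IntegrableOn D {x | (x, y) ∈ S} μ ∧ ∫ x in {x | (x, y) ∈ S}, D x ∂μ = K y)
  (hKg : Integrable (fun y => K y * g y) ν)
include hS hD hD0 hg hK hKg

lemma integrable_indicator_mul_of_section :
    Integrable (S.indicator fun p => D p.1 * g p.2) (μ.prod ν) := by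
  refine (integrable_prod_iff' ((hD.comp_fst.mul hg.comp_snd).indicator hS)).2
    ⟨hK.mono fun y hy => (integrable_indicator_iff (measurable_prodMk_right hS)).2
      (hy.1.mul_const (g y)), hKg.norm.congr ?_⟩
  filter_upwards [hK] with y ⟨_, hy⟩
  have hKy : 0 ≤ K y := hy ▸ integral_nonneg_of_ae (ae_restrict_of_ae hD0)
  calc ‖K y * g y‖ = ∫ x in {x | (x, y) ∈ S}, D x * ‖g y‖ ∂μ := by
        rw [integral_mul_const, hy, norm_mul, Real.norm_of_nonneg hKy]
    _ = ∫ x, indicator {x | (x, y) ∈ S} (fun x => D x * ‖g y‖) x ∂μ :=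
        (integral_indicator (measurable_prodMk_right hS)).symm
    _ = ∫ x, ‖S.indicator (fun p => D p.1 * g p.2) (x, y)‖ ∂μ := by
        refine integral_congr_ae (hD0.mono fun x hx => ?_)
        by_cases hxy : (x, y) ∈ S <;> simp [hxy, abs_of_nonneg hx]

lemma integral_setIntegral_section_mul :
    ∫ x, (∫ y in {y | (x, y) ∈ S}, g y ∂ν) * D x ∂μ = ∫ y, K y * g y ∂ν := by
  calc ∫ x, (∫ y in {y | (x, y) ∈ S}, g y ∂ν) * D x ∂μ
      = ∫ x, ∫ y, S.indicator (fun p => D p.1 * g p.2) (x, y) ∂ν ∂μ := by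
        refine integral_congr_ae (.of_forall fun x => ?_)
        beta_reduce
        have hsec : MeasurableSet {y | (x, y) ∈ S} := measurable_prodMk_left hS
        rw [mul_comm, ← integral_const_mul, ← integral_indicator hsec]
        rfl
    _ = ∫ y, ∫ x, S.indicator (fun p => D p.1 * g p.2) (x, y) ∂μ ∂ν :=
        integral_integral_swap (integrable_indicator_mul_of_section hS hD hD0 hg hK hKg)
    _ = ∫ y, K y * g y ∂ν := by
        refine integral_congr_ae (hK.mono fun y hy => ?_)
        beta_reduce
        have hsec : MeasurableSet {x | (x, y) ∈ S} := measurable_prodMk_right hS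
        rw [← hy.2, ← integral_mul_const, ← integral_indicator hsec]
        rfl

end Fubini

lemma restrict_Ioo_restrict_Ici {s t : ℝ} (hs : 0 ≤ s) :
    (volume.restrict (Ioo 0 t)).restrict (Ici s) = volume.restrict (Ioc s t) := by
  rw [restrict_Ioo_eq_restrict_Ioc, ← restrict_Ioi_eq_restrict_Ici,
    Measure.restrict_restrict measurableSet_Ioi, inter_comm, Ioc_inter_Ioi, max_eq_right hs]

lemma memLp_restrict_Ioo {t T : ℝ} (htT : t ≤ T) (g : Lp ℝ 2 (volume.restrict (Ioo 0 T))) :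
    MemLp g 2 (volume.restrict (Ioo 0 t)) :=
  (Lp.memLp g).mono_measure (Measure.restrict_mono (Ioo_subset_Ioo_right htT) le_rfl)

lemma integrableOn_Ioc_and_integral_eq_sub_of_nonneg {a b : ℝ} (hab : a ≤ b) {f f' : ℝ → ℝ}
    (hcont : ContinuousOn f (Icc a b)) (hderiv : ∀ x ∈ Ioo a b, HasDerivAt f (f' x) x)
    (hnonneg : ∀ x ∈ Ioo a b, 0 ≤ f' x) :
    IntegrableOn f' (Ioc a b) ∧ ∫ x in Ioc a b, f' x = f b - f a := by
  have hint := intervalIntegral.integrableOn_deriv_of_nonneg hcont hderiv hnonneg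
  refine ⟨hint, ?_⟩
  rw [← intervalIntegral.integral_of_le hab,
    intervalIntegral.integral_eq_sub_of_hasDerivAt_of_le hab hcont hderiv
      ((intervalIntegrable_iff_integrableOn_Ioc_of_le hab).2 hint)]

lemma integral_kernelOneDeriv {H t u : ℝ} (hH1 : H < 1 / 2) (hu : 0 ≤ u) (hut : u < t) :
    IntegrableOn (kernelOneDeriv H t) (Ioc 0 u) ∧
      ∫ s in Ioc 0 u, kernelOneDeriv H t s = kernelOne H t u := by
  have hcont : ContinuousOn (kernelOne H t) (Icc 0 u) :=
    (continuousOn_const.mul (continuousOn_id.rpow_const fun _ _ => .inr (by linarith))).mul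
      ((continuousOn_const.sub continuousOn_id).rpow_const fun s hs =>
        .inl (sub_pos.2 (hs.2.trans_lt hut)).ne')
  have hzero : kernelOne H t 0 = 0 := by
    rw [kernelOne, Real.zero_rpow (by linarith), mul_zero, zero_mul]
  have h := integrableOn_Ioc_and_integral_eq_sub_of_nonneg hu hcont
    (fun s hs => hasDerivAt_kernelOne hs.1 (hs.2.trans hut))
    fun s hs => kernelOneDeriv_nonneg hH1.le hs.1 (hs.2.trans hut)
  rwa [hzero, sub_zero] at h

section

variable {H : ℝ} (hH0 : 0 < H) (hH1 : H < 1 / 2)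
include hH0 hH1

lemma integral_kernelTwoNegDeriv {t u : ℝ} (hu : 0 < u) (hut : u ≤ t) :
    IntegrableOn (kernelTwoNegDeriv H t) (Ioc u t) ∧
      ∫ s in Ioc u t, kernelTwoNegDeriv H t s = kernelTwo H t u := by
  have hcont : ContinuousOn (kernelTwo H t) (Icc u t) := by
    refine ContinuousOn.congr (continuousOn_const.mul (ContinuousOn.mul ?_ <|
      continuousOn_const.mul ?_)) fun s hs => kernelTwo_eq hH0 hH1 (hu.trans_le hs.1) hs.2
    · exact continuousOn_id.rpow_const fun s hs => .inl (hu.trans_le hs.1).ne'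
    · exact ((continuous_incBeta (by linarith) (by linarith)).comp
        (continuous_id.div_const t)).continuousOn
  have hself : kernelTwo H t t = 0 := by
    rw [kernelTwo, intervalIntegral.integral_same, mul_zero]
  have h := integrableOn_Ioc_and_integral_eq_sub_of_nonneg hut hcont.neg
    (fun s hs => (hasDerivAt_kernelTwo hH0 hH1 (hu.trans hs.1) hs.2).neg)
    fun s hs => (neg_neg (kernelTwoNegDeriv H t s)).symm ▸
      kernelTwoNegDeriv_nonneg hH1.le (hu.trans hs.1) hs.2
  simpa only [neg_neg, Pi.neg_apply, hself, neg_zero, zero_sub] using h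

lemma memLp_kernelOne {t : ℝ} (ht : 0 ≤ t) :
    MemLp (kernelOne H t) 2 (volume.restrict (Ioo 0 t)) := by
  have hmeas : Measurable (kernelOne H t) := by
    unfold kernelOne
    fun_prop
  refine ((memLp_volterraK hH0 hH1 ht).restrict (Ioo 0 t)).mono hmeas.aestronglyMeasurable ?_
  filter_upwards [ae_restrict_mem measurableSet_Ioo] with u hu
  rw [Real.norm_of_nonneg (kernelOne_nonneg hu.1.le hu.2.le),
    Real.norm_of_nonneg (volterraK_nonneg hH1.le t u), volterraK, indicator_of_mem hu]
  exact le_add_of_nonneg_right (kernelTwo_nonneg hH1.le hu.1.le hu.2.le)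

lemma memLp_kernelTwo {t : ℝ} (ht : 0 ≤ t) :
    MemLp (kernelTwo H t) 2 (volume.restrict (Ioo 0 t)) := by
  refine (((memLp_volterraK hH0 hH1 ht).restrict (Ioo 0 t)).sub
    (memLp_kernelOne hH0 hH1 ht)).ae_eq ?_
  filter_upwards [ae_restrict_mem measurableSet_Ioo] with u hu
  rw [Pi.sub_apply, volterraK, indicator_of_mem hu, add_sub_cancel_left]

variable {t T : ℝ} (ht : t ∈ Icc 0 T) (g : Lp ℝ 2 (volume.restrict (Ioo 0 T)))
include ht

lemma setIntegral_inner_stepLp_sub_mul_kernelOneDeriv :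
    ∫ s in Ioo 0 t, inner ℝ (stepLp T t - stepLp T s) g * kernelOneDeriv H t s =
      ∫ u in Ioo 0 t, kernelOne H t u * g u := by
  rw [← integral_setIntegral_section_mul (μ := volume.restrict (Ioo 0 t))
    (measurableSet_le measurable_fst measurable_snd)
    (measurable_kernelOneDeriv H t).aestronglyMeasurable ?_ (memLp_restrict_Ioo ht.2 g).1 ?_
    ((memLp_kernelOne hH0 hH1 ht.1).integrable_mul (memLp_restrict_Ioo ht.2 g))]
  · refine setIntegral_congr_fun measurableSet_Ioo fun s hs => ?_
    rw [inner_stepLp_sub_left hs.1.le hs.2.le ht.2, ← restrict_Ioo_restrict_Ici hs.1.le]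
    rfl
  · filter_upwards [ae_restrict_mem measurableSet_Ioo] with s hs
      using kernelOneDeriv_nonneg hH1.le hs.1 hs.2
  · filter_upwards [ae_restrict_mem measurableSet_Ioo] with u hu
    have h := integral_kernelOneDeriv hH1 hu.1.le hu.2
    rwa [IntegrableOn, ← restrict_Ioo_restrict_Iic hu.2.le] at h

lemma setIntegral_inner_stepLp_mul_kernelTwoNegDeriv :
    ∫ s in Ioo 0 t, inner ℝ (stepLp T s) g * kernelTwoNegDeriv H t s =
      ∫ u in Ioo 0 t, kernelTwo H t u * g u := by
  rw [← integral_setIntegral_section_mul (μ := volume.restrict (Ioo 0 t))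
    (measurableSet_le measurable_snd measurable_fst)
    (measurable_kernelTwoNegDeriv hH0 hH1 t).aestronglyMeasurable ?_
    (memLp_restrict_Ioo ht.2 g).1 ?_
    ((memLp_kernelTwo hH0 hH1 ht.1).integrable_mul (memLp_restrict_Ioo ht.2 g))]
  · refine setIntegral_congr_fun measurableSet_Ioo fun s hs => ?_
    rw [inner_stepLp_left (hs.2.le.trans ht.2), ← restrict_Ioo_restrict_Iic hs.2.le]
    rfl
  · filter_upwards [ae_restrict_mem measurableSet_Ioo] with s hs
      using kernelTwoNegDeriv_nonneg hH1.le hs.1 hs.2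
  · filter_upwards [ae_restrict_mem measurableSet_Ioo] with u hu
    have h := integral_kernelTwoNegDeriv hH0 hH1 hu.1 hu.2.le
    rwa [IntegrableOn, ← restrict_Ioo_restrict_Ici hu.1.le] at h

lemma setIntegral_inner_stepLp_add :
    (∫ s in Ioo 0 t, inner ℝ (stepLp T t - stepLp T s) g * kernelOneDeriv H t s) +
      ∫ s in Ioo 0 t, inner ℝ (stepLp T s) g * kernelTwoNegDeriv H t s =
    inner ℝ (volterraLp hH0 hH1 T ⟨t, ht⟩) g := by
  have hg := memLp_restrict_Ioo ht.2 g
  rw [setIntegral_inner_stepLp_sub_mul_kernelOneDeriv hH0 hH1 ht g,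
    setIntegral_inner_stepLp_mul_kernelTwoNegDeriv hH0 hH1 ht g, inner_volterraLp_left,
    ← setIntegral_volterraK_mul (le_refl t)]
  refine (integral_add ((memLp_kernelOne hH0 hH1 ht.1).integrable_mul hg)
    ((memLp_kernelTwo hH0 hH1 ht.1).integrable_mul hg)).symm.trans <|
      setIntegral_congr_fun measurableSet_Ioo fun u hu => ?_
  simp only [volterraK, indicator_of_mem hu, add_mul, Pi.mul_apply]

end

/-! ### Stochastic Fubini and the representation -/

lemma setIntegral_isometry {Ω : Type*} [MeasurableSpace Ω] {P : Measure Ω} {W : Type*}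
    [NormedAddCommGroup W] [InnerProductSpace ℝ W] [CompleteSpace W] (J : W →ₗᵢ[ℝ] Lp ℝ 2 P)
    {A : Set Ω} (hA : MeasurableSet A) (hPA : P A ≠ ∞) (w : W) :
    ∫ ω in A, J w ω ∂P =
      inner ℝ w (J.toContinuousLinearMap.adjoint (indicatorConstLp 2 hA hPA 1)) := by
  rw [ContinuousLinearMap.adjoint_inner_right, real_inner_comm, L2.inner_indicatorConstLp_one]
  rfl

section StochasticFubini

variable {X Ω : Type*} [MeasurableSpace X] [MeasurableSpace Ω] {μ : Measure X} {P : Measure Ω}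
  {D : X → ℝ} {Z : X → Ω → ℝ}

lemma setIntegral_integral_mul [SFinite μ] [SFinite P]
    (hint : Integrable (fun p : X × Ω => Z p.1 p.2 * D p.1) (μ.prod P)) (A : Set Ω) :
    ∫ ω in A, ∫ x, Z x ω * D x ∂μ ∂P = ∫ x, (∫ ω in A, Z x ω ∂P) * D x ∂μ := by
  have hA : Integrable (fun p : X × Ω => Z p.1 p.2 * D p.1) (μ.prod (P.restrict A)) :=
    hint.mono_measure (Measure.prod_mono le_rfl Measure.restrict_le_self)
  simp only [← integral_mul_const]
  exact (integral_integral_swap (f := fun x ω => Z x ω * D x) hA).symm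

variable [IsProbabilityMeasure P] {W : Type*} [NormedAddCommGroup W] [InnerProductSpace ℝ W]
  {J : W →ₗᵢ[ℝ] Lp ℝ 2 P} {φ : X → W} (hZ : ∀ᵐ x ∂μ, Z x =ᵐ[P] J (φ x))
include hZ

lemma integrable_prod_mul_of_ae_eq_isometry (hZm : Measurable (Function.uncurry Z))
    (hD : Measurable D) (hφ : Integrable (fun x => ‖φ x‖ * D x) μ) :
    Integrable (fun p : X × Ω => Z p.1 p.2 * D p.1) (μ.prod P) := by
  have hmeas : AEStronglyMeasurable (fun p : X × Ω => Z p.1 p.2 * D p.1) (μ.prod P) :=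
    (hZm.mul (hD.comp measurable_fst)).aestronglyMeasurable
  rw [integrable_prod_iff hmeas]
  constructor
  · filter_upwards [hZ] with x hx
    exact (((Lp.memLp _).integrable one_le_two).congr hx.symm).mul_const _
  · refine hφ.norm.mono' hmeas.norm.integral_prod_right' ?_
    filter_upwards [hZ] with x hx
    rw [Real.norm_of_nonneg (integral_nonneg fun _ => norm_nonneg _)]
    calc ∫ ω, ‖Z x ω * D x‖ ∂P = (∫ ω, |J (φ x) ω| ∂P) * ‖D x‖ := by
          simp only [norm_mul, integral_mul_const]
          exact congrArg (· * ‖D x‖) (integral_congr_ae (hx.fun_comp abs))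
      _ ≤ ‖φ x‖ * ‖D x‖ := by
          gcongr
          exact (integral_abs_le_norm_Lp _).trans_eq (J.norm_map _)
      _ = ‖‖φ x‖ * D x‖ := by rw [norm_mul, norm_norm]

lemma setIntegral_integral_mul_of_ae_eq_isometry [SFinite μ] [CompleteSpace W]
    (hint : Integrable (fun p : X × Ω => Z p.1 p.2 * D p.1) (μ.prod P))
    {A : Set Ω} (hA : MeasurableSet A) :
    ∫ ω in A, ∫ x, Z x ω * D x ∂μ ∂P =
      ∫ x, inner ℝ (φ x) (J.toContinuousLinearMap.adjoint
        (indicatorConstLp 2 hA (measure_ne_top P A) 1)) * D x ∂μ := by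
  rw [setIntegral_integral_mul hint]
  refine integral_congr_ae (hZ.mono fun x hx => ?_)
  beta_reduce
  rw [← setIntegral_isometry, setIntegral_congr_ae hA (hx.mono fun ω h _ => h)]

end StochasticFubini

lemma norm_stepLp_sub {T s t : ℝ} (hs : s ∈ Icc 0 T) (ht : t ∈ Icc 0 T) (hst : s ≤ t) :
    ‖stepLp T t - stepLp T s‖ = (t - s) ^ (1 / 2 : ℝ) := by
  rw [← Real.sqrt_eq_rpow, ← norm_stepLp_sub_sq_of_mem hs ht hst, Real.sqrt_sq (norm_nonneg _)]

lemma norm_stepLp {T t : ℝ} (ht : t ∈ Icc 0 T) : ‖stepLp T t‖ = t ^ (1 / 2 : ℝ) := by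
  simpa only [stepLp_zero, sub_zero] using norm_stepLp_sub ⟨le_rfl, ht.1.trans ht.2⟩ ht ht.1

lemma volterraLp_zero {H T : ℝ} (hH0 : 0 < H) (hH1 : H < 1 / 2) (h0 : (0 : ℝ) ∈ Icc 0 T) :
    volterraLp hH0 hH1 T ⟨0, h0⟩ = 0 := by
  rw [← inner_self_eq_zero (𝕜 := ℝ), inner_volterraLp_left]
  simp only [volterraK, Ioo_self, indicator_empty, zero_mul, integral_zero]

section Representation

variable {Ω : Type*} [MeasurableSpace Ω] {P : Measure Ω}

lemma ae_eqOn_of_forall_ae_eq {E F : Type*} [PseudoMetricSpace E]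
    [TopologicalSpace.SeparableSpace E] [TopologicalSpace F] [T2Space F] {S : Set E}
    {Y Z : E → Ω → F} (hY : ∀ᵐ ω ∂P, ContinuousOn (fun t => Y t ω) S)
    (hZ : ∀ᵐ ω ∂P, ContinuousOn (fun t => Z t ω) S) (h : ∀ t ∈ S, Y t =ᵐ[P] Z t) :
    ∀ᵐ ω ∂P, EqOn (fun t => Y t ω) (fun t => Z t ω) S := by
  obtain ⟨c, hcS, hc, hSc⟩ :=
    (TopologicalSpace.IsSeparable.of_separableSpace S).exists_countable_dense_subset
  filter_upwards [hY, hZ, (ae_ball_iff hc).2 fun t ht => h t (hcS ht)] with ω hYω hZω heq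
  exact EqOn.of_subset_closure heq hYω hZω hcS hSc

lemma ae_continuousOn_fracOp {H T : ℝ} (hH0 : 0 < H) (hH1 : H < 1 / 2) (hT : 0 < T)
    {B : ℝ → Ω → ℝ} (hB : ∀ᵐ ω ∂P, ∀ lam : ℝ, 0 < lam → lam < 1 / 2 →
      MemHolderZero lam T (fun t => B t ω)) :
    ∀ᵐ ω ∂P, ContinuousOn (fracOp H fun s => B s ω) (Icc 0 T) := by
  obtain ⟨lam, hlam, hlam'⟩ := exists_between (show 1 / 2 - H < 1 / 2 by linarith)
  obtain ⟨C, hC⟩ := fracOp_bounded_linear hH0 hH1 hlam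
  exact hB.mono fun ω hω => (hC T hT _ (hω lam (by linarith) hlam')).2.1

variable [IsProbabilityMeasure P]

-- Both sides are integrable, so it suffices to compare their integrals over every event `A`, where
-- Fubini's theorem turns `fracOp` into the pairing of the Volterra kernel with `I† 1_A`.
theorem fracOp_ae_eq_isometry_volterraLp {H T : ℝ} (hH0 : 0 < H) (hH1 : H < 1 / 2)
    {I : Lp ℝ 2 (volume.restrict (Ioo 0 T)) →ₗᵢ[ℝ] Lp ℝ 2 P} {B : ℝ → Ω → ℝ}
    (hBm : ∀ t, Measurable (B t)) (hBc : ∀ ω, Continuous fun t => B t ω)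
    (hBI : ∀ t ∈ Icc 0 T, B t =ᵐ[P] I (stepLp T t)) {t : ℝ} (ht : t ∈ Icc 0 T) :
    (fun ω => fracOp H (fun s => B s ω) t) =ᵐ[P] I (volterraLp hH0 hH1 T ⟨t, ht⟩) := by
  rcases ht.1.eq_or_lt with rfl | ht0
  · simp only [fracOp_zero, volterraLp_zero, map_zero]
    exact (Lp.coeFn_zero ℝ 2 P).symm
  have hB : Measurable (Function.uncurry B) :=
    measurable_uncurry_of_continuous_of_measurable hBc hBm
  have hhalf : 1 / 2 - H < 1 / 2 := by linarith
  have hmem {s : ℝ} (hs : s ∈ Ioo 0 t) : s ∈ Icc 0 T := ⟨hs.1.le, hs.2.le.trans ht.2⟩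
  have hval : ∀ᵐ s ∂volume.restrict (Ioo 0 t), B s =ᵐ[P] I (stepLp T s) :=
    ae_restrict_of_forall_mem measurableSet_Ioo fun s hs => hBI s (hmem hs)
  have hincr : ∀ᵐ s ∂volume.restrict (Ioo 0 t),
      (fun ω => B t ω - B s ω) =ᵐ[P] I (stepLp T t - stepLp T s) :=
    hval.mono fun s hs => ((hBI t ht).sub hs).trans (coeFn_isometry_sub I _ _)
  have hint₁ := integrable_prod_mul_of_ae_eq_isometry hincr
    (((hBm t).comp measurable_snd).sub hB) (measurable_kernelOneDeriv H t) <|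
      (integrableOn_kernelOneDeriv hH0 hH1 hhalf ht0).congr_fun (fun s hs => by
        rw [norm_stepLp_sub (hmem hs) ht hs.2.le]) measurableSet_Ioo
  have hint₂ := integrable_prod_mul_of_ae_eq_isometry hval hB
    (measurable_kernelTwoNegDeriv hH0 hH1 t) <|
      (integrableOn_kernelTwoNegDeriv hH0 hH1 hhalf ht0).congr_fun (fun s hs => by
        rw [norm_stepLp (hmem hs)]) measurableSet_Ioo
  simp only [fracOp_eq hH0 hH1 ht0]
  refine Integrable.ae_eq_of_forall_setIntegral_eq _ _
    (hint₁.integral_prod_right.add hint₂.integral_prod_right)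
    ((Lp.memLp _).integrable one_le_two) fun A hA _ => ?_
  rw [integral_add hint₁.integral_prod_right.integrableOn hint₂.integral_prod_right.integrableOn,
    setIntegral_integral_mul_of_ae_eq_isometry hincr hint₁ hA,
    setIntegral_integral_mul_of_ae_eq_isometry hval hint₂ hA,
    setIntegral_inner_stepLp_add hH0 hH1 ht, setIntegral_isometry]

lemma IsFracBrownianOn.exists_isBrownianOn {H T : ℝ} (hH0 : 0 < H) (hH1 : H < 1 / 2) (hT : 0 < T)
    {X : ℝ → Ω → ℝ} (hX : IsFracBrownianOn H T X P) :
    ∃ B : ℝ → Ω → ℝ, IsBrownianOn T B P ∧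
      (∀ᵐ ω ∂P, ∀ lam : ℝ, 0 < lam → lam < 1 / 2 → MemHolderZero lam T (fun t => B t ω)) ∧
      ∀ t ∈ Icc 0 T, X t =ᵐ[P] fun ω => fracOp H (fun s => B s ω) t := by
  obtain ⟨I, hI, hIX⟩ := exists_isonormal_of_isFracBrownianOn hH0 hH1 hX
  obtain ⟨B, hBm, hBc, hB, hHolder, hBI⟩ := hI.exists_isBrownianOn hT
  exact ⟨B, hB, hHolder, fun t ht => (hIX ⟨t, ht⟩).symm.trans
    (fracOp_ae_eq_isometry_volterraLp hH0 hH1 hBm hBc hBI ht).symm⟩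

end Representation

theorem theorem2p1_general (H : ℝ) (hH0 : 0 < H) (hH1 : H < 1 / 2) :
    (∀ lam : ℝ, 1 / 2 - H < lam →
      ∃ C : ℝ, ∀ T : ℝ, 0 < T → ∀ f : ℝ → ℝ, MemHolderZero lam T f →
        (∀ t ∈ Icc 0 T, FracOpConverges H f t) ∧
        ContinuousOn (fracOp H f) (Icc 0 T) ∧
        (∀ t ∈ Icc 0 T, |fracOp H f t| ≤ C * T ^ (H - 1 / 2 + lam) * holderNorm lam T f) ∧
        (∀ g : ℝ → ℝ, MemHolderZero lam T g → ∀ a b : ℝ, ∀ t ∈ Icc 0 T,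
          fracOp H (fun s => a * f s + b * g s) t = a * fracOp H f t + b * fracOp H g t)) ∧
    (∀ T : ℝ, 0 < T → ∀ (Ω : Type*) [MeasurableSpace Ω] (P : Measure Ω) [IsProbabilityMeasure P]
      (X : ℝ → Ω → ℝ), IsFracBrownianOn H T X P →
      ∃ B : ℝ → Ω → ℝ, IsBrownianOn T B P ∧
        (∀ᵐ ω ∂P, ∀ lam : ℝ, 0 < lam → lam < 1 / 2 → MemHolderZero lam T (fun t => B t ω)) ∧
        (∀ t ∈ Icc 0 T, ∀ᵐ ω ∂P, X t ω = fracOp H (fun s => B s ω) t) ∧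
        ((∀ᵐ ω ∂P, ContinuousOn (fun t => X t ω) (Icc 0 T)) →
          ∀ᵐ ω ∂P, ∀ t ∈ Icc 0 T, X t ω = fracOp H (fun s => B s ω) t)) := by
  refine ⟨fun lam hlam => fracOp_bounded_linear hH0 hH1 hlam, fun T hT Ω _ P _ X hX => ?_⟩
  obtain ⟨B, hB, hHolder, hrep⟩ := hX.exists_isBrownianOn hH0 hH1 hT
  exact ⟨B, hB, hHolder, hrep, fun hXc =>
    ae_eqOn_of_forall_ae_eq hXc (ae_continuousOn_fracOp hH0 hH1 hT hHolder) hrep⟩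

end

theorem theorem2p1 (H : ℝ) (hH0 : 0 < H) (hH1 : H < 1 / 2) :
    -- `Λ_H` is a bounded linear operator from `C_0^lam` to the continuous functions on `[0,T]`
    (∀ lam : ℝ, 1 / 2 - H < lam → lam < 1 / 2 →
      ∃ C : ℝ, ∀ T : ℝ, 0 < T → ∀ f : ℝ → ℝ, MemHolderZero lam T f →
        (∀ t ∈ Icc 0 T, FracOpConverges H f t) ∧
        ContinuousOn (fracOp H f) (Icc 0 T) ∧
        (∀ t ∈ Icc 0 T, |fracOp H f t| ≤ C * T ^ (H - 1 / 2 + lam) * holderNorm lam T f) ∧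
        (∀ g : ℝ → ℝ, MemHolderZero lam T g → ∀ a b : ℝ, ∀ t ∈ Icc 0 T,
          fracOp H (fun s => a * f s + b * g s) t = a * fracOp H f t + b * fracOp H g t)) ∧
    -- every fractional Brownian motion on `[0,T]` is the image under `Λ_H` of a Brownian motion
    (∀ T : ℝ, 0 < T → ∀ (Ω : Type*) [MeasurableSpace Ω] (P : Measure Ω) [IsProbabilityMeasure P]
      (X : ℝ → Ω → ℝ), IsFracBrownianOn H T X P →
      ∃ B : ℝ → Ω → ℝ, IsBrownianOn T B P ∧
        (∀ᵐ ω ∂P, ∀ lam : ℝ, 1 / 2 - H < lam → lam < 1 / 2 →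
          MemHolderZero lam T (fun t => B t ω)) ∧
        (∀ t ∈ Icc 0 T, ∀ᵐ ω ∂P, X t ω = fracOp H (fun s => B s ω) t) ∧
        ((∀ᵐ ω ∂P, ContinuousOn (fun t => X t ω) (Icc 0 T)) →
          ∀ᵐ ω ∂P, ∀ t ∈ Icc 0 T, X t ω = fracOp H (fun s => B s ω) t)) := by
  obtain ⟨hbound, hrep⟩ := theorem2p1_general H hH0 hH1
  refine ⟨fun lam hlam _ => hbound lam hlam, fun T hT Ω _ P _ X hX => ?_⟩
  obtain ⟨B, hB, hHolder, hX⟩ := hrep T hT Ω P X hX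
  exact ⟨B, hB, hHolder.mono fun ω h lam hlam => h lam (by linarith), hX⟩
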